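/- Let $G$ be a finite simple connected graph with at least two vertices. Let $\mathcal S(G)$ be the set of complex Hermitian matrices $B=(b_{uv})$ indexed by $V(G)$ such that, for $u\ne v$, $b_{uv}\neq 0$ if and only if $u\sim v$ (the diagonal is arbitrary). For an induced subgraph $H$ of $G$, let $B(H)$ be the principal submatrix of $B$ on $V(H)$, let $\sigma(B(H))$ be its set of eigenvalues, and let $m_B(H,\lambda)$ be the multiplicity of $\lambda$ as an eigenvalue of $B(H)$ ($0$ if it is not one). Let $\theta(H)=|E(H)|-|V(H)|+\omega(H)$, where $\omega(H)$ is the number of connected components, and let $p(H)$ be the number of pendant vertices (vertices of degree $1$). A major vertex is a vertex of degree at least $3$ and a cycle-vertex is a vertex lying on a cycle. Let $\mathcal X(G)$ be the set of major vertices of $G$, and $\mathcal M(G)$ the set of major vertices of $G$ that are not cycle-vertices. Let $\mathcal U$ be the set of connected graphs $H$ with $\theta(H)=1$ and $p(H)\le 1$. An $\infty$-graph consists of two cycles joined at one vertex each by a path, so that the cycles are vertex-disjoint and the path is otherwise disjoint from them; the path may have length $0$, and then the two cycles share exactly one vertex. A $\theta$-graph is the union of three internally disjoint paths with the same two distinct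 end vertices, at most one of which has length $1$. A path may consist of a single vertex. Let $B\in\mathcal S(G)$ and let $\lambda$ be an eigenvalue of $B$. Then $$m_B(G,\lambda)=2\theta(G)+p(G)-1$$ if and only if one of the following holds. (a) $G$ is a path; or $G$ is a tree with $p(G)\ge 3$ such that $\lambda\in\sigma(B(P))$ for every component $P$ (necessarily a path) of $G-\mathcal X(G)$ and no two vertices of $\mathcal X(G)$ are adjacent. (b) $G$ is a cycle and $m_B(G,\lambda)=1$; or $G\in\mathcal U$ is not a cycle and $m_B(G,\lambda)=2$. (c) $G$ is an $\infty$-graph or a $\theta$-graph, and $m_B(G-y,\lambda)=m_B(G,\lambda)-1=2$ for every cycle-vertex $y$ of degree $2$ that is adjacent to a major vertex of $G$; moreover, if $G$ is a $\theta$-graph, then $m_B(G-x,\lambda)=2$ for every $x\in\mathcal X(G)$. (d) $\mathcal M(G)\neq\varnothing$, $\theta(G)\ge 1$, every cycle of $G$ contains exactly one major vertex and that vertex has degree $3$, no two vertices of $\mathcal M(G)$ are adjacent, and the components of $G-\mathcal M(G)$ are $C^*_1,\dots,C^*_{\theta(G)}\in\mathcal U$ and paths $P^1,\dots,P^l$ ($l\ge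 0$), with $m_B(C^*_j,\lambda)=2$ for $1\le j\le\theta(G)$ and $\lambda\in\sigma(B(P^i))$ for $1\le i\le l$. -/

import Mathlib

namespace HermitianGraph

section Spectral

/-- `B ∈ 𝒮(G)`: `B` is a complex Hermitian matrix indexed by the vertices of `G` whose nonzero
off-diagonal entries are exactly those at adjacent pairs; the diagonal is unrestricted. -/
def IsMatrixOf {V : Type*} (G : SimpleGraph V) (B : Matrix V V ℂ) : Prop :=
  B.IsHermitian ∧ ∀ i j, i ≠ j → (B i j ≠ 0 ↔ G.Adj i j)

/-- The linear operator `x ↦ B x` on `V → ℂ`. -/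
noncomputable def op {V : Type*} [Finite V] (B : Matrix V V ℂ) : (V → ℂ) →ₗ[ℂ] (V → ℂ) :=
  letI := Fintype.ofFinite V
  B.mulVecLin

/-- `μ` is an eigenvalue of `B`. -/
def IsEig {V : Type*} [Finite V] (B : Matrix V V ℂ) (μ : ℂ) : Prop :=
  Module.End.HasEigenvalue (op B) μ

/-- The multiplicity of `μ` as an eigenvalue of `B`: the dimension of the eigenspace
(for a Hermitian matrix this is also the algebraic multiplicity). It is `0` when `μ` is not an
eigenvalue. -/
noncomputable def mult {V : Type*} [Finite V] (B : Matrix V V ℂ) (μ : ℂ) : ℕ :=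
  Module.finrank ℂ (Module.End.eigenspace (op B) μ)

/-- The principal submatrix of `B` retaining the rows and columns in `s`. -/
def restrict {V : Type*} (B : Matrix V V ℂ) (s : Set V) : Matrix s s ℂ :=
  B.submatrix Subtype.val Subtype.val

end Spectral

section Graphs

/-- The degree of a vertex (of a finite graph). -/
noncomputable def deg {V : Type*} (G : SimpleGraph V) (v : V) : ℕ := (G.neighborSet v).ncard

/-- `p(G)`, the number of pendant vertices. -/
noncomputable def pendantCount {V : Type*} (G : SimpleGraph V) : ℕ := {v | deg G v = 1}.ncard

/-- The cyclomatic number `θ(G) = |E(G)| - |V(G)| + ω(G)`, computed in `ℤ`. -/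
noncomputable def cyclomatic {V : Type*} (G : SimpleGraph V) : ℤ :=
  (G.edgeSet.ncard : ℤ) - (Nat.card V : ℤ) + (Nat.card G.ConnectedComponent : ℤ)

/-- `𝒳(G)`, the set of major vertices. -/
def majorSet {V : Type*} (G : SimpleGraph V) : Set V := {v | 3 ≤ deg G v}

/-- `v` lies on a cycle of `G`. -/
def IsCycleVertex {V : Type*} (G : SimpleGraph V) (v : V) : Prop :=
  ∃ c : G.Walk v v, c.IsCycle

/-- `ℳ(G)`, the set of major vertices that lie on no cycle. -/
def offCycleMajorSet {V : Type*} (G : SimpleGraph V) : Set V :=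
  {v | v ∈ majorSet G ∧ ¬ IsCycleVertex G v}

/-- `G` is a path with at least one vertex. -/
def IsPathGraph {V : Type*} (G : SimpleGraph V) : Prop :=
  ∃ n : ℕ, 1 ≤ n ∧ Nonempty (G ≃g SimpleGraph.pathGraph n)

/-- `G` is a cycle `C_n`, `n ≥ 3`. -/
def IsCycleGraph {V : Type*} (G : SimpleGraph V) : Prop :=
  ∃ n : ℕ, 3 ≤ n ∧ Nonempty (G ≃g SimpleGraph.cycleGraph n)

/-- `G ∈ 𝒰`: `G` is a unicyclic (connected, cyclomatic number one) graph with at most one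
pendant vertex. -/
def InU {V : Type*} (G : SimpleGraph V) : Prop :=
  G.Connected ∧ cyclomatic G = 1 ∧ pendantCount G ≤ 1

/-- `G` is an `∞`-graph: two cycles `c₁`, `c₂` together with a path `w` (possibly of length zero)
from a vertex `a` of `c₁` to a vertex `b` of `c₂`; the path meets `c₁` only in `a` and `c₂` only in
`b`, and a vertex common to both cycles is `a = b`. So the cycles are vertex-disjoint when the path
has positive length and share exactly one vertex when it has length zero. -/
def IsInfinityGraph {V : Type*} (G : SimpleGraph V) : Prop :=
  ∃ (a b : V) (c₁ : G.Walk a a) (c₂ : G.Walk b b) (w : G.Walk a b),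
    c₁.IsCycle ∧ c₂.IsCycle ∧ w.IsPath ∧
    (∀ v, v ∈ c₁.support → v ∈ w.support → v = a) ∧
    (∀ v, v ∈ c₂.support → v ∈ w.support → v = b) ∧
    (∀ v, v ∈ c₁.support → v ∈ c₂.support → v = a ∧ v = b) ∧
    (∀ v, v ∈ c₁.support ∨ v ∈ c₂.support ∨ v ∈ w.support) ∧
    (∀ e, e ∈ G.edgeSet → e ∈ c₁.edges ∨ e ∈ c₂.edges ∨ e ∈ w.edges)

/-- `G` is a `θ`-graph: the union of three internally disjoint paths with common distinct end
vertices, at most one of which has length one. -/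
def IsThetaGraph {V : Type*} (G : SimpleGraph V) : Prop :=
  ∃ (a b : V) (w : Fin 3 → G.Walk a b),
    a ≠ b ∧ (∀ i, (w i).IsPath) ∧
    (∀ i j, i ≠ j → ∀ v, v ∈ (w i).support → v ∈ (w j).support → v = a ∨ v = b) ∧
    (∀ i j, i ≠ j → ¬ ((w i).length = 1 ∧ (w j).length = 1)) ∧
    (∀ v, ∃ i, v ∈ (w i).support) ∧
    (∀ e, e ∈ G.edgeSet → ∃ i, e ∈ (w i).edges)

end Graphs

section Forms

/-- Form (a): a path, or a tree with at least three pendant vertices such that `μ` is an eigenvalue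
of every component (a path) left after deleting all major vertices, and no two major vertices are
adjacent. -/
def FormA {V : Type*} [Finite V] (G : SimpleGraph V) (B : Matrix V V ℂ) (μ : ℂ) : Prop :=
  IsPathGraph G ∨
  (G.IsTree ∧ 3 ≤ pendantCount G ∧
    (∀ K : (G.induce (majorSet G)ᶜ).ConnectedComponent,
      IsEig (restrict (restrict B (majorSet G)ᶜ) K.supp) μ) ∧
    (∀ u ∈ majorSet G, ∀ v ∈ majorSet G, ¬ G.Adj u v))

/-- Form (b): a cycle with multiplicity `1`, or a member of `𝒰` that is not a cycle, with
multiplicity `2`. -/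
def FormB {V : Type*} [Finite V] (G : SimpleGraph V) (B : Matrix V V ℂ) (μ : ℂ) : Prop :=
  (IsCycleGraph G ∧ mult B μ = 1) ∨ (InU G ∧ ¬ IsCycleGraph G ∧ mult B μ = 2)

/-- Form (c): an `∞`-graph or a `θ`-graph such that deleting any cycle-vertex of degree two adjacent
to a major vertex lowers the multiplicity by one, to `2`; and, for a `θ`-graph, deleting any major
vertex also leaves multiplicity `2`. -/
def FormC {V : Type*} [Finite V] (G : SimpleGraph V) (B : Matrix V V ℂ) (μ : ℂ) : Prop :=
  (IsInfinityGraph G ∨ IsThetaGraph G) ∧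
  (∀ y, IsCycleVertex G y → deg G y = 2 → (∃ x ∈ majorSet G, G.Adj y x) →
    mult (restrict B {y}ᶜ) μ + 1 = mult B μ ∧ mult (restrict B {y}ᶜ) μ = 2) ∧
  (IsThetaGraph G → ∀ x ∈ majorSet G, mult (restrict B {x}ᶜ) μ = 2)

/-- Form (d): `ℳ(G)` is nonempty, `θ(G) ≥ 1`, each cycle has exactly one major vertex, which has
degree three, no two vertices of `ℳ(G)` are adjacent, and of the components of `G - ℳ(G)` exactly
`θ(G)` are in `𝒰`, each of these with multiplicity `2`, all the others being paths with `μ` as an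
eigenvalue. -/
def FormD {V : Type*} [Finite V] (G : SimpleGraph V) (B : Matrix V V ℂ) (μ : ℂ) : Prop :=
  (offCycleMajorSet G).Nonempty ∧ 1 ≤ cyclomatic G ∧
  (∀ (v : V) (c : G.Walk v v), c.IsCycle →
    (∃! x, x ∈ c.support ∧ x ∈ majorSet G) ∧
    ∀ x, x ∈ c.support → x ∈ majorSet G → deg G x = 3) ∧
  (∀ u ∈ offCycleMajorSet G, ∀ v ∈ offCycleMajorSet G, ¬ G.Adj u v) ∧
  ({K : (G.induce (offCycleMajorSet G)ᶜ).ConnectedComponent | InU K.toSimpleGraph}.ncard : ℤ)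
    = cyclomatic G ∧
  (∀ K : (G.induce (offCycleMajorSet G)ᶜ).ConnectedComponent,
    (InU K.toSimpleGraph ∧
      mult (restrict (restrict B (offCycleMajorSet G)ᶜ) K.supp) μ = 2) ∨
    (IsPathGraph K.toSimpleGraph ∧
      IsEig (restrict (restrict B (offCycleMajorSet G)ᶜ) K.supp) μ))

end Forms

end HermitianGraph

namespace HermitianGraph

open scoped Classical

set_option linter.unusedSectionVars false

/-! ### Eigenvectors with prescribed zeros, and the effect of deleting a vertex -/

section SolutionSpaces

variable {V : Type*} [Fintype V]

/-! In a connected graph with at least two vertices, deg v + [deg v = 1] = 2 + max(deg v - 2, 0) for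
every v. Summing over v gives 2θ + p - 1 = 1 + `majorExcess`, where `majorExcess` is the sum of
max(deg v - 2, 0). So the theorem describes when the multiplicity m equals 1 + `majorExcess`
(`mult_eq_iff_extremal`).

Upper bounds come from zero forcing. If an eigenvector vanishes at w, its equation at w is a linear
relation among the values at the neighbours of w. Making all of these zero therefore costs at most
one dimension less than their number, and w can then be discarded. On a connected set this gives m ≤
1 + `excess` from a single zero (`ConnSet.solDim_le_root`), with one dimension saved for each
further zero (`ConnSet.solDim_le`).

Now delete a major vertex x. Either m rises (here Hermitian symmetry and a real eigenvalue are
needed), and the rooted bounds of the components add up to m ≤ 1 + `majorExcess`, with equality only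
if x separates all its neighbours. Or every eigenvector of the remainder satisfies the equation at
x. Each component then inherits a linear relation, so the bound again holds, and equality leaves
only one or two components of a rigid kind (`comps_of_extremal`).

The equality case splits according to the major vertices lying on no cycle. If there are none but
some major vertex exists, the rigid alternatives and a count of private cycles force either θ = 1, p
= 1 or θ = 2, p = 0: forms (b) and (c) (`ConnSet.extremal_of_cycAt`). Otherwise an off-cycle major
vertex is joined to each component by a bridge, and each component is extremal again with an end
vertex at the bridge, or is a cycle of multiplicity two. Induction gives the paths and unicyclic
pieces of (a) and (d) (`ConnSet.goodComp_of_extremal`). Without major vertices the graph is a path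
or a cycle.

Conversely, in (b) and (c) the multiplicity is given and only degrees are counted. In (a) and (d),
interlacing over an independent set of deleted vertices gives the lower bound
(`le_solDim_of_independent`) that meets the general upper bound. -/

/-- Number of neighbours of `v` inside `S`. -/
noncomputable def degIn (G : SimpleGraph V) (S : Finset V) (v : V) : ℕ := (S.filter (G.Adj v)).card

/-- Vectors supported on `S`, vanishing on `W`, and satisfying the eigenvalue equation of the
principal submatrix on `S`. -/
def solSpace (B : Matrix V V ℂ) (μ : ℂ) (S W : Finset V) : Submodule ℂ (V → ℂ) where
  carrier := {z | (∀ v ∉ S, z v = 0) ∧ (∀ v ∈ W, z v = 0) ∧ ∀ v ∈ S, ∑ u, B v u * z u = μ * z v}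
  add_mem' := by
    rintro a b ⟨h1, h2, h3⟩ ⟨k1, k2, k3⟩
    refine ⟨fun v hv => by simp [h1 v hv, k1 v hv], fun v hv => by simp [h2 v hv, k2 v hv],
      fun v hv => ?_⟩
    simp only [Pi.add_apply, mul_add, Finset.sum_add_distrib, h3 v hv, k3 v hv]
  zero_mem' := by simp
  smul_mem' := by
    rintro c a ⟨h1, h2, h3⟩
    refine ⟨fun v hv => by simp [h1 v hv], fun v hv => by simp [h2 v hv], fun v hv => ?_⟩
    simp only [Pi.smul_apply, smul_eq_mul]
    rw [mul_left_comm μ, ← h3 v hv, Finset.mul_sum]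
    exact Finset.sum_congr rfl fun u _ => by ring

/-- The multiplicity of `μ` for the principal submatrix on `S`. -/
noncomputable def solDim (B : Matrix V V ℂ) (μ : ℂ) (S W : Finset V) : ℕ :=
  Module.finrank ℂ (solSpace B μ S W)

theorem finrank_le_finrank_inf_ker_add_one (E : Submodule ℂ (V → ℂ)) (f : (V → ℂ) →ₗ[ℂ] ℂ) :
    Module.finrank ℂ E ≤ Module.finrank ℂ (E ⊓ LinearMap.ker f : Submodule ℂ (V → ℂ)) + 1 := by
  have h := LinearMap.finrank_range_add_finrank_ker (f.domRestrict E)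
  have h1 : Module.finrank ℂ (LinearMap.range (f.domRestrict E)) ≤ 1 := by
    simpa using Submodule.finrank_le (LinearMap.range (f.domRestrict E))
  have h2 : LinearMap.ker (f.domRestrict E) = (LinearMap.ker f).comap E.subtype := rfl
  have h3 : Module.finrank ℂ ((LinearMap.ker f).comap E.subtype) =
      Module.finrank ℂ (E ⊓ LinearMap.ker f : Submodule ℂ (V → ℂ)) := by
    rw [← Submodule.map_comap_subtype, Submodule.finrank_map_subtype_eq]
  rw [h2, h3] at h
  omega

theorem solDim_mono {B : Matrix V V ℂ} {μ : ℂ} {S W S' W' : Finset V}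
    (h : solSpace B μ S W ≤ solSpace B μ S' W') : solDim B μ S W ≤ solDim B μ S' W' :=
  Submodule.finrank_mono h

theorem solSpace_anti_right {B : Matrix V V ℂ} {μ : ℂ} {S W W' : Finset V} (h : W ⊆ W') :
    solSpace B μ S W' ≤ solSpace B μ S W :=
  fun _ hz => ⟨hz.1, fun v hv => hz.2.1 v (h hv), hz.2.2⟩

theorem solDim_le_add_one (B : Matrix V V ℂ) (μ : ℂ) (S W : Finset V) (u : V) :
    solDim B μ S W ≤ solDim B μ S (insert u W) + 1 := by
  refine (finrank_le_finrank_inf_ker_add_one _ (LinearMap.proj u)).trans ?_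
  gcongr
  apply Submodule.finrank_mono
  rintro z ⟨hz, hu⟩
  refine ⟨hz.1, fun v hv => ?_, hz.2.2⟩
  rcases Finset.mem_insert.1 hv with rfl | hv
  · simpa using hu
  · exact hz.2.1 v hv

theorem solDim_le_card_add (B : Matrix V V ℂ) (μ : ℂ) (S W D : Finset V) :
    solDim B μ S W ≤ D.card + solDim B μ S (W ∪ D) := by
  induction D using Finset.induction_on with
  | empty => simp
  | insert u D hu ih =>
    rw [Finset.card_insert_of_notMem hu, Finset.union_insert]
    have := solDim_le_add_one B μ S (W ∪ D) u
    omega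

/-- Once all vertices of `D` but one are zero, the relation makes the last one zero as well. This
saved dimension is the source of every sharp bound below. -/
theorem solDim_le_card_sub_one_add (B : Matrix V V ℂ) (μ : ℂ) (S W D : Finset V) (c : V → ℂ)
    (hc : ∀ u ∈ D, c u ≠ 0) (h : ∀ z ∈ solSpace B μ S W, ∑ u ∈ D, c u * z u = 0) :
    solDim B μ S W ≤ (D.card - 1) + solDim B μ S (W ∪ D) := by
  rcases D.eq_empty_or_nonempty with rfl | ⟨u, hu⟩
  · simp
  have h1 := solDim_le_card_add B μ S W (D.erase u)
  rw [Finset.card_erase_of_mem hu] at h1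
  refine h1.trans ?_
  gcongr
  apply Submodule.finrank_mono
  intro z hz
  have hz0 : z ∈ solSpace B μ S W := solSpace_anti_right Finset.subset_union_left hz
  refine ⟨hz.1, fun v hv => ?_, hz.2.2⟩
  by_cases hvu : v = u
  · subst hvu
    have := h z hz0
    rw [← Finset.add_sum_erase D _ hu, Finset.sum_eq_zero, add_zero] at this
    · exact (mul_eq_zero.1 this).resolve_left (hc _ hu)
    · intro x hx
      rw [hz.2.1 x (Finset.mem_union_right _ hx), mul_zero]
  · refine hz.2.1 v ?_
    rcases Finset.mem_union.1 hv with hv | hv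
    · exact Finset.mem_union_left _ hv
    · exact Finset.mem_union_right _ (Finset.mem_erase.2 ⟨hvu, hv⟩)

variable {G : SimpleGraph V} {B : Matrix V V ℂ} {μ : ℂ}

theorem IsMatrixOf.apply_ne_zero (hB : IsMatrixOf G B) {u v : V} (h : G.Adj u v) : B u v ≠ 0 :=
  (hB.2 u v h.ne).2 h

theorem IsMatrixOf.apply_eq_zero (hB : IsMatrixOf G B) {u v : V} (hne : u ≠ v) (h : ¬ G.Adj u v) :
    B u v = 0 := by
  by_contra h0
  exact h ((hB.2 u v hne).1 h0)

/-- A row sum against a vector supported on `S` only sees the neighbours in `S`. -/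
theorem IsMatrixOf.sum_row (hB : IsMatrixOf G B) {S : Finset V} {z : V → ℂ} {w : V}
    (hz : ∀ v ∉ S, z v = 0) (hw : z w = 0) :
    ∑ u, B w u * z u = ∑ u ∈ S.filter (G.Adj w), B w u * z u := by
  symm
  apply Finset.sum_subset (Finset.subset_univ _)
  intro u _ hu
  by_cases hS : u ∈ S
  · have : ¬ G.Adj w u := fun h => hu (Finset.mem_filter.2 ⟨hS, h⟩)
    by_cases hwu : w = u
    · subst hwu; simp [hw]
    · rw [hB.apply_eq_zero hwu this, zero_mul]
  · rw [hz u hS, mul_zero]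

theorem solSpace_erase (S W : Finset V) (x : V) (hx : x ∈ W) :
    solSpace B μ S W ≤ solSpace B μ (S.erase x) (W.erase x) := by
  intro z hz
  refine ⟨fun v hv => ?_, fun v hv => hz.2.1 v (Finset.mem_of_mem_erase hv),
    fun v hv => hz.2.2 v (Finset.mem_of_mem_erase hv)⟩
  by_cases hvx : v = x
  · subst hvx; exact hz.2.1 _ hx
  · exact hz.1 v fun h => hv (Finset.mem_erase.2 ⟨hvx, h⟩)

/-- Interlacing, upper half. -/
theorem solDim_le_erase_add_one (S : Finset V) (x : V) :
    solDim B μ S ∅ ≤ solDim B μ (S.erase x) ∅ + 1 := by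
  refine (solDim_le_add_one B μ S ∅ x).trans ?_
  gcongr
  refine solDim_mono ?_
  have := solSpace_erase (B := B) (μ := μ) S {x} x (by simp)
  simpa using this

/-- Interlacing, lower half. -/
theorem solDim_erase_le_add_one (S : Finset V) (x : V) :
    solDim B μ (S.erase x) ∅ ≤ solDim B μ S ∅ + 1 := by
  refine (finrank_le_finrank_inf_ker_add_one _
    ((LinearMap.proj x).comp (Matrix.mulVecLin B))).trans ?_
  refine Nat.add_le_add_right (Submodule.finrank_mono ?_) 1
  rintro z ⟨hz, hx⟩
  have hzx : z x = 0 := hz.1 x (by simp)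
  refine ⟨fun v hv => hz.1 v fun h => hv (Finset.mem_of_mem_erase h), by simp, fun v hv => ?_⟩
  by_cases hvx : v = x
  · subst hvx
    rw [hzx, mul_zero]
    simpa [Matrix.mulVec, dotProduct] using hx
  · exact hz.2.2 v (Finset.mem_erase.2 ⟨hvx, hv⟩)

/-- Deleting `x` raises the multiplicity, unless all eigenvectors of the remainder satisfy the
equation at `x`. -/
theorem solDim_add_one_le_erase_or (hB : IsMatrixOf G B) (hμ : star μ = μ) (S : Finset V) {x : V}
    (hx : x ∈ S) :
    solDim B μ S ∅ + 1 ≤ solDim B μ (S.erase x) ∅ ∨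
      ∀ y ∈ solSpace B μ (S.erase x) ∅, ∑ u ∈ S.filter (G.Adj x), B x u * y u = 0 := by
  by_cases hN : ∀ y ∈ solSpace B μ (S.erase x) ∅, ∑ u, B x u * y u = 0
  · right
    intro y hy
    rw [← hN y hy]
    refine (hB.sum_row (fun v hv => ?_) (hy.1 x (by simp))).symm
    exact hy.1 v fun h => hv (Finset.mem_of_mem_erase h)
  left
  push Not at hN
  obtain ⟨y, hy, hyx⟩ := hN
  have hyx0 : y x = 0 := hy.1 x (by simp)
  -- Pair z with y. Since B is Hermitian and μ is real, both ways of evaluating y*Bz agree except at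
  -- row x, where z x is multiplied by the conjugate of the nonzero row sum of y.
  have key : ∀ z ∈ solSpace B μ S ∅, z x = 0 := by
    intro z hz
    have hherm : ∀ u v, B u v = star (B v u) := fun u v => (hB.1.apply u v).symm
    have e1 : ∑ v, star (y v) * (∑ u, B v u * z u) = μ * ∑ v, star (y v) * z v := by
      rw [Finset.mul_sum]
      refine Finset.sum_congr rfl fun v _ => ?_
      by_cases hv : v ∈ S
      · rw [hz.2.2 v hv]; ring
      · rw [hy.1 v fun h => hv (Finset.mem_of_mem_erase h)]; simp
    have e2 : ∑ v, star (y v) * (∑ u, B v u * z u) =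
        ∑ u, star (∑ v, B u v * y v) * z u := by
      simp_rw [Finset.mul_sum, star_sum, Finset.sum_mul]
      rw [Finset.sum_comm]
      refine Finset.sum_congr rfl fun u _ => Finset.sum_congr rfl fun v _ => ?_
      rw [hherm v u, star_mul']
      ring
    have e3 : ∑ u, star (∑ v, B u v * y v) * z u =
        star (∑ v, B x v * y v) * z x + μ * ∑ v, star (y v) * z v := by
      rw [← Finset.add_sum_erase Finset.univ _ (Finset.mem_univ x), Finset.mul_sum]
      congr 1
      rw [← Finset.add_sum_erase Finset.univ (fun v => μ * (star (y v) * z v)) (Finset.mem_univ x),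
        hyx0, star_zero, zero_mul, mul_zero, zero_add]
      refine Finset.sum_congr rfl fun u hu => ?_
      have hux := Finset.ne_of_mem_erase hu
      by_cases hv : u ∈ S
      · rw [hy.2.2 u (Finset.mem_erase.2 ⟨hux, hv⟩), star_mul', hμ]; ring
      · rw [hz.1 u hv]; simp
    have e4 : star (∑ v, B x v * y v) * z x = 0 := by
      have := e1.symm.trans (e2.trans e3)
      simpa using this
    exact (mul_eq_zero.1 e4).resolve_left (star_ne_zero.2 hyx)
  -- All solutions on `S` vanish at x, hence are solutions on the remainder. The vector y shows
  -- strictness: it vanishes at x but fails the equation there.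
  have hle : solSpace B μ S ∅ < solSpace B μ (S.erase x) ∅ := by
    refine lt_of_le_of_ne (fun z hz => ⟨fun v hv => ?_, by simp, fun v hv =>
      hz.2.2 v (Finset.mem_of_mem_erase hv)⟩) fun h => ?_
    · by_cases hvx : v = x
      · subst hvx; exact key z hz
      · exact hz.1 v fun h => hv (Finset.mem_erase.2 ⟨hvx, h⟩)
    · rw [← h] at hy
      apply hyx
      rw [hy.2.2 x hx, hyx0, mul_zero]
  exact Submodule.finrank_lt_finrank_of_lt hle

end SolutionSpaces

/-! ### Connected vertex sets, components and degree counts -/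

section VertexSets

variable {V : Type*} [Fintype V] (G : SimpleGraph V)

/-- `C` is a union of connected components of the graph induced on `S ⊇ C`. -/
def ClosedIn (C S : Finset V) : Prop := ∀ a ∈ C, ∀ b ∈ S, G.Adj a b → b ∈ C

/-- The graph induced on `S` is connected. -/
def ConnSet (S : Finset V) : Prop :=
  S.Nonempty ∧ ∀ C ⊆ S, C.Nonempty → ClosedIn G C S → C = S

/-- The vertex sets of the components of the graph induced on `T`. -/
noncomputable def comps (T : Finset V) : Finset (Finset V) :=
  T.powerset.filter fun C => ConnSet G C ∧ ClosedIn G C T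

/-- The excess of the degrees over `1` on `W` and over `2` elsewhere. -/
noncomputable def excess (S W : Finset V) : ℕ :=
  ∑ v ∈ S, (degIn G S v - if v ∈ W then 1 else 2)

/-- The excess of the degrees over `2`. -/
noncomputable def majorExcess (S : Finset V) : ℕ := ∑ v ∈ S, (degIn G S v - 2)

variable {G}

theorem mem_comps {T C : Finset V} : C ∈ comps G T ↔ C ⊆ T ∧ ConnSet G C ∧ ClosedIn G C T := by
  simp [comps]

theorem degIn_mono {S T : Finset V} (h : S ⊆ T) (v : V) : degIn G S v ≤ degIn G T v :=
  Finset.card_le_card (Finset.filter_subset_filter _ h)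

theorem degIn_erase_of_adj {S : Finset V} {x v : V} (hx : x ∈ S) (h : G.Adj v x) :
    degIn G (S.erase x) v + 1 = degIn G S v := by
  unfold degIn
  rw [Finset.filter_erase, Finset.card_erase_add_one]
  simp [hx, h]

theorem degIn_erase_of_not_adj {S : Finset V} {x v : V} (h : ¬ G.Adj v x) :
    degIn G (S.erase x) v = degIn G S v := by
  unfold degIn
  rw [Finset.filter_erase, Finset.erase_eq_of_notMem]
  simp [h]

theorem degIn_of_closedIn {C T : Finset V} (hCT : C ⊆ T) (h : ClosedIn G C T) {v : V}
    (hv : v ∈ C) : degIn G C v = degIn G T v := by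
  unfold degIn
  congr 1
  ext u
  simp only [Finset.mem_filter]
  exact ⟨fun ⟨h1, h2⟩ => ⟨hCT h1, h2⟩, fun ⟨h1, h2⟩ => ⟨h v hv u h1 h2, h2⟩⟩

theorem ClosedIn.sdiff {C T : Finset V} (h : ClosedIn G C T) : ClosedIn G (T \ C) T := by
  intro a ha b hb hab
  rw [Finset.mem_sdiff] at ha ⊢
  exact ⟨hb, fun hbC => ha.2 (h b hbC a ha.1 hab.symm)⟩

theorem ClosedIn.trans {C D T : Finset V} (h : ClosedIn G C D) (hCD : C ⊆ D)
    (h' : ClosedIn G D T) : ClosedIn G C T :=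
  fun a ha b hb hab => h a ha b (h' a (hCD ha) b hb hab) hab

theorem ClosedIn.mono {C T T' : Finset V} (h : ClosedIn G C T) (hT : T' ⊆ T) : ClosedIn G C T' :=
  fun a ha b hb hab => h a ha b (hT hb) hab

theorem ClosedIn.inter {C D T : Finset V} (h : ClosedIn G C T) (hD : D ⊆ T) :
    ClosedIn G (C ∩ D) D := by
  intro a ha b hb hab
  rw [Finset.mem_inter] at ha ⊢
  exact ⟨h a ha.1 b (hD hb) hab, hb⟩

/-- A connected set meeting a closed set is contained in it. -/
theorem ConnSet.subset_of_closedIn {A C T : Finset V} (hA : ConnSet G A) (hAT : A ⊆ T)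
    (hC : ClosedIn G C T) (h : (A ∩ C).Nonempty) : A ⊆ C := by
  have := hA.2 (C ∩ A) Finset.inter_subset_right (by rwa [Finset.inter_comm])
    (hC.inter hAT)
  exact fun a ha => (Finset.mem_inter.1 (this.symm ▸ ha : a ∈ C ∩ A)).1

theorem comps_eq_of_inter {T C D : Finset V} (hC : C ∈ comps G T) (hD : D ∈ comps G T)
    (h : (C ∩ D).Nonempty) : C = D := by
  rw [mem_comps] at hC hD
  exact Finset.Subset.antisymm (hC.2.1.subset_of_closedIn hC.1 hD.2.2 h)
    (hD.2.1.subset_of_closedIn hD.1 hC.2.2 (by rwa [Finset.inter_comm]))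

theorem comps_pairwiseDisjoint (T : Finset V) :
    ((comps G T : Finset (Finset V)) : Set (Finset V)).PairwiseDisjoint id := by
  intro C hC D hD hne
  rw [Function.onFun, id, id, Finset.disjoint_iff_inter_eq_empty]
  by_contra h
  exact hne (comps_eq_of_inter hC hD (Finset.nonempty_iff_ne_empty.2 h))

theorem exists_mem_comps {T : Finset V} {v : V} (hv : v ∈ T) : ∃ C ∈ comps G T, v ∈ C := by
  -- The component of v is a closed set containing v of least size: a proper closed part, or its
  -- complement, would be a smaller one.
  have hne : (T.powerset.filter fun C => v ∈ C ∧ ClosedIn G C T).Nonempty :=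
    ⟨T, by simp [hv]; exact fun a _ b hb _ => hb⟩
  obtain ⟨C, hC, hmin⟩ := Finset.exists_min_image _ Finset.card hne
  simp only [Finset.mem_filter, Finset.mem_powerset] at hC hmin
  refine ⟨C, mem_comps.2 ⟨hC.1, ⟨⟨v, hC.2.1⟩, fun D hD hDne hDcl => ?_⟩, hC.2.2⟩, hC.2.1⟩
  by_cases hvD : v ∈ D
  · exact Finset.eq_of_subset_of_card_le hD
      (hmin D ⟨hD.trans hC.1, hvD, hDcl.trans hD hC.2.2⟩)
  · exfalso
    have h1 := hmin (C \ D) ⟨Finset.sdiff_subset.trans hC.1,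
      Finset.mem_sdiff.2 ⟨hC.2.1, hvD⟩, hDcl.sdiff.trans Finset.sdiff_subset hC.2.2⟩
    have h2 := Finset.card_sdiff_add_card_eq_card hD
    have h3 := hDne.card_pos
    omega

theorem biUnion_comps (T : Finset V) : (comps G T).biUnion id = T := by
  ext v
  simp only [Finset.mem_biUnion, id]
  exact ⟨fun ⟨C, hC, hv⟩ => (mem_comps.1 hC).1 hv, fun hv => exists_mem_comps hv⟩

theorem sum_comps {M : Type*} [AddCommMonoid M] (T : Finset V) (f : V → M) :
    ∑ C ∈ comps G T, ∑ v ∈ C, f v = ∑ v ∈ T, f v := by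
  conv_rhs => rw [← biUnion_comps (G := G) T]
  rw [Finset.sum_biUnion (comps_pairwiseDisjoint T)]
  rfl

theorem ConnSet.comps_eq {T : Finset V} (h : ConnSet G T) : comps G T = {T} := by
  ext C
  rw [mem_comps, Finset.mem_singleton]
  constructor
  · rintro ⟨h1, h2, h3⟩
    exact h.2 C h1 h2.1 h3
  · rintro rfl
    exact ⟨subset_rfl, h, fun a _ b hb _ => hb⟩

/-- Removing a vertex of degree at most one keeps a set connected. -/
theorem ConnSet.erase_of_degIn_le_one {T : Finset V} (h : ConnSet G T) {u : V}
    (hd : degIn G T u ≤ 1) (hne : (T.erase u).Nonempty) : ConnSet G (T.erase u) := by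
  by_cases hu : u ∈ T
  swap
  · rwa [Finset.erase_eq_of_notMem hu]
  refine ⟨hne, fun C hC hCne hCcl => ?_⟩
  have hone : ∀ a ∈ T, ∀ b ∈ T, G.Adj u a → G.Adj u b → a = b := fun a ha b hb h1 h2 =>
    Finset.card_le_one.1 hd a (by simp [ha, h1]) b (by simp [hb, h2])
  by_cases hadj : ∃ a ∈ C, G.Adj u a
  · obtain ⟨a, haC, hua⟩ := hadj
    have haT : a ∈ T := Finset.mem_of_mem_erase (hC haC)
    have hcl : ClosedIn G (insert u C) T := by
      intro b hb c hc hbc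
      rcases Finset.mem_insert.1 hb with rfl | hb
      · rw [hone c hc a haT hbc hua]
        exact Finset.mem_insert_of_mem haC
      · by_cases hcu : c = u
        · subst hcu; exact Finset.mem_insert_self _ _
        · exact Finset.mem_insert_of_mem (hCcl b hb c (Finset.mem_erase.2 ⟨hcu, hc⟩) hbc)
    have := h.2 _ (Finset.insert_subset hu (hC.trans (Finset.erase_subset _ _)))
      ⟨u, by simp⟩ hcl
    rw [← this, Finset.erase_insert fun huC => (Finset.notMem_erase u T) (hC huC)]
  · push Not at hadj
    have hcl : ClosedIn G C T := by
      intro b hb c hc hbc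
      by_cases hcu : c = u
      · subst hcu; exact absurd hbc.symm (hadj b hb)
      · exact hCcl b hb c (Finset.mem_erase.2 ⟨hcu, hc⟩) hbc
    have := h.2 C (hC.trans (Finset.erase_subset _ _)) hCne hcl
    rw [← this] at hu
    exact absurd (hC hu) (Finset.notMem_erase u T)

theorem ConnSet.exists_adj {T : Finset V} (h : ConnSet G T) {A : Finset V} (hA : A ⊆ T)
    (hne : A.Nonempty) (hAT : A ≠ T) : ∃ a ∈ A, ∃ b ∈ T, b ∉ A ∧ G.Adj a b := by
  by_contra hcon
  push Not at hcon
  exact hAT (h.2 A hA hne fun a ha b hb hab => by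
    by_contra hbA; exact hcon a ha b hb hbA hab)

theorem ConnSet.degIn_pos {T : Finset V} (h : ConnSet G T) (hc : 2 ≤ T.card) {v : V} (hv : v ∈ T) :
    1 ≤ degIn G T v := by
  obtain ⟨a, ha, b, hb, -, hab⟩ := h.exists_adj (A := {v}) (by simpa using hv) (by simp)
    (by rintro rfl; simp at hc)
  rw [Finset.mem_singleton] at ha
  subst ha
  exact Finset.card_pos.2 ⟨b, by simp [hb, hab]⟩

theorem ConnSet.eq_singleton_of_degIn {T : Finset V} (h : ConnSet G T) {v : V} (hv : v ∈ T)
    (hd : degIn G T v = 0) : T = {v} := by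
  by_contra hne
  have h1 : 2 ≤ T.card := by
    by_contra hlt
    refine hne (Finset.eq_singleton_iff_unique_mem.2 ⟨hv, fun w hw => ?_⟩)
    exact Finset.card_le_one.1 (by omega) w hw v hv
  have := h.degIn_pos h1 hv
  omega

/-- Growing a set by one vertex joined to it raises the degree sum by at least two. -/
theorem sum_degIn_insert {A : Finset V} {a b : V} (ha : a ∈ A) (hb : b ∉ A) (h : G.Adj a b) :
    ∑ v ∈ A, degIn G A v + 2 ≤ ∑ v ∈ insert b A, degIn G (insert b A) v := by
  rw [Finset.sum_insert hb]
  have h1 : 1 ≤ degIn G (insert b A) b :=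
    Finset.card_pos.2 ⟨a, by simp [ha, h.symm]⟩
  have h2 : ∑ v ∈ A, degIn G A v < ∑ v ∈ A, degIn G (insert b A) v := by
    refine Finset.sum_lt_sum (fun v _ => degIn_mono (Finset.subset_insert _ _) v) ⟨a, ha, ?_⟩
    refine Finset.card_lt_card (Finset.ssubset_iff_of_subset
      (Finset.filter_subset_filter _ (Finset.subset_insert _ _)) |>.2 ⟨b, ?_, ?_⟩)
    · simp [h]
    · simp [hb]
  omega

/-- In a connected set the number of edges minus the number of vertices is at least that of any
nonempty subset. -/
theorem ConnSet.sum_degIn_subset {T : Finset V} (h : ConnSet G T) {A₀ : Finset V} (hA₀ : A₀ ⊆ T)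
    (hne : A₀.Nonempty) :
    ∑ v ∈ A₀, degIn G A₀ v + 2 * T.card ≤ ∑ v ∈ T, degIn G T v + 2 * A₀.card := by
  induction hk : T.card - A₀.card generalizing A₀ with
  | zero =>
    have : A₀ = T := Finset.eq_of_subset_of_card_le hA₀ (by omega)
    subst this
    exact le_rfl
  | succ k ih =>
    obtain ⟨a, ha, b, hb, hbA, hab⟩ := h.exists_adj hA₀ hne (by rintro rfl; omega)
    have hc := Finset.card_insert_of_notMem hbA
    have h1 := ih (A₀ := insert b A₀) (Finset.insert_subset hb hA₀) ⟨b, by simp⟩ (by omega)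
    have h2 := sum_degIn_insert ha hbA hab
    omega

/-- Growing from a single vertex shows |E| ≥ |V| - 1, i.e. the cyclomatic number is nonnegative. -/
theorem ConnSet.two_mul_card_le {T : Finset V} (h : ConnSet G T) :
    2 * T.card ≤ ∑ v ∈ T, degIn G T v + 2 := by
  obtain ⟨a, ha⟩ := h.1
  have := h.sum_degIn_subset (A₀ := {a}) (by simpa using ha) (by simp)
  simp only [Finset.card_singleton] at this
  omega

/-- The degree sum is at most the excess plus the sum of the thresholds, which is 2|T| - |W|, while
connectivity bounds it below by 2|T| - 2. Applied to the neighbours of a deleted vertex, this limits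
the number of edges attaching a component. -/
theorem ConnSet.card_le_excess_add_two {T : Finset V} (h : ConnSet G T) {W : Finset V}
    (hW : W ⊆ T) : W.card ≤ excess G T W + 2 := by
  have h1 := h.two_mul_card_le
  have h2 : ∑ v ∈ T, degIn G T v ≤ excess G T W + ∑ v ∈ T, (if v ∈ W then 1 else 2) := by
    rw [excess, ← Finset.sum_add_distrib]
    exact Finset.sum_le_sum fun v _ => by omega
  have h3 : ∑ v ∈ T, (if v ∈ W then 1 else 2) + W.card = 2 * T.card := by
    have : W.card = ∑ v ∈ T, if v ∈ W then 1 else 0 := by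
      rw [Finset.sum_ite_mem, Finset.inter_eq_right.2 hW]; simp
    rw [this, ← Finset.sum_add_distrib, Finset.sum_congr rfl (g := fun _ => 2)]
    · simp [mul_comm]
    · intro v _; split_ifs <;> rfl
  omega

/-- The handshake lemma: a new vertex contributes its degree once at itself and once in total at its
neighbours. The parity later excludes borderline values in the counts. -/
theorem even_sum_degIn (S : Finset V) : Even (∑ v ∈ S, degIn G S v) := by
  induction S using Finset.induction_on with
  | empty => simp
  | insert b A hb ih =>
    rw [Finset.sum_insert hb]
    have h1 : ∑ v ∈ A, degIn G (insert b A) v =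
        ∑ v ∈ A, degIn G A v + degIn G (insert b A) b := by
      have h2 : degIn G (insert b A) b = ∑ v ∈ A, if G.Adj b v then 1 else 0 := by
        rw [degIn, Finset.filter_insert, if_neg (G.loopless.irrefl b), Finset.card_filter]
      rw [h2, ← Finset.sum_add_distrib]
      refine Finset.sum_congr rfl fun v hv => ?_
      unfold degIn
      rw [Finset.filter_insert]
      by_cases h : G.Adj v b
      · rw [if_pos h, if_pos h.symm, Finset.card_insert_of_notMem (by simp [hb])]
      · rw [if_neg h, if_neg fun h' => h h'.symm]; rfl
    rw [h1]
    obtain ⟨k, hk⟩ := ih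
    exact ⟨k + degIn G (insert b A) b, by omega⟩

end VertexSets

/-! ### Zero forcing bounds for the multiplicity -/

section ZeroForcing

variable {V : Type*} [Fintype V] {G : SimpleGraph V} {B : Matrix V V ℂ} {μ : ℂ}

/-- Zero forcing from a set meeting every component: each removed vertex of the set spends at most
its degree minus one. -/
theorem solDim_le_excess (hB : IsMatrixOf G B) (S W : Finset V)
    (hdom : ∀ C ⊆ S, C.Nonempty → ClosedIn G C S → (C ∩ W).Nonempty) :
    solDim B μ S W ≤ excess G S W := by
  induction hn : S.card generalizing S W with
  | zero =>
    rw [Finset.card_eq_zero] at hn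
    subst hn
    have : solSpace B μ ∅ W = ⊥ := by
      rw [eq_bot_iff]
      intro z hz
      rw [Submodule.mem_bot]
      funext v
      exact hz.1 v (by simp)
    rw [solDim, this, finrank_bot]
    exact Nat.zero_le _
  | succ n ih =>
    have hSne : S.Nonempty := Finset.card_pos.1 (by omega)
    obtain ⟨w, hw⟩ := hdom S subset_rfl hSne fun a _ b hb _ => hb
    obtain ⟨hwS, hwW⟩ := Finset.mem_inter.1 hw
    set D := (S.filter (G.Adj w)) \ W with hD
    -- As z w = 0, the equation at w is a relation with nonzero coefficients among the neighbours
    -- not already forced to be zero.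
    have h1 : solDim B μ S W ≤ (D.card - 1) + solDim B μ S (W ∪ D) := by
      refine solDim_le_card_sub_one_add B μ S W D (fun u => B w u) (fun u hu => ?_) fun z hz => ?_
      · rw [hD, Finset.mem_sdiff, Finset.mem_filter] at hu
        exact hB.apply_ne_zero hu.1.2
      · have h2 := hz.2.2 w hwS
        rw [hz.2.1 w hwW, mul_zero, hB.sum_row hz.1 (hz.2.1 w hwW)] at h2
        rw [← h2]
        refine Finset.sum_subset Finset.sdiff_subset fun u hu huD => ?_
        have : u ∈ W := by
          by_contra h
          exact huD (Finset.mem_sdiff.2 ⟨hu, h⟩)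
        rw [hz.2.1 u this, mul_zero]
    have h2 : solDim B μ S (W ∪ D) ≤ solDim B μ (S.erase w) ((W ∪ D).erase w) :=
      solDim_mono (solSpace_erase S _ w (Finset.mem_union_left _ hwW))
    have h3 := ih (S.erase w) ((W ∪ D).erase w) (fun C hC hCne hCcl => ?_) (by
      rw [Finset.card_erase_of_mem hwS]; omega)
    -- A vertex of `D` loses the edge to w while its threshold drops from 2 to 1, so its term is
    -- unchanged. Removing w thus releases its own term deg w - 1, which pays for |D| - 1.
    · have h4 : excess G (S.erase w) ((W ∪ D).erase w) + (degIn G S w - 1) ≤ excess G S W := by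
        rw [excess, excess, ← Finset.sum_erase_add S _ hwS, if_pos hwW]
        refine Nat.add_le_add_right (Finset.sum_le_sum fun v hv => ?_) _
        obtain ⟨hvw, hvS⟩ := Finset.mem_erase.1 hv
        by_cases hvW : v ∈ W
        · rw [if_pos hvW, if_pos (by simp [hvw, hvW])]
          exact Nat.sub_le_sub_right (degIn_mono (Finset.erase_subset _ _) v) 1
        · by_cases hvw' : G.Adj w v
          · rw [if_neg hvW, if_pos (by simp [hvw, hvW, hD, hvS, hvw'])]
            have := degIn_erase_of_adj hwS hvw'.symm
            omega
          · rw [if_neg hvW, if_neg (by simp [hvw, hvW, hD, hvw'])]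
            exact Nat.sub_le_sub_right (degIn_mono (Finset.erase_subset _ _) v) 2
      have h5 : D.card ≤ degIn G S w := Finset.card_le_card Finset.sdiff_subset
      omega
    -- Every component still meets the zero set: a component touching w contains a neighbour of w,
    -- and any other was already a component of `S`.
    · by_cases hadj : ∃ a ∈ C, G.Adj w a
      · obtain ⟨a, haC, hwa⟩ := hadj
        obtain ⟨haw, haS⟩ := Finset.mem_erase.1 (hC haC)
        refine ⟨a, Finset.mem_inter.2 ⟨haC, Finset.mem_erase.2 ⟨haw, ?_⟩⟩⟩
        by_cases haW : a ∈ W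
        · exact Finset.mem_union_left _ haW
        · exact Finset.mem_union_right _ (by simp [hD, haS, hwa, haW])
      · push Not at hadj
        have hcl : ClosedIn G C S := by
          intro a ha b hb hab
          by_cases hbw : b = w
          · subst hbw; exact absurd hab.symm (hadj a ha)
          · exact hCcl a ha b (Finset.mem_erase.2 ⟨hbw, hb⟩) hab
        obtain ⟨a, ha⟩ := hdom C (hC.trans (Finset.erase_subset _ _)) hCne hcl
        obtain ⟨haC, haW⟩ := Finset.mem_inter.1 ha
        exact ⟨a, Finset.mem_inter.2 ⟨haC, Finset.mem_erase.2
          ⟨(Finset.mem_erase.1 (hC haC)).1, Finset.mem_union_left _ haW⟩⟩⟩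

theorem excess_erase_add_one {S W : Finset V} {w : V} (hwS : w ∈ S) (hwW : w ∈ W)
    (hd : 2 ≤ degIn G S w) : excess G S (W.erase w) + 1 = excess G S W := by
  rw [excess, excess, ← Finset.sum_erase_add S _ hwS,
    ← Finset.sum_erase_add S (fun v => degIn G S v - if v ∈ W then 1 else 2) hwS]
  rw [if_pos hwW, if_neg (by simp)]
  have : ∑ v ∈ S.erase w, (degIn G S v - if v ∈ W.erase w then 1 else 2) =
      ∑ v ∈ S.erase w, (degIn G S v - if v ∈ W then 1 else 2) := by
    refine Finset.sum_congr rfl fun v hv => ?_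
    simp [(Finset.mem_erase.1 hv).1]
  rw [this]
  omega

/-- In a connected set every further zero vertex saves one dimension. -/
theorem ConnSet.solDim_le (hB : IsMatrixOf G B) (T W : Finset V) (hT : ConnSet G T) (hW : W ⊆ T)
    (hne : W.Nonempty) : solDim B μ T W ≤ excess G T W - (W.card - 1) := by
  induction hn : T.card + W.card using Nat.strong_induction_on generalizing T W with
  | _ n ih =>
  have hbase : solDim B μ T W ≤ excess G T W := by
    refine solDim_le_excess hB T W fun C hC hCne hcl => ?_
    rw [hT.2 C hC hCne hcl, Finset.inter_eq_right.2 hW]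
    exact hne
  have hWpos := hne.card_pos
  rcases Nat.lt_or_ge W.card 2 with hcard | hcard
  · have : W.card - 1 = 0 := by omega
    rwa [this, Nat.sub_zero]
  -- A zero at a vertex of degree at least two can be forgotten: this lowers the excess by exactly
  -- one, and so accounts for that vertex. It remains to treat zeros at vertices of degree one only.
  by_cases hbig : ∃ w ∈ W, 2 ≤ degIn G T w
  · obtain ⟨w, hwW, hd⟩ := hbig
    have hc := Finset.card_erase_of_mem hwW
    have h1 := ih (T.card + (W.erase w).card) (by omega) T (W.erase w) hT
      ((Finset.erase_subset _ _).trans hW) (Finset.card_pos.1 (by omega)) rfl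
    have h2 : solDim B μ T W ≤ solDim B μ T (W.erase w) :=
      solDim_mono (solSpace_anti_right (Finset.erase_subset _ _))
    have h3 := excess_erase_add_one (hW hwW) hwW hd
    omega
  push Not at hbig
  obtain ⟨u, huW⟩ := hne
  have huT := hW huW
  have hTcard : W.card ≤ T.card := Finset.card_le_card hW
  have hd1 : degIn G T u = 1 := by
    have := hT.degIn_pos (by omega) huT
    have := hbig u huW
    omega
  obtain ⟨u', hu'⟩ := Finset.card_eq_one.1 hd1
  have hu'mem : u' ∈ T ∧ G.Adj u u' := by
    have : u' ∈ T.filter (G.Adj u) := by rw [hu']; simp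
    simpa using this
  have hne' : u' ≠ u := hu'mem.2.ne'
  -- The equation at the pendant vertex u has a single term, so the zero passes to its neighbour u'.
  -- If u' was already in `W` then T is just {u, u'} and nothing survives; otherwise u is replaced
  -- by u'.
  have hvan : solSpace B μ T W ≤ solSpace B μ T (insert u' W) := by
    intro z hz
    refine ⟨hz.1, fun v hv => ?_, hz.2.2⟩
    rcases Finset.mem_insert.1 hv with rfl | hv
    · have h2 := hz.2.2 u huT
      rw [hz.2.1 u huW, mul_zero, hB.sum_row hz.1 (hz.2.1 u huW), hu', Finset.sum_singleton] at h2
      exact (mul_eq_zero.1 h2).resolve_left (hB.apply_ne_zero hu'mem.2)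
    · exact hz.2.1 v hv
  have hT' := hT.erase_of_degIn_le_one hd1.le ⟨u', Finset.mem_erase.2 ⟨hne', hu'mem.1⟩⟩
  have hTc := Finset.card_erase_of_mem huT
  have hWc := Finset.card_erase_of_mem huW
  have hsub : solDim B μ T W ≤ solDim B μ (T.erase u) ((insert u' W).erase u) :=
    solDim_mono (hvan.trans (solSpace_erase T _ u (by simp [huW])))
  by_cases hu'W : u' ∈ W
  · have hd' : degIn G (T.erase u) u' = 0 := by
      have := degIn_erase_of_adj huT hu'mem.2.symm
      have := hbig u' hu'W
      omega
    have hTe := hT'.eq_singleton_of_degIn (Finset.mem_erase.2 ⟨hne', hu'mem.1⟩) hd'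
    have hz : solSpace B μ T W = ⊥ := by
      rw [eq_bot_iff]
      intro z hz
      rw [Submodule.mem_bot]
      funext v
      by_cases hv : v ∈ T
      · by_cases hvu : v = u
        · subst hvu; exact hz.2.1 _ huW
        · have : v ∈ T.erase u := Finset.mem_erase.2 ⟨hvu, hv⟩
          rw [hTe, Finset.mem_singleton] at this
          subst this
          exact hz.2.1 _ hu'W
      · exact hz.1 v hv
    rw [solDim, hz, finrank_bot]
    exact Nat.zero_le _
  · have hins : (insert u' W).erase u = insert u' (W.erase u) := by
      rw [Finset.erase_insert_of_ne hne']
    rw [hins] at hsub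
    have hc' : (insert u' (W.erase u)).card = W.card := by
      rw [Finset.card_insert_of_notMem (by simp [hu'W]), hWc]; omega
    have h1 := ih ((T.erase u).card + (insert u' (W.erase u)).card) (by omega) (T.erase u)
      (insert u' (W.erase u)) hT' ?_ ⟨u', by simp⟩ rfl
    · have h3 : excess G (T.erase u) (insert u' (W.erase u)) = excess G T W := by
        rw [excess, excess, ← Finset.sum_erase_add T _ huT, if_pos huW, hd1]
        simp only [Nat.sub_self, add_zero]
        refine Finset.sum_congr rfl fun v hv => ?_
        obtain ⟨hvu, hvT⟩ := Finset.mem_erase.1 hv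
        by_cases hvu' : v = u'
        · subst hvu'
          have := degIn_erase_of_adj huT hu'mem.2.symm
          rw [if_pos (by simp), if_neg hu'W]
          omega
        · have hnadj : ¬ G.Adj v u := by
            intro h
            have : v ∈ T.filter (G.Adj u) := by simp [hvT, h.symm]
            rw [hu', Finset.mem_singleton] at this
            exact hvu' this
          rw [degIn_erase_of_not_adj hnadj]
          simp [hvu, hvu']
      rw [h3, hc'] at h1
      exact hsub.trans h1
    · refine Finset.insert_subset (Finset.mem_erase.2 ⟨hne', hu'mem.1⟩)
        (Finset.erase_subset_erase _ hW)

/-- One dimension pays for a zero at the root u, after which forcing starts from u. -/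
theorem ConnSet.solDim_le_root (hB : IsMatrixOf G B) {T : Finset V} (hT : ConnSet G T) {u : V}
    (hu : u ∈ T) : solDim B μ T ∅ ≤ 1 + excess G T {u} := by
  have h1 := solDim_le_add_one B μ T ∅ u
  have h2 := hT.solDim_le (μ := μ) hB T {u} (by simpa using hu) (by simp)
  simp only [insert_empty_eq, Finset.card_singleton] at h1 h2
  omega

end ZeroForcing

/-! ### Additivity of the multiplicity over components -/

section Components

variable {V : Type*} [Fintype V] {G : SimpleGraph V} {B : Matrix V V ℂ} {μ : ℂ}

theorem solSpace_closedIn_le (hB : IsMatrixOf G B) {C T : Finset V} (hCT : C ⊆ T)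
    (hcl : ClosedIn G C T) : solSpace B μ C ∅ ≤ solSpace B μ T ∅ := by
  intro z hz
  refine ⟨fun v hv => hz.1 v fun h => hv (hCT h), by simp, fun v hv => ?_⟩
  by_cases hvC : v ∈ C
  · exact hz.2.2 v hvC
  · rw [hz.1 v hvC, mul_zero, hB.sum_row hz.1 (hz.1 v hvC)]
    refine Finset.sum_eq_zero fun u hu => ?_
    rw [Finset.mem_filter] at hu
    exact absurd (hcl u hu.1 v hv hu.2.symm) hvC

theorem solDim_union (hB : IsMatrixOf G B) {A C : Finset V} (hdisj : Disjoint A C)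
    (hno : ∀ a ∈ A, ∀ c ∈ C, ¬ G.Adj a c) :
    solDim B μ (A ∪ C) ∅ = solDim B μ A ∅ + solDim B μ C ∅ := by
  have hAcl : ClosedIn G A (A ∪ C) := fun a ha b hb hab =>
    (Finset.mem_union.1 hb).elim id fun h => absurd hab (hno a ha b h)
  have hCcl : ClosedIn G C (A ∪ C) := fun a ha b hb hab =>
    (Finset.mem_union.1 hb).elim (fun h => absurd hab.symm (hno b h a ha)) id
  have hinf : solSpace B μ A ∅ ⊓ solSpace B μ C ∅ = ⊥ := by
    rw [eq_bot_iff]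
    rintro z ⟨h1, h2⟩
    rw [Submodule.mem_bot]
    funext v
    by_cases hv : v ∈ A
    · exact h2.1 v (Finset.disjoint_left.1 hdisj hv)
    · exact h1.1 v hv
  have hsup : solSpace B μ A ∅ ⊔ solSpace B μ C ∅ = solSpace B μ (A ∪ C) ∅ := by
    refine le_antisymm (sup_le (solSpace_closedIn_le hB Finset.subset_union_left hAcl)
      (solSpace_closedIn_le hB Finset.subset_union_right hCcl)) fun z hz => ?_
    -- Cutting an eigenvector off to one side of a partition without crossing edges leaves an
    -- eigenvector of that side.
    have hpart : ∀ D D' : Finset V, D ⊆ A ∪ C → D' ⊆ A ∪ C → (∀ v, v ∈ A ∪ C → v ∈ D ∨ v ∈ D') →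
        Disjoint D D' → (∀ a ∈ D, ∀ c ∈ D', ¬ G.Adj a c) →
        (fun v => if v ∈ D then z v else 0) ∈ solSpace B μ D ∅ := by
      intro D D' hD hD' hcov hd hno'
      refine ⟨fun v hv => if_neg hv, by simp, fun v hv => ?_⟩
      beta_reduce
      rw [if_pos hv, ← hz.2.2 v (hD hv)]
      refine Finset.sum_congr rfl fun u _ => ?_
      by_cases hu : u ∈ D
      · rw [if_pos hu]
      · rw [if_neg hu, mul_zero]
        by_cases hu' : u ∈ A ∪ C
        · have huD' := (hcov u hu').resolve_left hu
          rw [hB.apply_eq_zero (by rintro rfl; exact hu hv) (hno' v hv u huD'), zero_mul]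
        · rw [hz.1 u hu', mul_zero]
    have h1 := hpart A C Finset.subset_union_left Finset.subset_union_right
      (fun v hv => Finset.mem_union.1 hv) hdisj hno
    have h2 := hpart C A Finset.subset_union_right Finset.subset_union_left
      (fun v hv => (Finset.mem_union.1 hv).symm) hdisj.symm
      (fun c hc a ha h => hno a ha c hc h.symm)
    rw [Submodule.mem_sup]
    refine ⟨_, h1, _, h2, ?_⟩
    funext v
    simp only [Pi.add_apply]
    by_cases hvA : v ∈ A
    · rw [if_pos hvA, if_neg (Finset.disjoint_left.1 hdisj hvA), add_zero]
    · rw [if_neg hvA, zero_add]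
      by_cases hvC : v ∈ C
      · rw [if_pos hvC]
      · rw [if_neg hvC, hz.1 v (by simp [hvA, hvC])]
  have := Submodule.finrank_sup_add_finrank_inf_eq (solSpace B μ A ∅) (solSpace B μ C ∅)
  rw [hsup, hinf, finrank_bot, add_zero] at this
  exact this

/-- The multiplicity is the sum of the multiplicities of the components. -/
theorem solDim_eq_sum_comps (hB : IsMatrixOf G B) (T : Finset V) :
    solDim B μ T ∅ = ∑ C ∈ comps G T, solDim B μ C ∅ := by
  suffices h : ∀ 𝒞 ⊆ comps G T, solDim B μ (𝒞.biUnion id) ∅ = ∑ C ∈ 𝒞, solDim B μ C ∅ by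
    have := h _ subset_rfl
    rwa [biUnion_comps] at this
  intro 𝒞
  induction 𝒞 using Finset.induction_on with
  | empty =>
    intro _
    have := solDim_le_excess (μ := μ) hB ∅ ∅ (fun C hC hne _ => by
      rw [Finset.subset_empty] at hC; simp [hC] at hne)
    simpa [excess] using this
  | insert C 𝒞 hC ih =>
    intro hsub
    rw [Finset.insert_subset_iff] at hsub
    have hdis : ∀ D ∈ 𝒞, Disjoint C D := fun D hD =>
      comps_pairwiseDisjoint T hsub.1 (hsub.2 hD) (fun h => hC (h ▸ hD))
    rw [Finset.sum_insert hC, Finset.biUnion_insert, id, solDim_union hB, ih hsub.2]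
    · exact (Finset.disjoint_biUnion_right _ _ _).2 hdis
    · intro a ha c hc hac
      obtain ⟨D, hD, hcD⟩ := Finset.mem_biUnion.1 hc
      have h1 := (mem_comps.1 (hsub.2 hD))
      have h2 := (mem_comps.1 hsub.1)
      have : c ∈ C := h2.2.2 a ha c (h1.1 hcD) hac
      exact Finset.disjoint_left.1 (hdis D hD) this hcD

end Components

/-! ### Deleting a major vertex: the upper bound and its equality case -/

section VertexDeletion

variable {V : Type*} [Fintype V] {G : SimpleGraph V} {B : Matrix V V ℂ} {μ : ℂ}

theorem degIn_eq_of_mem_comps_erase {S C : Finset V} {x v : V} (hx : x ∈ S)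
    (hC : C ∈ comps G (S.erase x)) (hv : v ∈ C) :
    degIn G S v = degIn G C v + if G.Adj x v then 1 else 0 := by
  obtain ⟨h1, -, h3⟩ := mem_comps.1 hC
  rw [degIn_of_closedIn h1 h3 hv]
  split_ifs with h
  · exact (degIn_erase_of_adj hx h.symm).symm
  · exact (degIn_erase_of_not_adj fun h' => h h'.symm).symm

/-- A neighbour of x loses one degree when x is deleted, and its threshold drops from 2 to 1. Hence
taking the neighbours of x as zero set measures the excess by the degrees before the deletion, and
`majorExcess` splits over the components. -/
theorem excess_of_mem_comps_erase {S C : Finset V} {x : V} (hx : x ∈ S)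
    (hC : C ∈ comps G (S.erase x)) :
    excess G C (C.filter (G.Adj x)) = ∑ v ∈ C, (degIn G S v - 2) := by
  refine Finset.sum_congr rfl fun v hv => ?_
  rw [degIn_eq_of_mem_comps_erase hx hC hv]
  by_cases h : G.Adj x v
  · rw [if_pos h, if_pos (by simp [hv, h])]; omega
  · rw [if_neg h, if_neg (by simp [h])]; omega

theorem majorExcess_eq_sum_comps {S : Finset V} {x : V} (hx : x ∈ S) :
    majorExcess G S = ∑ C ∈ comps G (S.erase x), excess G C (C.filter (G.Adj x)) +
      (degIn G S x - 2) := by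
  rw [majorExcess, ← Finset.sum_erase_add S _ hx, ← sum_comps (G := G) (S.erase x)]
  congr 1
  exact Finset.sum_congr rfl fun C hC => (excess_of_mem_comps_erase hx hC).symm

theorem sum_comps_degIn (S : Finset V) (x : V) :
    ∑ C ∈ comps G (S.erase x), degIn G C x = degIn G S x := by
  have h : ∀ A : Finset V, degIn G A x = ∑ v ∈ A, if G.Adj x v then 1 else 0 := fun A => by
    rw [degIn, Finset.card_filter]
  simp_rw [h]
  rw [sum_comps]
  refine Finset.sum_subset (Finset.erase_subset _ _) fun v hv hv' => ?_
  have : v = x := by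
    by_contra hne
    exact hv' (Finset.mem_erase.2 ⟨hne, hv⟩)
  subst this
  simp

theorem ConnSet.degIn_comps_pos {S C : Finset V} (hS : ConnSet G S) {x : V} (hx : x ∈ S)
    (hC : C ∈ comps G (S.erase x)) : 1 ≤ degIn G C x := by
  obtain ⟨h1, h2, h3⟩ := mem_comps.1 hC
  obtain ⟨a, ha, b, hb, hbC, hab⟩ := hS.exists_adj (h1.trans (Finset.erase_subset _ _)) h2.1
    (by rintro rfl; exact Finset.notMem_erase x _ (h1 hx))
  have hbx : b = x := by
    by_contra hne
    exact hbC (h3 a ha b (Finset.mem_erase.2 ⟨hne, hb⟩) hab)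
  subst hbx
  exact Finset.card_pos.2 ⟨a, by simp [ha, hab.symm]⟩

theorem ConnSet.card_comps_le {S : Finset V} (hS : ConnSet G S) {x : V} (hx : x ∈ S) :
    (comps G (S.erase x)).card ≤ degIn G S x := by
  rw [← sum_comps_degIn S x, Finset.card_eq_sum_ones]
  exact Finset.sum_le_sum fun C hC => hS.degIn_comps_pos hx hC

theorem excess_anti {S W W' : Finset V} (h : W ⊆ W') : excess G S W ≤ excess G S W' := by
  refine Finset.sum_le_sum fun v _ => ?_
  by_cases h1 : v ∈ W
  · rw [if_pos h1, if_pos (h h1)]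
  · rw [if_neg h1]
    split_ifs <;> omega

/-- Root the component at a single neighbour of x. Enlarging the zero set to all neighbours of x
only raises the excess. -/
theorem solDim_comps_le (hB : IsMatrixOf G B) {S C : Finset V} (hS : ConnSet G S) {x : V}
    (hx : x ∈ S) (hC : C ∈ comps G (S.erase x)) :
    solDim B μ C ∅ ≤ 1 + excess G C (C.filter (G.Adj x)) := by
  obtain ⟨u, hu⟩ := Finset.card_pos.1 (hS.degIn_comps_pos hx hC)
  refine ((mem_comps.1 hC).2.1.solDim_le_root hB (Finset.mem_filter.1 hu).1).trans ?_
  gcongr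
  exact excess_anti (by simpa using hu)

/-- Let d be the number of edges from x to C. Extended by zero, a solution on C satisfies the
equation at x, which is a relation among d values: zeros at all of them cost d - 1. Zero forcing
from these d zeros leaves at most the excess minus d - 1. Truncated subtraction turns the sum into a
maximum. -/
theorem solDim_comps_le_max (hB : IsMatrixOf G B) {S C : Finset V} (hS : ConnSet G S) {x : V}
    (hx : x ∈ S) (hC : C ∈ comps G (S.erase x))
    (hN : ∀ y ∈ solSpace B μ (S.erase x) ∅, ∑ u ∈ S.filter (G.Adj x), B x u * y u = 0) :
    solDim B μ C ∅ ≤ max (degIn G C x - 1) (excess G C (C.filter (G.Adj x))) := by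
  obtain ⟨h1, h2, h3⟩ := mem_comps.1 hC
  have e1 := solDim_le_card_sub_one_add B μ C ∅ (C.filter (G.Adj x)) (fun u => B x u)
    (fun u hu => hB.apply_ne_zero (Finset.mem_filter.1 hu).2) (fun z hz => by
      rw [← hN z (solSpace_closedIn_le hB h1 h3 hz)]
      refine Finset.sum_subset
        (Finset.filter_subset_filter _ (h1.trans (Finset.erase_subset _ _))) fun u hu hu' => ?_
      rw [hz.1 u fun h => hu' (Finset.mem_filter.2 ⟨h, (Finset.mem_filter.1 hu).2⟩), mul_zero])
  have e2 := h2.solDim_le (μ := μ) hB C (C.filter (G.Adj x)) (Finset.filter_subset _ _)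
    (Finset.card_pos.1 (hS.degIn_comps_pos hx hC))
  rw [Finset.empty_union] at e1
  change solDim B μ C ∅ ≤ degIn G C x - 1 + _ at e1
  change _ ≤ _ - (degIn G C x - 1) at e2
  omega

theorem ConnSet.degIn_le_excess_add_two {S C : Finset V} {x : V}
    (hC : C ∈ comps G (S.erase x)) : degIn G C x ≤ excess G C (C.filter (G.Adj x)) + 2 :=
  (mem_comps.1 hC).2.1.card_le_excess_add_two (Finset.filter_subset _ _)

/-- The behaviour of the components at a vertex of degree at least three whose removal does not
raise the multiplicity, when the multiplicity is at least `1 + majorExcess`. -/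
theorem comps_of_solDim_ge (hB : IsMatrixOf G B) {S : Finset V} (hS : ConnSet G S) {x : V}
    (hx : x ∈ S) (hd : 3 ≤ degIn G S x) (hge : 1 + majorExcess G S ≤ solDim B μ S ∅)
    (hN : ∀ y ∈ solSpace B μ (S.erase x) ∅, ∑ u ∈ S.filter (G.Adj x), B x u * y u = 0) :
    solDim B μ S ∅ = 1 + majorExcess G S ∧
    ((∃ C, comps G (S.erase x) = {C} ∧ degIn G S x = 3 ∧ excess G C (C.filter (G.Adj x)) = 1) ∨
      ∃ C D, C ≠ D ∧ comps G (S.erase x) = {C, D} ∧ ∀ E ∈ comps G (S.erase x),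
        degIn G E x = 1 ∨ (degIn G E x = 2 ∧ excess G E (E.filter (G.Adj x)) = 0)) := by
  have h1 := solDim_le_erase_add_one (B := B) (μ := μ) S x
  rw [solDim_eq_sum_comps hB (S.erase x)] at h1
  have h2 := majorExcess_eq_sum_comps (G := G) hx
  have h3 := sum_comps_degIn (G := G) S x
  have hmax := fun C (hC : C ∈ comps G (S.erase x)) => solDim_comps_le_max hB hS hx hC hN
  have hpos := fun C (hC : C ∈ comps G (S.erase x)) => hS.degIn_comps_pos hx hC
  have hlow := fun C (hC : C ∈ comps G (S.erase x)) => ConnSet.degIn_le_excess_add_two hC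
  -- For d ≥ 1 one has max(d - 1, e) + 1 ≤ d + e, with e the excess of the component. Summing gives
  -- at most `majorExcess` + 2, whereas the multiplicities alone sum to at least `majorExcess`.
  have hk : (comps G (S.erase x)).card ≤ 2 := by
    have h4 : ∑ C ∈ comps G (S.erase x), solDim B μ C ∅ + (comps G (S.erase x)).card ≤
        ∑ C ∈ comps G (S.erase x), (degIn G C x + excess G C (C.filter (G.Adj x))) := by
      rw [Finset.card_eq_sum_ones, ← Finset.sum_add_distrib]
      refine Finset.sum_le_sum fun C hC => ?_
      have := hmax C hC
      have := hpos C hC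
      omega
    rw [Finset.sum_add_distrib, h3] at h4
    omega
  generalize comps G (S.erase x) = 𝒞 at *
  interval_cases hc : 𝒞.card
  · rw [Finset.card_eq_zero] at hc
    subst hc
    simp at h3
    omega
  -- With a single component, e + d - 2 ≤ max(d - 1, e) and d ≥ 3 give e ≤ 1, and d ≤ e + 2 then
  -- leaves d = 3, e = 1. With two components, equality must hold in max(d - 1, e) ≤ d + e - 1 for
  -- both, so d = 1 or e = 0.
  · obtain ⟨C, rfl⟩ := Finset.card_eq_one.1 hc
    simp only [Finset.sum_singleton, Finset.mem_singleton, forall_eq] at *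
    refine ⟨by omega, Or.inl ⟨C, rfl, by omega, by omega⟩⟩
  · obtain ⟨C, D, hCD, rfl⟩ := Finset.card_eq_two.1 hc
    simp only [Finset.sum_pair hCD, Finset.mem_insert, Finset.mem_singleton, forall_eq_or_imp,
      forall_eq] at *
    exact ⟨by omega, Or.inr ⟨C, D, hCD, rfl, by omega, by omega⟩⟩

/-- The upper bound on the multiplicity in the presence of a major vertex. -/
theorem ConnSet.solDim_le_of_major (hB : IsMatrixOf G B) (hμ : star μ = μ) {S : Finset V}
    (hS : ConnSet G S) {x : V} (hx : x ∈ S) (hd : 3 ≤ degIn G S x) :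
    solDim B μ S ∅ ≤ 1 + majorExcess G S := by
  rcases solDim_add_one_le_erase_or hB hμ S hx with h | h
  · rw [solDim_eq_sum_comps hB (S.erase x)] at h
    have h1 := Finset.sum_le_sum fun C (hC : C ∈ comps G (S.erase x)) =>
      solDim_comps_le (μ := μ) hB hS hx hC
    rw [Finset.sum_add_distrib, ← Finset.card_eq_sum_ones] at h1
    have h2 := majorExcess_eq_sum_comps (G := G) hx
    have h3 := hS.card_comps_le hx
    omega
  · by_contra hlt
    have := (comps_of_solDim_ge hB hS hx hd (by omega) h).1
    omega

/-- In the extremal case a major vertex either separates all its neighbours, or its deletion leaves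
one or two components of a very restricted type. -/
theorem comps_of_extremal (hB : IsMatrixOf G B) (hμ : star μ = μ) {S : Finset V}
    (hS : ConnSet G S) {x : V} (hx : x ∈ S) (hd : 3 ≤ degIn G S x)
    (hext : solDim B μ S ∅ = 1 + majorExcess G S) :
    (∀ C ∈ comps G (S.erase x), degIn G C x = 1 ∧
        solDim B μ C ∅ = 1 + excess G C (C.filter (G.Adj x))) ∨
      (∃ C, comps G (S.erase x) = {C} ∧ degIn G S x = 3 ∧ excess G C (C.filter (G.Adj x)) = 1) ∨
      ∃ C D, C ≠ D ∧ comps G (S.erase x) = {C, D} ∧ ∀ E ∈ comps G (S.erase x),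
        degIn G E x = 1 ∨ (degIn G E x = 2 ∧ excess G E (E.filter (G.Adj x)) = 0) := by
  rcases solDim_add_one_le_erase_or hB hμ S hx with h | h
  · left
    rw [solDim_eq_sum_comps hB (S.erase x)] at h
    have hle := fun C (hC : C ∈ comps G (S.erase x)) => solDim_comps_le (μ := μ) hB hS hx hC
    have hpos := fun C (hC : C ∈ comps G (S.erase x)) => hS.degIn_comps_pos hx hC
    have h1 := Finset.sum_le_sum hle
    have h1' := Finset.sum_le_sum hpos
    have h2 := majorExcess_eq_sum_comps (G := G) hx
    have h3 := sum_comps_degIn (G := G) S x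
    rw [Finset.sum_add_distrib, ← Finset.card_eq_sum_ones] at h1
    rw [← Finset.card_eq_sum_ones] at h1'
    -- With k components, 2 + `majorExcess` ≤ ∑ m(C) ≤ k + ∑ e(C) ≤ deg x + ∑ e(C) = 2 +
    -- `majorExcess`. Everything is therefore an equality, term by term.
    have e1 := (Finset.sum_eq_sum_iff_of_le hle).1 (by
      rw [Finset.sum_add_distrib, ← Finset.card_eq_sum_ones]; omega)
    have e2 := (Finset.sum_eq_sum_iff_of_le hpos).1 (by
      rw [← Finset.card_eq_sum_ones]; omega)
    exact fun C hC => ⟨(e2 C hC).symm, e1 C hC⟩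
  · exact Or.inr (comps_of_solDim_ge hB hS hx hd hext.ge h).2

theorem ConnSet.exists_degIn_le_one_or {S : Finset V} (h0 : majorExcess G S = 0) :
    (∃ v ∈ S, degIn G S v ≤ 1) ∨ ∀ v ∈ S, degIn G S v = 2 := by
  by_contra hcon
  push Not at hcon
  obtain ⟨h1, v, hv, h2⟩ := hcon
  have := Finset.sum_eq_zero_iff.1 h0 v hv
  have := h1 v hv
  omega

/-- Rooting at a vertex of degree at most one is free: deg - 1 and deg - 2 both truncate to zero
there. -/
theorem ConnSet.solDim_le_of_pendant (hB : IsMatrixOf G B) {S : Finset V} (hS : ConnSet G S) {w : V}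
    (hw : w ∈ S) (hd : degIn G S w ≤ 1) : solDim B μ S ∅ ≤ 1 + majorExcess G S := by
  refine (hS.solDim_le_root hB hw).trans ?_
  gcongr
  refine Finset.sum_le_sum fun v hv => ?_
  by_cases h : v = w
  · subst h
    rw [if_pos (Finset.mem_singleton_self v)]
    omega
  · rw [if_neg (by simpa using h)]

/-- A component attached by a single edge and attaining the rooted bound. -/
theorem ConnSet.rooted_extremal (hB : IsMatrixOf G B) (hμ : star μ = μ) {S : Finset V}
    (hS : ConnSet G S) {w : V} (hw : w ∈ S) (hext : solDim B μ S ∅ = 1 + excess G S {w}) :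
    (degIn G S w ≤ 1 ∧ solDim B μ S ∅ = 1 + majorExcess G S) ∨
      ((∀ v ∈ S, degIn G S v = 2) ∧ solDim B μ S ∅ = 2) := by
  -- The rooted excess agrees with `majorExcess` if the root has degree at most one, and otherwise
  -- exceeds it by one. In the latter case the multiplicity is 2 + `majorExcess`, beyond the general
  -- bound as soon as there is a major vertex or a vertex of degree at most one. Only the cycle
  -- remains.
  have key : excess G S {w} + (degIn G S w - 2) = majorExcess G S + (degIn G S w - 1) := by
    rw [excess, majorExcess, ← Finset.sum_erase_add S _ hw,
      ← Finset.sum_erase_add S (fun v => degIn G S v - 2) hw, if_pos (by simp)]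
    have : ∑ v ∈ S.erase w, (degIn G S v - if v ∈ ({w} : Finset V) then 1 else 2) =
        ∑ v ∈ S.erase w, (degIn G S v - 2) := by
      refine Finset.sum_congr rfl fun v hv => ?_
      rw [if_neg (by simpa using (Finset.mem_erase.1 hv).1)]
    omega
  rcases Nat.lt_or_ge (degIn G S w) 2 with h | h
  · exact Or.inl ⟨by omega, by omega⟩
  right
  have h0 : majorExcess G S = 0 := by
    by_contra hne
    obtain ⟨x, hx, hx0⟩ := Finset.exists_ne_zero_of_sum_ne_zero hne
    have := hS.solDim_le_of_major (μ := μ) hB hμ hx (by omega)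
    omega
  refine ⟨?_, by omega⟩
  refine (ConnSet.exists_degIn_le_one_or h0).resolve_left ?_
  rintro ⟨v, hv, hv1⟩
  have := hS.solDim_le_of_pendant (μ := μ) hB hv hv1
  omega

end VertexDeletion

/-! ### Cycle vertices expressed by connected sets, and private cycles -/

section CycleVertices

variable {V : Type*} [Fintype V] (G : SimpleGraph V)

/-- Two neighbours of `v` in `S` can be joined inside `S` without using `v`. -/
def CycAt (S : Finset V) (v : V) : Prop :=
  ∃ A ⊆ S.erase v, ConnSet G A ∧ 2 ≤ degIn G A v

/-- The major vertices of the graph induced on `S` that lie on no cycle. -/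
noncomputable def offMajor (S : Finset V) : Finset V :=
  S.filter fun v => 3 ≤ degIn G S v ∧ ¬ CycAt G S v

variable {G}

theorem CycAt.exists_comp {S : Finset V} {v : V} (h : CycAt G S v) :
    ∃ C ∈ comps G (S.erase v), 2 ≤ degIn G C v := by
  obtain ⟨A, hA, hconn, hd⟩ := h
  obtain ⟨a, ha⟩ := hconn.1
  obtain ⟨C, hC, haC⟩ := exists_mem_comps (G := G) (hA ha)
  refine ⟨C, hC, hd.trans (degIn_mono ?_ v)⟩
  exact hconn.subset_of_closedIn hA (mem_comps.1 hC).2.2 ⟨a, Finset.mem_inter.2 ⟨ha, haC⟩⟩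

theorem CycAt.of_mem_comps {S C : Finset V} {v : V} (hC : C ∈ comps G (S.erase v))
    (h : 2 ≤ degIn G C v) : CycAt G S v :=
  ⟨C, (mem_comps.1 hC).1, (mem_comps.1 hC).2.1, h⟩

theorem CycAt.mono {S T : Finset V} (hST : S ⊆ T) {v : V} (h : CycAt G S v) : CycAt G T v := by
  obtain ⟨A, hA, h1⟩ := h
  exact ⟨A, hA.trans (Finset.erase_subset_erase _ hST), h1⟩

theorem sum_ite_adj (A : Finset V) (x : V) :
    ∑ v ∈ A, (if G.Adj x v then 1 else 0) = degIn G A x := by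
  rw [degIn, Finset.card_filter]

theorem sum_degIn_of_mem_comps_erase {S C : Finset V} {x : V} (hx : x ∈ S)
    (hC : C ∈ comps G (S.erase x)) :
    ∑ v ∈ C, degIn G S v = ∑ v ∈ C, degIn G C v + degIn G C x := by
  rw [← sum_ite_adj, ← Finset.sum_add_distrib]
  exact Finset.sum_congr rfl fun v hv => degIn_eq_of_mem_comps_erase hx hC hv

theorem sum_degIn_eq_sum_comps {S : Finset V} {x : V} (hx : x ∈ S) :
    ∑ v ∈ S, degIn G S v =
      ∑ C ∈ comps G (S.erase x), ∑ v ∈ C, degIn G C v + 2 * degIn G S x := by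
  rw [← Finset.sum_erase_add S _ hx, ← sum_comps (G := G) (S.erase x),
    Finset.sum_congr rfl fun C hC => sum_degIn_of_mem_comps_erase hx hC,
    Finset.sum_add_distrib, sum_comps_degIn]
  omega

theorem sum_card_comps (T : Finset V) : ∑ C ∈ comps G T, C.card = T.card := by
  have := sum_comps (G := G) T (fun _ => 1)
  simpa using this

/-- Without isolated vertices, deg + [deg = 1] = 2 + max(deg - 2, 0) at each vertex. This is the
identity 2θ + p = `majorExcess` + 2. -/
theorem sum_degIn_add_pendant {S : Finset V} (hS : ConnSet G S) (hc : 2 ≤ S.card) :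
    ∑ v ∈ S, degIn G S v + (S.filter fun v => degIn G S v = 1).card =
      2 * S.card + majorExcess G S := by
  rw [Finset.card_filter, majorExcess, ← Finset.sum_add_distrib, mul_comm, ← smul_eq_mul,
    ← Finset.sum_const, ← Finset.sum_add_distrib]
  refine Finset.sum_congr rfl fun v hv => ?_
  have := hS.degIn_pos hc hv
  split_ifs <;> omega

/-- A connected regular set of degree two is a cycle through each of its vertices. -/
theorem ConnSet.cycAt_of_regular {S : Finset V} (hS : ConnSet G S)
    (hreg : ∀ v ∈ S, degIn G S v = 2) {w : V} (hw : w ∈ S) : CycAt G S w := by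
  have hd := hreg w hw
  obtain ⟨u, hu⟩ := Finset.card_pos.1 (show 0 < degIn G S w by omega)
  rw [Finset.mem_filter] at hu
  obtain ⟨C, hC, -⟩ := exists_mem_comps (G := G) (Finset.mem_erase.2 ⟨hu.2.ne', hu.1⟩)
  refine CycAt.of_mem_comps hC ?_
  have h1 := hS.degIn_comps_pos hw hC
  have h2 := sum_degIn_of_mem_comps_erase hw hC
  rw [Finset.sum_congr rfl fun v hv =>
    hreg v (Finset.mem_of_mem_erase ((mem_comps.1 hC).1 hv))] at h2
  -- Inside C the degree sum is 2|C| minus the number of edges to w. That number is thus even and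
  -- positive, so at least two.
  obtain ⟨k, hk⟩ := even_sum_degIn (G := G) C
  simp only [Finset.sum_const, smul_eq_mul] at h2
  omega

/-- Each vertex of `X` carrying a private cycle contributes to the cyclomatic number. -/
theorem ConnSet.card_private_cycles {S : Finset V} (hS : ConnSet G S) {X : Finset V} (hX : X ⊆ S)
    (f : V → Finset V) (hf : ∀ x ∈ X, f x ∈ comps G (S.erase x))
    (hdisj : ∀ x ∈ X, Disjoint (f x) X) (hd : ∀ x ∈ X, 2 ≤ degIn G (f x) x) :
    2 * S.card + 2 * X.card ≤ ∑ v ∈ S, degIn G S v + 2 := by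
  set U := X.biUnion f with hU
  have hfS : ∀ x ∈ X, f x ⊆ S := fun x hx =>
    (mem_comps.1 (hf x hx)).1.trans (Finset.erase_subset _ _)
  have hUS : U ⊆ S := Finset.biUnion_subset.2 hfS
  have hXR : X ⊆ S \ U := by
    intro x hx
    refine Finset.mem_sdiff.2 ⟨hX hx, fun h => ?_⟩
    obtain ⟨y, hy, hxy⟩ := Finset.mem_biUnion.1 h
    exact Finset.disjoint_left.1 (hdisj y hy) hxy hx
  have hRne : (S \ U).Nonempty := by
    rcases X.eq_empty_or_nonempty with rfl | h
    · simpa [hU] using hS.1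
    · exact h.mono hXR
  -- The pieces `f x` hang at their vertices x only. A closed part of the rest, enlarged by the
  -- pieces hanging at it, is closed in `S` and hence everything.
  have hR : ConnSet G (S \ U) := by
    refine ⟨hRne, fun C hC hCne hcl => ?_⟩
    have h1 : ClosedIn G (C ∪ (X ∩ C).biUnion f) S := by
      intro a ha b hb hab
      rcases Finset.mem_union.1 ha with ha | ha
      · by_cases hbU : b ∈ U
        · obtain ⟨x, hx, hbx⟩ := Finset.mem_biUnion.1 hbU
          obtain ⟨haS, haU⟩ := Finset.mem_sdiff.1 (hC ha)
          have hax : a = x := by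
            by_contra hne
            exact haU (Finset.mem_biUnion.2 ⟨x, hx, (mem_comps.1 (hf x hx)).2.2 b hbx a
              (Finset.mem_erase.2 ⟨hne, haS⟩) hab.symm⟩)
          subst hax
          exact Finset.mem_union_right _
            (Finset.mem_biUnion.2 ⟨a, Finset.mem_inter.2 ⟨hx, ha⟩, hbx⟩)
        · exact Finset.mem_union_left _ (hcl a ha b (Finset.mem_sdiff.2 ⟨hb, hbU⟩) hab)
      · obtain ⟨x, hx, hax⟩ := Finset.mem_biUnion.1 ha
        obtain ⟨hxX, hxC⟩ := Finset.mem_inter.1 hx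
        by_cases hbx : b = x
        · subst hbx; exact Finset.mem_union_left _ hxC
        · exact Finset.mem_union_right _ (Finset.mem_biUnion.2 ⟨x, hx,
            (mem_comps.1 (hf x hxX)).2.2 a hax b (Finset.mem_erase.2 ⟨hbx, hb⟩) hab⟩)
    have h2 := hS.2 _ (Finset.union_subset (hC.trans Finset.sdiff_subset)
      (Finset.biUnion_subset.2 fun x hx => hfS x (Finset.mem_inter.1 hx).1))
      (hCne.mono Finset.subset_union_left) h1
    refine Finset.Subset.antisymm hC fun v hv => ?_
    obtain ⟨hvS, hvU⟩ := Finset.mem_sdiff.1 hv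
    rw [← h2] at hvS
    refine (Finset.mem_union.1 hvS).resolve_right fun h => hvU ?_
    exact Finset.biUnion_subset_biUnion_of_subset_left f Finset.inter_subset_left h
  -- If two pieces met, connectivity would put `f x` inside `f y`. Then x, adjacent to `f x`, would
  -- lie in `f y` too, which avoids `X`.
  have hpair : (X : Set V).PairwiseDisjoint f := by
    intro x hx y hy hxy
    rw [Function.onFun, Finset.disjoint_left]
    intro v hvx hvy
    have hsub : f x ⊆ f y := by
      refine (mem_comps.1 (hf x hx)).2.1.subset_of_closedIn (T := S.erase y) (fun a ha => ?_)
        (mem_comps.1 (hf y hy)).2.2 ⟨v, Finset.mem_inter.2 ⟨hvx, hvy⟩⟩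
      exact Finset.mem_erase.2 ⟨by
        rintro rfl; exact Finset.disjoint_left.1 (hdisj x hx) ha hy, hfS x hx ha⟩
    obtain ⟨a, ha⟩ := Finset.card_pos.1 (show 0 < degIn G (f x) x from by have := hd x hx; omega)
    rw [Finset.mem_filter] at ha
    exact Finset.disjoint_left.1 (hdisj y hy) ((mem_comps.1 (hf y hy)).2.2 a (hsub ha.1) x
      (Finset.mem_erase.2 ⟨hxy, hX hx⟩) ha.2.symm) hx
  -- Each x loses at least two edges to its piece, and each piece has degree sum at least 2|f x| in
  -- S. With |E| ≥ |V| - 1 on the rest, every piece adds at least one to the cyclomatic number.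
  have e1 : ∑ v ∈ S \ U, degIn G (S \ U) v + 2 * X.card ≤ ∑ v ∈ S \ U, degIn G S v := by
    have : 2 * X.card = ∑ v ∈ S \ U, if v ∈ X then 2 else 0 := by
      rw [Finset.sum_ite_mem, Finset.inter_eq_right.2 hXR, Finset.sum_const, smul_eq_mul, mul_comm]
    rw [this, ← Finset.sum_add_distrib]
    refine Finset.sum_le_sum fun v _ => ?_
    split_ifs with hv
    · refine (Nat.add_le_add_left (hd v hv) _).trans ?_
      unfold degIn
      rw [← Finset.card_union_of_disjoint]
      · refine Finset.card_le_card (Finset.union_subset ?_ ?_)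
        · exact Finset.filter_subset_filter _ Finset.sdiff_subset
        · exact Finset.filter_subset_filter _ (hfS v hv)
      · refine Finset.disjoint_filter_filter (Finset.disjoint_left.2 fun a ha hav => ?_)
        exact (Finset.mem_sdiff.1 ha).2 (Finset.mem_biUnion.2 ⟨v, hv, hav⟩)
    · exact degIn_mono Finset.sdiff_subset v
  have e2 : 2 * U.card ≤ ∑ v ∈ U, degIn G S v := by
    rw [hU, Finset.sum_biUnion hpair, Finset.card_biUnion hpair, Finset.mul_sum]
    refine Finset.sum_le_sum fun x hx => ?_
    rw [sum_degIn_of_mem_comps_erase (hX hx) (hf x hx)]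
    have := (mem_comps.1 (hf x hx)).2.1.two_mul_card_le
    have := hd x hx
    omega
  have e3 := hR.two_mul_card_le
  have e4 := Finset.sum_sdiff (f := fun v => degIn G S v) hUS
  have e5 := Finset.card_sdiff_add_card_eq_card hUS
  omega

end CycleVertices

/-! ### Structure of extremal connected sets -/

section Structure

variable {V : Type*} [Fintype V] {G : SimpleGraph V} {B : Matrix V V ℂ} {μ : ℂ}

/-- Extremal connected sets all of whose major vertices lie on cycles are unicyclic with one
pendant vertex or bicyclic without pendant vertices. -/
theorem ConnSet.extremal_of_cycAt (hB : IsMatrixOf G B) (hμ : star μ = μ) {S : Finset V}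
    (hS : ConnSet G S) (hext : solDim B μ S ∅ = 1 + majorExcess G S)
    (hmaj : ∃ x ∈ S, 3 ≤ degIn G S x) (hcyc : ∀ x ∈ S, 3 ≤ degIn G S x → CycAt G S x) :
    (majorExcess G S = 1 ∧ (S.filter fun v => degIn G S v = 1).card = 1) ∨
      (majorExcess G S = 2 ∧ (S.filter fun v => degIn G S v = 1).card = 0) := by
  have hc : 2 ≤ S.card := by
    obtain ⟨x, -, h3⟩ := hmaj
    exact le_trans (by omega) (h3.trans (Finset.card_le_card (Finset.filter_subset _ _)))
  have hp := sum_degIn_add_pendant hS hc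
  -- A cycle vertex has two neighbours in one component, so it does not separate all its neighbours;
  -- only the rigid alternatives remain.
  have hdich := fun x (hx : x ∈ S) (h3 : 3 ≤ degIn G S x) =>
    (comps_of_extremal (μ := μ) hB hμ hS hx h3 hext).resolve_left fun h => by
      obtain ⟨C, hC, h2⟩ := (hcyc x hx h3).exists_comp
      have := (h C hC).1
      omega
  have hcard : ∀ x ∈ S, ∑ C ∈ comps G (S.erase x), C.card + 1 = S.card := fun x hx => by
    rw [sum_card_comps, Finset.card_erase_add_one hx]
  by_cases h1 : ∃ x ∈ S, 3 ≤ degIn G S x ∧ ∃ C, comps G (S.erase x) = {C} ∧ degIn G S x = 3 ∧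
      excess G C (C.filter (G.Adj x)) = 1
  -- Here `majorExcess` is 1 + (3 - 2) = 2. Returning x to the connected set C adds three edges, so
  -- the cyclomatic number is at least 2 and no pendant vertex is possible. Two components with two
  -- edges each are treated alike.
  · obtain ⟨x, hx, -, C, hC, h3, hΦ⟩ := h1
    have e1 := sum_degIn_eq_sum_comps (G := G) hx
    have e2 := hcard x hx
    have e3 := majorExcess_eq_sum_comps (G := G) hx
    have e4 := (mem_comps.1 (show C ∈ comps G (S.erase x) by rw [hC]; simp)).2.1.two_mul_card_le
    rw [hC, Finset.sum_singleton] at e1 e2 e3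
    omega
  by_cases h2 : ∃ x ∈ S, 3 ≤ degIn G S x ∧ ∃ C D, C ≠ D ∧ comps G (S.erase x) = {C, D} ∧
      ∀ E ∈ comps G (S.erase x), degIn G E x = 2 ∧ excess G E (E.filter (G.Adj x)) = 0
  · obtain ⟨x, hx, -, C, D, hne, hCD, h3⟩ := h2
    have e1 := sum_degIn_eq_sum_comps (G := G) hx
    have e2 := hcard x hx
    have e3 := majorExcess_eq_sum_comps (G := G) hx
    have e0 := sum_comps_degIn (G := G) S x
    have hCm : C ∈ comps G (S.erase x) := by rw [hCD]; simp
    have hDm : D ∈ comps G (S.erase x) := by rw [hCD]; simp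
    have e4 := (mem_comps.1 hCm).2.1.two_mul_card_le
    have e5 := (mem_comps.1 hDm).2.1.two_mul_card_le
    have e6 := h3 C hCm
    have e7 := h3 D hDm
    rw [hCD, Finset.sum_pair hne] at e0 e1 e2 e3
    omega
  -- In the remaining case each major vertex has degree three, and two of its edges lead to a
  -- component of excess zero, that is, one without further major vertices.
  have hpriv : ∀ x, ∃ C, x ∈ S → 3 ≤ degIn G S x → degIn G S x = 3 ∧ C ∈ comps G (S.erase x) ∧
      degIn G C x = 2 ∧ excess G C (C.filter (G.Adj x)) = 0 := by
    intro x
    by_cases hx : x ∈ S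
    swap
    · exact ⟨∅, fun h => absurd h hx⟩
    by_cases h3 : 3 ≤ degIn G S x
    swap
    · exact ⟨∅, fun _ h => absurd h h3⟩
    rcases hdich x hx h3 with h | ⟨C, D, hne, hCD, hE⟩
    · exact absurd ⟨x, hx, h3, h⟩ h1
    · have hCm : C ∈ comps G (S.erase x) := by rw [hCD]; simp
      have hDm : D ∈ comps G (S.erase x) := by rw [hCD]; simp
      have e0 := sum_comps_degIn (G := G) S x
      rw [hCD, Finset.sum_pair hne] at e0
      rcases hE C hCm with hC | hC
      · rcases hE D hDm with hD | hD
        · omega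
        · exact ⟨D, fun _ _ => ⟨by omega, hDm, hD⟩⟩
      · rcases hE D hDm with hD | hD
        · exact ⟨C, fun _ _ => ⟨by omega, hCm, hC⟩⟩
        · refine absurd ⟨x, hx, h3, C, D, hne, hCD, ?_⟩ h2
          rw [hCD]
          simp only [Finset.mem_insert, Finset.mem_singleton, forall_eq_or_imp, forall_eq]
          exact ⟨hC, hD⟩
  choose f hf using hpriv
  set X := S.filter fun v => 3 ≤ degIn G S v with hXdef
  have hX : ∀ x ∈ X, x ∈ S ∧ 3 ≤ degIn G S x := fun x hx => Finset.mem_filter.1 hx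
  -- Now `majorExcess` = |X| and θ ≥ |X|, so 2θ + p = |X| + 2 gives |X| + p ≤ 2. Parity decides p.
  have e1 := hS.card_private_cycles (X := X) (Finset.filter_subset _ _) f
    (fun x hx => (hf x (hX x hx).1 (hX x hx).2).2.1) (fun x hx => ?_)
    (fun x hx => (hf x (hX x hx).1 (hX x hx).2).2.2.1.ge)
  · have e2 : majorExcess G S = X.card := by
      rw [majorExcess, hXdef, Finset.card_filter]
      refine Finset.sum_congr rfl fun v hv => ?_
      split_ifs with h
      · have := (hf v hv h).1
        omega
      · omega
    have e3 : 1 ≤ X.card := by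
      obtain ⟨x, hx, h3⟩ := hmaj
      exact Finset.card_pos.2 ⟨x, Finset.mem_filter.2 ⟨hx, h3⟩⟩
    obtain ⟨k, hk⟩ := even_sum_degIn (G := G) S
    omega
  · obtain ⟨hxS, h3⟩ := hX x hx
    obtain ⟨-, h4, h5, h6⟩ := hf x hxS h3
    rw [excess_of_mem_comps_erase hxS h4] at h6
    rw [Finset.disjoint_left]
    intro v hv hvX
    have := Finset.sum_eq_zero_iff.1 h6 v hv
    have := (hX v hvX).2
    omega

/-- A cycle cannot cross the bridge from x to its only neighbour w in C. If the connected set A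
witnessing the cycle contains x, every nonempty closed part of A ∩ C contains w, so A ∩ C is
connected. It keeps all neighbours of v in A, since v adjacent to x would mean v = w, which lies in
A. -/
theorem cycAt_comps_iff {S C : Finset V} {x v : V} (hC : C ∈ comps G (S.erase x))
    (h1 : degIn G C x = 1) (hv : v ∈ C) : CycAt G S v ↔ CycAt G C v := by
  obtain ⟨hCS, hCconn, hCcl⟩ := mem_comps.1 hC
  refine ⟨fun h => ?_, CycAt.mono (hCS.trans (Finset.erase_subset _ _))⟩
  obtain ⟨A, hA, hAconn, hAd⟩ := h
  obtain ⟨a, ha, b, hb, hab⟩ := Finset.one_lt_card.1 hAd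
  rw [Finset.mem_filter] at ha hb
  have hmem : ∀ u ∈ A, u ≠ x → G.Adj v u → u ∈ C := fun u hu hux hvu =>
    hCcl v hv u (Finset.mem_erase.2 ⟨hux, Finset.mem_of_mem_erase (hA hu)⟩) hvu
  have hAC : (A ∩ C).Nonempty := by
    by_cases hax : a = x
    · exact ⟨b, Finset.mem_inter.2 ⟨hb.1, hmem b hb.1 (fun h => hab (hax.trans h.symm)) hb.2⟩⟩
    · exact ⟨a, Finset.mem_inter.2 ⟨ha.1, hmem a ha.1 hax ha.2⟩⟩
  by_cases hxA : x ∈ A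
  swap
  · have hsub : A ⊆ C := hAconn.subset_of_closedIn (T := S.erase x) (fun u hu =>
      Finset.mem_erase.2 ⟨fun h => hxA (h ▸ hu), Finset.mem_of_mem_erase (hA hu)⟩) hCcl hAC
    exact ⟨A, fun u hu => Finset.mem_erase.2 ⟨Finset.ne_of_mem_erase (hA hu), hsub hu⟩, hAconn, hAd⟩
  obtain ⟨w, hw⟩ := Finset.card_eq_one.1 h1
  have hwu : ∀ u ∈ C, G.Adj x u → u = w := fun u hu hxu => by
    have : u ∈ C.filter (G.Adj x) := Finset.mem_filter.2 ⟨hu, hxu⟩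
    rwa [hw, Finset.mem_singleton] at this
  have hclosed : ∀ F ⊆ A ∩ C, F.Nonempty → ClosedIn G F (A ∩ C) → w ∈ F := by
    intro F hF hFne hFcl
    by_contra hwF
    have hFA : F = A := by
      refine hAconn.2 F (hF.trans Finset.inter_subset_left) hFne fun p hp q hq hpq => ?_
      have hpC := (Finset.mem_inter.1 (hF hp)).2
      by_cases hqx : q = x
      · subst hqx
        have := hwu p hpC hpq.symm
        subst this
        exact absurd hp hwF
      · refine hFcl p hp q (Finset.mem_inter.2 ⟨hq, ?_⟩) hpq
        exact hCcl p hpC q (Finset.mem_erase.2 ⟨hqx, Finset.mem_of_mem_erase (hA hq)⟩) hpq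
    rw [← hFA] at hxA
    exact Finset.notMem_erase x S (hCS (Finset.mem_inter.1 (hF hxA)).2)
  have hwA := hclosed _ subset_rfl hAC fun a _ b hb _ => hb
  refine ⟨A ∩ C, fun u hu => ?_, ⟨hAC, fun F hF hFne hFcl => ?_⟩, hAd.trans ?_⟩
  · exact Finset.mem_erase.2 ⟨Finset.ne_of_mem_erase (hA (Finset.mem_inter.1 hu).1),
      (Finset.mem_inter.1 hu).2⟩
  · by_contra hne
    have h2 : ((A ∩ C) \ F).Nonempty := Finset.sdiff_nonempty.2 fun h =>
      hne (Finset.Subset.antisymm hF h)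
    have := hclosed _ Finset.sdiff_subset h2 hFcl.sdiff
    exact (Finset.mem_sdiff.1 this).2 (hclosed F hF hFne hFcl)
  · refine Finset.card_le_card fun u hu => ?_
    rw [Finset.mem_filter] at hu ⊢
    refine ⟨Finset.mem_inter.2 ⟨hu.1, hmem u hu.1 ?_ hu.2⟩, hu.2⟩
    rintro rfl
    have := hwu v hv hu.2.symm
    subst this
    exact Finset.notMem_erase v S (hA (Finset.mem_inter.1 hwA).1)

theorem degIn_comps_eq_one_of_not_cycAt {S C : Finset V} (hS : ConnSet G S) {x : V} (hx : x ∈ S)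
    (hcyc : ¬ CycAt G S x) (hC : C ∈ comps G (S.erase x)) : degIn G C x = 1 := by
  have h1 := hS.degIn_comps_pos hx hC
  by_contra hne
  exact hcyc (CycAt.of_mem_comps hC (by omega))

/-- In the extremal case, each component at an off-cycle major vertex `x` is attached by a single
edge, and is extremal with a vertex of degree at most one or a cycle of multiplicity two. -/
theorem ConnSet.comps_offMajor (hB : IsMatrixOf G B) (hμ : star μ = μ) {S : Finset V}
    (hS : ConnSet G S) (hext : solDim B μ S ∅ = 1 + majorExcess G S) {x : V}
    (hx : x ∈ offMajor G S) {C : Finset V} (hC : C ∈ comps G (S.erase x)) :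
    degIn G C x = 1 ∧
      ((solDim B μ C ∅ = 1 + majorExcess G C ∧ (∃ w ∈ C, degIn G C w ≤ 1) ∧
        ∀ v ∈ C, G.Adj x v → degIn G C v ≤ 1) ∨
      ((∀ v ∈ C, degIn G C v = 2) ∧ solDim B μ C ∅ = 2)) := by
  obtain ⟨hxS, h3, hcyc⟩ := Finset.mem_filter.1 hx
  have hone := fun D hD => degIn_comps_eq_one_of_not_cycAt (C := D) hS hxS hcyc hD
  refine ⟨hone C hC, ?_⟩
  -- All components are attached by one edge, so their number is deg x ≥ 3. The alternatives with
  -- one or two components are impossible.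
  have hm : solDim B μ C ∅ = 1 + excess G C (C.filter (G.Adj x)) := by
    have hsum := sum_comps_degIn (G := G) S x
    rcases comps_of_extremal hB hμ hS hxS h3 hext with h | ⟨D, hD, -⟩ | ⟨D, E, hne, hDE, -⟩
    · exact (h C hC).2
    · have := hone D (by rw [hD]; simp)
      rw [hD, Finset.sum_singleton] at hsum
      omega
    · have := hone D (by rw [hDE]; simp)
      have := hone E (by rw [hDE]; simp)
      rw [hDE, Finset.sum_pair hne] at hsum
      omega
  obtain ⟨w, hw⟩ := Finset.card_eq_one.1 (hone C hC)
  have hwm : w ∈ C ∧ G.Adj x w := by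
    have : w ∈ C.filter (G.Adj x) := by rw [hw]; simp
    simpa using this
  rw [hw] at hm
  rcases (mem_comps.1 hC).2.1.rooted_extremal hB hμ hwm.1 hm with h | h
  · refine Or.inl ⟨h.2, ⟨w, hwm.1, h.1⟩, fun v hv hxv => ?_⟩
    have : v ∈ C.filter (G.Adj x) := Finset.mem_filter.2 ⟨hv, hxv⟩
    rw [hw, Finset.mem_singleton] at this
    subst this
    exact h.1
  · exact Or.inr h

/-- Deleting x changes degrees only at the ends of bridges. Such an end has degree at most one in C,
hence at most two in S, or lies on a cycle; it is not an off-cycle major vertex before or after.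
This makes the induction over components possible and keeps such vertices pairwise nonadjacent. -/
theorem ConnSet.mem_offMajor_comps_iff (hB : IsMatrixOf G B) (hμ : star μ = μ) {S : Finset V}
    (hS : ConnSet G S) (hext : solDim B μ S ∅ = 1 + majorExcess G S) {x : V}
    (hx : x ∈ offMajor G S) {C : Finset V} (hC : C ∈ comps G (S.erase x)) {v : V} (hv : v ∈ C) :
    (v ∈ offMajor G S ↔ v ∈ offMajor G C) ∧ (G.Adj x v → v ∉ offMajor G S) := by
  obtain ⟨h1, h2⟩ := hS.comps_offMajor hB hμ hext hx hC
  have hxS := (Finset.mem_filter.1 hx).1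
  have hcyc := cycAt_comps_iff hC h1 hv
  have hd := degIn_eq_of_mem_comps_erase hxS hC hv
  have hvS : v ∈ S := Finset.mem_of_mem_erase ((mem_comps.1 hC).1 hv)
  simp only [offMajor, Finset.mem_filter, hv, hvS, true_and, hcyc]
  rcases h2 with ⟨-, -, h⟩ | ⟨h, -⟩
  · by_cases hxv : G.Adj x v
    · have := h v hv hxv
      rw [if_pos hxv] at hd
      exact ⟨⟨fun h' => by omega, fun h' => by omega⟩, fun _ h' => by omega⟩
    · rw [if_neg hxv, add_zero] at hd
      rw [hd]
      exact ⟨Iff.rfl, fun h' => absurd h' hxv⟩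
  · have := (mem_comps.1 hC).2.1.cycAt_of_regular h hv
    simp [this]

theorem ConnSet.offMajor_not_adj (hB : IsMatrixOf G B) (hμ : star μ = μ) {S : Finset V}
    (hS : ConnSet G S) (hext : solDim B μ S ∅ = 1 + majorExcess G S) {x y : V}
    (hx : x ∈ offMajor G S) (hy : y ∈ offMajor G S) : ¬ G.Adj x y := by
  intro hxy
  obtain ⟨C, hC, hyC⟩ := exists_mem_comps (G := G)
    (Finset.mem_erase.2 ⟨hxy.ne', (Finset.mem_filter.1 hy).1⟩)
  exact (hS.mem_offMajor_comps_iff hB hμ hext hx hC hyC).2 hxy hy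

theorem comps_sdiff_eq_biUnion {S M : Finset V} {x : V} (hx : x ∈ M) :
    comps G (S \ M) = (comps G (S.erase x)).biUnion fun C => comps G (C \ M) := by
  have hsub : S \ M ⊆ S.erase x := fun v hv => by
    obtain ⟨h1, h2⟩ := Finset.mem_sdiff.1 hv
    exact Finset.mem_erase.2 ⟨by rintro rfl; exact h2 hx, h1⟩
  ext K
  rw [Finset.mem_biUnion]
  constructor
  · intro hK
    obtain ⟨h1, h2, h3⟩ := mem_comps.1 hK
    obtain ⟨a, ha⟩ := h2.1
    obtain ⟨C, hC, haC⟩ := exists_mem_comps (G := G) (hsub (h1 ha))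
    obtain ⟨g1, g2, g3⟩ := mem_comps.1 hC
    have hKC : K ⊆ C := h2.subset_of_closedIn (h1.trans hsub) g3
      ⟨a, Finset.mem_inter.2 ⟨ha, haC⟩⟩
    refine ⟨C, hC, mem_comps.2 ⟨fun v hv => ?_, h2, h3.mono ?_⟩⟩
    · exact Finset.mem_sdiff.2 ⟨hKC hv, (Finset.mem_sdiff.1 (h1 hv)).2⟩
    · exact Finset.sdiff_subset_sdiff (g1.trans (Finset.erase_subset _ _)) subset_rfl
  · rintro ⟨C, hC, hK⟩
    obtain ⟨g1, g2, g3⟩ := mem_comps.1 hC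
    obtain ⟨h1, h2, h3⟩ := mem_comps.1 hK
    have hCS : C ⊆ S := g1.trans (Finset.erase_subset _ _)
    refine mem_comps.2 ⟨h1.trans (Finset.sdiff_subset_sdiff hCS subset_rfl), h2, ?_⟩
    intro a ha b hb hab
    refine h3 a ha b (Finset.mem_sdiff.2 ⟨?_, (Finset.mem_sdiff.1 hb).2⟩) hab
    exact g3 a (Finset.mem_sdiff.1 (h1 ha)).1 b (hsub hb) hab

theorem sum_comps_sdiff {N : Type*} [AddCommMonoid N] {S M : Finset V} {x : V} (hx : x ∈ M)
    (F : Finset V → N) : ∑ K ∈ comps G (S \ M), F K =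
      ∑ C ∈ comps G (S.erase x), ∑ K ∈ comps G (C \ M), F K := by
  rw [comps_sdiff_eq_biUnion hx, Finset.sum_biUnion]
  intro C hC D hD hne
  rw [Function.onFun, Finset.disjoint_left]
  intro K hKC hKD
  obtain ⟨a, ha⟩ := (mem_comps.1 hKC).2.1.1
  exact hne (comps_eq_of_inter hC hD ⟨a, Finset.mem_inter.2
    ⟨(Finset.mem_sdiff.1 ((mem_comps.1 hKC).1 ha)).1,
      (Finset.mem_sdiff.1 ((mem_comps.1 hKD).1 ha)).1⟩⟩)

/-- The two kinds of components left after deleting the off-cycle major vertices of an extremal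
connected set: a path with eigenvalue `μ`, or a unicyclic graph with multiplicity two, the latter
containing exactly one major vertex of `S`, of degree three. -/
def GoodComp (G : SimpleGraph V) (B : Matrix V V ℂ) (μ : ℂ) (S K : Finset V) : Prop :=
  (∑ v ∈ K, degIn G K v + 2 = 2 * K.card ∧ 1 ≤ solDim B μ K ∅ ∧ ∑ v ∈ K, (degIn G S v - 2) = 0) ∨
  (∑ v ∈ K, degIn G K v = 2 * K.card ∧ solDim B μ K ∅ = 2 ∧ ∑ v ∈ K, (degIn G S v - 2) = 1)

theorem ConnSet.goodComp_of_extremal (hB : IsMatrixOf G B) (hμ : star μ = μ) (S : Finset V)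
    (hS : ConnSet G S) (hext : solDim B μ S ∅ = 1 + majorExcess G S)
    (h : (offMajor G S).Nonempty ∨ ∃ w ∈ S, degIn G S w ≤ 1) :
    (∀ K ∈ comps G (S \ offMajor G S), GoodComp G B μ S K) ∧
      ∑ K ∈ comps G (S \ offMajor G S),
        ((∑ v ∈ K, degIn G K v : ℕ) - 2 * (K.card : ℤ) + 2) =
      (∑ v ∈ S, degIn G S v : ℕ) - 2 * (S.card : ℤ) + 2 := by
  induction hn : S.card using Nat.strong_induction_on generalizing S with
  | _ n ih =>
  rw [← hn]
  rcases (offMajor G S).eq_empty_or_nonempty with hM | ⟨x, hx⟩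
  · obtain ⟨w, hw, hw1⟩ := h.resolve_left (by simp [hM])
    rw [hM, Finset.sdiff_empty, hS.comps_eq]
    simp only [Finset.mem_singleton, forall_eq, Finset.sum_singleton, and_true]
    have hcyc : ∀ x ∈ S, 3 ≤ degIn G S x → CycAt G S x := fun x hx h3 => by
      by_contra hc
      have : x ∈ offMajor G S := Finset.mem_filter.2 ⟨hx, h3, hc⟩
      simp [hM] at this
    have hlow := hS.two_mul_card_le
    obtain ⟨k, hk⟩ := even_sum_degIn (G := G) S
    -- All major vertices lie on cycles. The vertex of degree at most one excludes the bicyclic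
    -- case, leaving the unicyclic one with a pendant vertex; without major vertices the set is a
    -- tree with degrees at most two.
    by_cases hmaj : ∃ x ∈ S, 3 ≤ degIn G S x
    · have hc : 2 ≤ S.card := by
        obtain ⟨x, -, h3⟩ := hmaj
        exact le_trans (by omega) (h3.trans (Finset.card_le_card (Finset.filter_subset _ _)))
      have hp := sum_degIn_add_pendant hS hc
      have hp1 : 1 ≤ (S.filter fun v => degIn G S v = 1).card := by
        refine Finset.card_pos.2 ⟨w, Finset.mem_filter.2 ⟨hw, ?_⟩⟩
        have := hS.degIn_pos hc hw
        omega
      right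
      have := hS.extremal_of_cycAt hB hμ hext hmaj hcyc
      change _ ∧ _ ∧ majorExcess G S = 1
      omega
    · push Not at hmaj
      have h0 : majorExcess G S = 0 := Finset.sum_eq_zero fun v hv => by
        have := hmaj v hv; omega
      left
      refine ⟨?_, by omega, h0⟩
      have hlt : ∑ v ∈ S, degIn G S v < ∑ v ∈ S, 2 :=
        Finset.sum_lt_sum (fun v hv => by have := hmaj v hv; omega) ⟨w, hw, by omega⟩
      rw [Finset.sum_const, smul_eq_mul] at hlt
      omega
  · have hxS := (Finset.mem_filter.1 hx).1
    have hMC : ∀ C ∈ comps G (S.erase x), C \ offMajor G S = C \ offMajor G C := by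
      intro C hC
      ext v
      simp only [Finset.mem_sdiff]
      refine and_congr_right fun hv => not_congr ?_
      exact (hS.mem_offMajor_comps_iff hB hμ hext hx hC hv).1
    have hpiece : ∀ C ∈ comps G (S.erase x),
        (∀ K ∈ comps G (C \ offMajor G C), GoodComp G B μ S K) ∧
        ∑ K ∈ comps G (C \ offMajor G C),
          ((∑ v ∈ K, degIn G K v : ℕ) - 2 * (K.card : ℤ) + 2) =
        (∑ v ∈ C, degIn G C v : ℕ) - 2 * (C.card : ℤ) + 2 := by
      intro C hC
      obtain ⟨g1, g2, g3⟩ := mem_comps.1 hC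
      obtain ⟨h1, ⟨h2, h3, h4⟩ | ⟨h2, h3⟩⟩ := hS.comps_offMajor hB hμ hext hx hC
      · have hlt : C.card < n := by
          rw [← hn, ← Finset.card_erase_add_one hxS]
          exact Nat.lt_succ_of_le (Finset.card_le_card g1)
        obtain ⟨i1, i2⟩ := ih C.card hlt C g2 h2 (Or.inr h3) rfl
        refine ⟨fun K hK => ?_, i2⟩
        have : ∑ v ∈ K, (degIn G S v - 2) = ∑ v ∈ K, (degIn G C v - 2) := by
          refine Finset.sum_congr rfl fun v hv => ?_
          have hvC : v ∈ C := (Finset.mem_sdiff.1 ((mem_comps.1 hK).1 hv)).1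
          rw [degIn_eq_of_mem_comps_erase hxS hC hvC]
          split_ifs with hxv
          · have := h4 v hvC hxv
            omega
          · rfl
        unfold GoodComp
        rw [this]
        exact i1 K hK
      · have hM : offMajor G C = ∅ := by
          refine Finset.eq_empty_of_forall_notMem fun v hv => ?_
          obtain ⟨hvC, hv3, -⟩ := Finset.mem_filter.1 hv
          have := h2 v hvC
          omega
        rw [hM, Finset.sdiff_empty, g2.comps_eq]
        simp only [Finset.mem_singleton, forall_eq, Finset.sum_singleton, and_true]
        right
        refine ⟨?_, h3, ?_⟩
        · rw [Finset.sum_congr rfl h2, Finset.sum_const, smul_eq_mul, mul_comm]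
        · rw [← h1, ← sum_ite_adj]
          refine Finset.sum_congr rfl fun v hv => ?_
          rw [degIn_eq_of_mem_comps_erase hxS hC hv, h2 v hv]
          omega
    constructor
    · intro K hK
      rw [comps_sdiff_eq_biUnion hx, Finset.mem_biUnion] at hK
      obtain ⟨C, hC, hK⟩ := hK
      rw [hMC C hC] at hK
      exact (hpiece C hC).1 K hK
    · rw [sum_comps_sdiff hx, Finset.sum_congr rfl fun C hC => by
        rw [hMC C hC, (hpiece C hC).2]]
      -- The summands are twice the cyclomatic numbers. Deleting x removes deg x bridges and one
      -- vertex and creates deg x components, so their sum is preserved.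
      have e1 := sum_degIn_eq_sum_comps (G := G) hxS
      have e2 := sum_card_comps (G := G) (S.erase x)
      have e3 := Finset.card_erase_add_one hxS
      have e4 : (comps G (S.erase x)).card = degIn G S x := by
        rw [← sum_comps_degIn S x, Finset.card_eq_sum_ones]
        exact Finset.sum_congr rfl fun C hC =>
          (hS.comps_offMajor hB hμ hext hx hC).1.symm
      rw [Finset.sum_add_distrib, Finset.sum_sub_distrib, ← Finset.mul_sum, ← Nat.cast_sum,
        ← Nat.cast_sum, e2, Finset.sum_const, e4, e1, nsmul_eq_mul]
      push_cast
      rw [← e3]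
      push_cast
      ring

end Structure

/-! ### From subtypes, submatrices and induced subgraphs to vertex sets -/

section Transport

open scoped ComplexOrder

variable {V : Type*} [Fintype V] {G : SimpleGraph V} {B : Matrix V V ℂ} {μ : ℂ}

theorem op_apply {W : Type*} [Fintype W] (A : Matrix W W ℂ) (z : W → ℂ) (a : W) :
    op A z a = ∑ b, A a b * z b := by
  change @Finset.sum _ _ _ (@Finset.univ W (Fintype.ofFinite W)) (fun b => A a b * z b) = _
  congr!

theorem isEig_iff {W : Type*} [Finite W] (A : Matrix W W ℂ) (μ : ℂ) :
    IsEig A μ ↔ 1 ≤ mult A μ := by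
  rw [IsEig, mult, Module.End.hasEigenvalue_iff, Nat.one_le_iff_ne_zero, Ne, Ne,
    Submodule.finrank_eq_zero]

theorem IsEig.star_eq {W : Type*} [Finite W] {A : Matrix W W ℂ} (hA : A.IsHermitian) {μ : ℂ}
    (h : IsEig A μ) : star μ = μ := by
  have := Fintype.ofFinite W
  obtain ⟨x, hx⟩ := Module.End.HasEigenvalue.exists_hasEigenvector h
  have h1 : ∀ a, ∑ b, A a b * x b = μ * x a := fun a => by
    rw [← op_apply, hx.apply_eq_smul]; rfl
  have e1 : ∑ a, star (x a) * ∑ b, A a b * x b = μ * ∑ a, star (x a) * x a := by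
    rw [Finset.mul_sum]
    exact Finset.sum_congr rfl fun a _ => by rw [h1]; ring
  have e2 : ∑ a, star (x a) * ∑ b, A a b * x b = star μ * ∑ a, star (x a) * x a := by
    simp_rw [Finset.mul_sum]
    rw [Finset.sum_comm]
    refine Finset.sum_congr rfl fun b _ => ?_
    have : star (∑ a, A b a * x a) = ∑ a, star (x a) * A a b := by
      rw [star_sum]
      refine Finset.sum_congr rfl fun a _ => ?_
      rw [star_mul', mul_comm, hA.apply]
    rw [h1, star_mul'] at this
    rw [← mul_assoc, this, Finset.sum_mul]
    exact Finset.sum_congr rfl fun a _ => by ring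
  have e3 : ∑ a, star (x a) * x a ≠ 0 := by
    intro h0
    apply hx.2
    exact dotProduct_star_self_eq_zero.1 h0
  exact mul_right_cancel₀ e3 (e2.symm.trans e1)

/-- Extension by zero along `f` identifies the eigenspace of the submatrix with a solution space on
V. It covers the whole matrix, single deletions and components of induced subgraphs at once. -/
theorem mult_submatrix {W : Type*} [Finite W] {f : W → V} (hf : Function.Injective f)
    {C : Finset V} (hC : ∀ v, v ∈ C ↔ ∃ a, f a = v) :
    mult (B.submatrix f f) μ = solDim B μ C ∅ := by
  have := Fintype.ofFinite W
  have hsum : ∀ (z : V → ℂ), (∀ v ∉ C, z v = 0) → ∀ v, ∑ u, B v u * z u = ∑ a, B v (f a) * z (f a) := by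
    intro z hz v
    have : ∑ a, B v (f a) * z (f a) = ∑ u ∈ Finset.univ.image f, B v u * z u :=
      (Finset.sum_image (f := fun u => B v u * z u) fun a _ b _ h => hf h).symm
    rw [this]
    symm
    refine Finset.sum_subset (Finset.subset_univ _) fun u _ hu => ?_
    rw [hz u, mul_zero]
    rw [hC]
    simpa using hu
  set E := Function.ExtendByZero.linearMap ℂ f with hE
  have hEa : ∀ z a, E z (f a) = z a := fun z a => by
    exact hf.extend_apply z 0 a
  have hE0 : ∀ z, ∀ v ∉ C, E z v = 0 := fun z v hv => by
    have : ¬ ∃ a, f a = v := by rwa [← hC]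
    exact Function.extend_apply' z (0 : V → ℂ) v this
  have hEinj : Function.Injective E := fun z z' h => by
    funext a
    rw [← hEa z, ← hEa z', h]
  have hmap : (Module.End.eigenspace (op (B.submatrix f f)) μ).map E = solSpace B μ C ∅ := by
    ext y
    rw [Submodule.mem_map]
    constructor
    · rintro ⟨z, hz, rfl⟩
      rw [Module.End.mem_eigenspace_iff] at hz
      refine ⟨hE0 z, by simp, fun v hv => ?_⟩
      obtain ⟨a, rfl⟩ := (hC v).1 hv
      rw [hsum _ (hE0 z), hEa]
      have := congrFun hz a
      rw [op_apply] at this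
      simpa [hEa] using this
    · intro hy
      refine ⟨fun a => y (f a), ?_, ?_⟩
      · rw [Module.End.mem_eigenspace_iff]
        funext a
        rw [op_apply]
        have := hy.2.2 (f a) ((hC _).2 ⟨a, rfl⟩)
        rw [hsum y hy.1] at this
        simpa using this
      · funext v
        by_cases hv : v ∈ C
        · obtain ⟨a, rfl⟩ := (hC v).1 hv
          rw [hEa]
        · rw [hE0 _ v hv, hy.1 v hv]
  rw [mult, solDim, ← hmap]
  exact (Submodule.equivMapOfInjective E hEinj _).finrank_eq

theorem mult_eq_solDim_univ : mult B μ = solDim B μ Finset.univ ∅ :=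
  mult_submatrix (f := id) Function.injective_id (by simp)

theorem mult_restrict_compl_singleton (y : V) :
    mult (restrict B {y}ᶜ) μ = solDim B μ (Finset.univ.erase y) ∅ :=
  mult_submatrix Subtype.val_injective (by simp)

variable {W : Type*} [Finite W] {H : SimpleGraph W}

theorem deg_eq_degIn (φ : H ↪g G) {C : Finset V} (hC : ∀ v, v ∈ C ↔ ∃ a, φ a = v) (a : W) :
    deg H a = degIn G C (φ a) := by
  rw [deg, degIn, ← Set.ncard_coe_finset, ← Set.ncard_image_of_injective _ φ.injective]
  congr 1
  ext v
  simp only [Set.mem_image, SimpleGraph.mem_neighborSet, Finset.coe_filter, Set.mem_ofPred_eq, hC]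
  constructor
  · rintro ⟨b, hb, rfl⟩
    exact ⟨⟨b, rfl⟩, φ.map_adj_iff.2 hb⟩
  · rintro ⟨⟨b, rfl⟩, hb⟩
    exact ⟨b, φ.map_adj_iff.1 hb, rfl⟩

theorem pendantCount_eq (φ : H ↪g G) {C : Finset V} (hC : ∀ v, v ∈ C ↔ ∃ a, φ a = v) :
    pendantCount H = (C.filter fun v => degIn G C v = 1).card := by
  rw [pendantCount, ← Set.ncard_coe_finset, ← Set.ncard_image_of_injective _ φ.injective]
  congr 1
  ext v
  simp only [Set.mem_image, Set.mem_ofPred_eq, Finset.coe_filter, hC, deg_eq_degIn φ hC]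
  constructor
  · rintro ⟨b, hb, rfl⟩
    exact ⟨⟨b, rfl⟩, hb⟩
  · rintro ⟨⟨b, rfl⟩, hb⟩
    exact ⟨b, hb, rfl⟩

theorem natCard_eq (φ : H ↪g G) {C : Finset V} (hC : ∀ v, v ∈ C ↔ ∃ a, φ a = v) :
    Nat.card W = C.card := by
  rw [← Set.ncard_univ, ← Set.ncard_image_of_injective _ φ.injective, ← Set.ncard_coe_finset]
  congr 1
  ext v
  simp [hC]

theorem two_mul_ncard_edgeSet (H : SimpleGraph W) [Fintype W] :
    2 * H.edgeSet.ncard = ∑ a, deg H a := by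
  have h1 := H.sum_degrees_eq_twice_card_edges
  have h2 : H.edgeSet.ncard = H.edgeFinset.card := by
    rw [← SimpleGraph.coe_edgeFinset, Set.ncard_coe_finset]
  rw [h2, ← h1]
  refine Finset.sum_congr rfl fun a _ => ?_
  rw [deg, ← SimpleGraph.card_neighborFinset_eq_degree, ← Set.ncard_coe_finset,
    SimpleGraph.coe_neighborFinset]

theorem sum_degIn_eq_edges (φ : H ↪g G) {C : Finset V} (hC : ∀ v, v ∈ C ↔ ∃ a, φ a = v) :
    ∑ v ∈ C, degIn G C v = 2 * H.edgeSet.ncard := by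
  have := Fintype.ofFinite W
  rw [two_mul_ncard_edgeSet]
  have : C = Finset.univ.image φ := by ext v; simp [hC]
  conv_lhs => rw [this, Finset.sum_image fun a _ b _ h => φ.injective h]
  rw [← this]
  exact Finset.sum_congr rfl fun a _ => (deg_eq_degIn φ hC a).symm

theorem cyclomatic_of_connected (hH : H.Connected) :
    cyclomatic H = (H.edgeSet.ncard : ℤ) - Nat.card W + 1 := by
  have := hH.preconnected.subsingleton_connectedComponent
  have := hH.nonempty
  have : Nat.card H.ConnectedComponent = 1 := Nat.card_eq_one_iff_unique.2
    ⟨inferInstance, ⟨H.connectedComponentMk (Classical.arbitrary W)⟩⟩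
  rw [cyclomatic, this]
  rfl

theorem two_mul_cyclomatic (hH : H.Connected) (φ : H ↪g G) {C : Finset V}
    (hC : ∀ v, v ∈ C ↔ ∃ a, φ a = v) :
    2 * cyclomatic H = ((∑ v ∈ C, degIn G C v : ℕ) : ℤ) - 2 * C.card + 2 := by
  rw [cyclomatic_of_connected hH, natCard_eq φ hC, sum_degIn_eq_edges φ hC]
  push_cast
  ring

theorem connSet_of_connected (hH : H.Connected) (φ : H ↪g G) {C : Finset V}
    (hC : ∀ v, v ∈ C ↔ ∃ a, φ a = v) : ConnSet G C := by
  have := hH.nonempty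
  refine ⟨⟨φ (Classical.arbitrary W), (hC _).2 ⟨_, rfl⟩⟩, fun D hD hDne hcl => ?_⟩
  refine Finset.Subset.antisymm hD fun v hv => ?_
  obtain ⟨b, rfl⟩ := (hC v).1 hv
  obtain ⟨u, hu⟩ := hDne
  obtain ⟨a, rfl⟩ := (hC u).1 (hD hu)
  obtain ⟨w⟩ := hH.preconnected a b
  clear hv
  induction w with
  | nil => exact hu
  | cons h p ih => exact ih (hcl _ hu _ ((hC _).2 ⟨_, rfl⟩) (φ.map_adj_iff.2 h))

theorem ConnSet.univ_of_connected (hG : G.Connected) : ConnSet G Finset.univ :=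
  connSet_of_connected hG SimpleGraph.Embedding.refl (by simp)

theorem deg_eq_degIn_univ (v : V) : deg G v = degIn G Finset.univ v :=
  deg_eq_degIn SimpleGraph.Embedding.refl (by simp) v

/-- The vertex set in `V` of a component of an induced subgraph. -/
noncomputable def compFin {s : Set V} (K : (G.induce s).ConnectedComponent) : Finset V :=
  Finset.univ.filter fun v => ∃ a : K.supp, a.1.1 = v

/-- A component of an induced subgraph, as an embedded subgraph. -/
def compEmbedding {s : Set V} (K : (G.induce s).ConnectedComponent) : K.toSimpleGraph ↪g G where
  toFun a := a.1.1
  inj' _ _ h := Subtype.ext (Subtype.ext h)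
  map_rel_iff' := Iff.rfl

theorem mem_compFin {s : Set V} (K : (G.induce s).ConnectedComponent) (v : V) :
    v ∈ compFin K ↔ ∃ a, compEmbedding K a = v := by
  rw [compFin, Finset.mem_filter, and_iff_right (Finset.mem_univ _)]
  rfl

theorem compFin_mem_comps {s : Set V} (K : (G.induce s).ConnectedComponent) :
    compFin K ∈ comps G s.toFinset := by
  refine mem_comps.2 ⟨fun v hv => ?_,
    connSet_of_connected K.connected_toSimpleGraph (compEmbedding K) (mem_compFin K), ?_⟩
  · obtain ⟨a, rfl⟩ := (mem_compFin K v).1 hv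
    exact Set.mem_toFinset.2 a.1.2
  · intro a ha b hb hab
    obtain ⟨a, rfl⟩ := (mem_compFin K a).1 ha
    rw [Set.mem_toFinset] at hb
    refine (mem_compFin K b).2 ⟨⟨⟨b, hb⟩, ?_⟩, rfl⟩
    exact SimpleGraph.ConnectedComponent.mem_supp_of_adj_mem_supp K a.2 (by exact hab)

theorem compFin_injective {s : Set V} :
    Function.Injective (compFin : (G.induce s).ConnectedComponent → Finset V) := by
  intro K L h
  obtain ⟨a, ha⟩ := K.nonempty_supp
  have : a.1 ∈ compFin L := h ▸ (mem_compFin K _).2 ⟨⟨a, ha⟩, rfl⟩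
  obtain ⟨⟨b, hb⟩, hba⟩ := (mem_compFin L _).1 this
  have : b = a := Subtype.ext hba
  subst this
  exact ha.symm.trans hb

theorem exists_compFin_eq {s : Set V} {C : Finset V} (hC : C ∈ comps G s.toFinset) :
    ∃ K : (G.induce s).ConnectedComponent, compFin K = C := by
  obtain ⟨v, hv⟩ := (mem_comps.1 hC).2.1.1
  have hvs := Set.mem_toFinset.1 ((mem_comps.1 hC).1 hv)
  refine ⟨(G.induce s).connectedComponentMk ⟨v, hvs⟩, comps_eq_of_inter (compFin_mem_comps _) hC
    ⟨v, Finset.mem_inter.2 ⟨?_, hv⟩⟩⟩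
  exact (mem_compFin _ v).2 ⟨⟨⟨v, hvs⟩, rfl⟩, rfl⟩

theorem sum_compFin {M : Type*} [AddCommMonoid M] {s : Set V} (F : Finset V → M) :
    ∑ K : (G.induce s).ConnectedComponent, F (compFin K) = ∑ C ∈ comps G s.toFinset, F C := by
  rw [← Finset.sum_image (s := Finset.univ) (f := F) fun _ _ _ _ h => compFin_injective h]
  congr 1
  ext C
  simp only [Finset.mem_image, Finset.mem_univ, true_and]
  exact ⟨fun ⟨K, hK⟩ => hK ▸ compFin_mem_comps K, exists_compFin_eq⟩

theorem mult_restrict_restrict {s : Set V} (K : (G.induce s).ConnectedComponent) :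
    mult (restrict (restrict B s) K.supp) μ = solDim B μ (compFin K) ∅ :=
  mult_submatrix (compEmbedding K).injective (mem_compFin K)

end Transport

/-! ### Paths and cycles versus connected sets -/

section Walks

variable {V : Type*} [Fintype V] {G : SimpleGraph V}

theorem ConnSet.exists_path {A : Finset V} (hA : ConnSet G A) {a b : V} (ha : a ∈ A) (hb : b ∈ A) :
    ∃ p : G.Walk a b, p.IsPath ∧ ∀ v ∈ p.support, v ∈ A := by
  have h1 := hA.2 (A.filter fun u => ∃ p : G.Walk a u, ∀ v ∈ p.support, v ∈ A)
    (Finset.filter_subset _ _)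
    ⟨a, Finset.mem_filter.2 ⟨ha, SimpleGraph.Walk.nil, by simpa using ha⟩⟩ (by
      intro u hu v hv huv
      obtain ⟨-, p, hp⟩ := Finset.mem_filter.1 hu
      refine Finset.mem_filter.2 ⟨hv, p.concat huv, fun x hx => ?_⟩
      rw [SimpleGraph.Walk.support_concat, List.mem_append] at hx
      rcases hx with hx | hx
      · exact hp x hx
      · rw [List.mem_singleton] at hx
        exact hx ▸ hv)
  rw [← h1] at hb
  obtain ⟨-, p, hp⟩ := Finset.mem_filter.1 hb
  exact ⟨p.bypass, p.bypass_isPath, fun v hv => hp v (p.support_bypass_subset_support hv)⟩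

theorem connSet_support {a b : V} (p : G.Walk a b) : ConnSet G p.support.toFinset := by
  refine ⟨⟨a, by simp⟩, fun C hC hCne hcl => ?_⟩
  have hfwd : ∀ {x y : V} (q : G.Walk x y), (∀ v ∈ q.support, v ∈ p.support) →
      ((x ∈ C ∨ y ∈ C) → ∀ v ∈ q.support, v ∈ C) := by
    intro x y q
    induction q with
    | nil =>
      intro _ h v hv
      rw [SimpleGraph.Walk.support_nil, List.mem_singleton] at hv
      subst hv
      exact h.elim id id
    | @cons x u y h q ih =>
      intro hsub hxy v hv
      have hsub' : ∀ v ∈ q.support, v ∈ p.support := fun v hv =>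
        hsub v (by simp [hv])
      have hu : u ∈ p.support.toFinset := List.mem_toFinset.2 (hsub' u (by simp))
      have hx : x ∈ p.support.toFinset := List.mem_toFinset.2 (hsub x (by simp))
      have hall : ∀ v ∈ q.support, v ∈ C := by
        rcases hxy with hxC | hyC
        · exact ih hsub' (Or.inl (hcl x hxC u hu h))
        · exact ih hsub' (Or.inr hyC)
      rw [SimpleGraph.Walk.support_cons, List.mem_cons] at hv
      rcases hv with rfl | hv
      · exact hcl u (hall u (by simp)) v hx h.symm
      · exact hall v hv
  obtain ⟨c, hc⟩ := hCne
  have hcp : c ∈ p.support := List.mem_toFinset.1 (hC hc)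
  refine Finset.Subset.antisymm hC fun v hv => ?_
  have hv' := List.mem_toFinset.1 hv
  rw [← p.take_spec hcp, SimpleGraph.Walk.mem_support_append_iff] at hv'
  rcases hv' with h | h
  · exact hfwd (p.takeUntil c hcp) (fun v hv => p.support_takeUntil_subset_support hcp hv) (Or.inr hc) v h
  · exact hfwd (p.dropUntil c hcp) (fun v hv => p.support_dropUntil_subset_support hcp hv) (Or.inl hc) v h

/-- Closing a path through a further vertex gives a cycle. -/
theorem exists_isCycle_of_path {x a b : V} (hab : a ≠ b) (hxa : G.Adj x a) (hxb : G.Adj x b)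
    {p : G.Walk a b} (hp : p.IsPath) (hx : x ∉ p.support) :
    (SimpleGraph.Walk.cons hxa (p.concat hxb.symm)).IsCycle := by
  rw [SimpleGraph.Walk.cons_isCycle_iff, SimpleGraph.Walk.concat_isPath_iff]
  refine ⟨⟨hp, hx⟩, fun h => ?_⟩
  rw [SimpleGraph.Walk.edges_concat, List.concat_eq_append, List.mem_append,
    List.mem_singleton] at h
  rcases h with h | h
  · exact hx (p.fst_mem_support_of_mem_edges h)
  · rw [Sym2.eq_iff] at h
    rcases h with h | h
    · exact hxb.ne h.1
    · exact hab h.2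

/-- Splitting off the first and last edge leaves a path avoiding v whose ends are neighbours of v.
They are distinct because a cycle does not repeat an edge. -/
theorem isCycle_support_erase {v : V} {c : G.Walk v v} (hc : c.IsCycle) :
    ConnSet G (c.support.toFinset.erase v) ∧ 2 ≤ degIn G (c.support.toFinset.erase v) v := by
  cases c with
  | nil => exact absurd hc SimpleGraph.Walk.not_isCycle_nil
  | @cons _ u _ h p =>
    rw [SimpleGraph.Walk.cons_isCycle_iff] at hc
    cases p using SimpleGraph.Walk.concatRec with
    | Hnil => exact absurd h (G.loopless.irrefl _)
    | @Hconcat u w v q h' =>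
      rw [SimpleGraph.Walk.concat_isPath_iff] at hc
      have hs : (SimpleGraph.Walk.cons h (q.concat h')).support.toFinset.erase v =
          q.support.toFinset := by
        ext z
        simp only [SimpleGraph.Walk.support_cons, SimpleGraph.Walk.support_concat,
          Finset.mem_erase, List.mem_toFinset, List.mem_cons,
          List.mem_append, List.not_mem_nil, or_false]
        constructor
        · rintro ⟨h1, h2 | h2 | h2⟩
          · exact absurd h2 h1
          · exact h2
          · exact absurd h2 h1
        · intro hz
          exact ⟨fun h => hc.1.2 (h ▸ hz), Or.inr (Or.inl hz)⟩
      rw [hs]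
      refine ⟨connSet_support q, Finset.one_lt_card.2 ⟨u, ?_, w, ?_, ?_⟩⟩
      · simp [h]
      · simp [h'.symm]
      · rintro rfl
        exact hc.2 (by simp [SimpleGraph.Walk.edges_concat, Sym2.eq_swap])

theorem cycAt_univ_iff {v : V} : CycAt G Finset.univ v ↔ IsCycleVertex G v := by
  constructor
  · rintro ⟨A, hA, hconn, hd⟩
    obtain ⟨a, ha, b, hb, hab⟩ := Finset.one_lt_card.1 hd
    rw [Finset.mem_filter] at ha hb
    obtain ⟨p, hp, hpA⟩ := hconn.exists_path ha.1 hb.1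
    exact ⟨_, exists_isCycle_of_path hab ha.2 hb.2 hp fun h =>
      Finset.notMem_erase v _ (hA (hpA v h))⟩
  · rintro ⟨c, hc⟩
    obtain ⟨h1, h2⟩ := isCycle_support_erase hc
    exact ⟨_, Finset.erase_subset_erase _ (Finset.subset_univ _), h1, h2⟩

end Walks

/-! ### Degrees along paths and cycles -/

section WalkDegrees

variable {V : Type*} [Fintype V] {G : SimpleGraph V}

theorem mem_of_card_degIn_le {x y : V} (F : Finset V) (hF : ∀ c ∈ F, G.Adj x c)
    (hd : degIn G Finset.univ x ≤ F.card) (hxy : G.Adj x y) : y ∈ F := by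
  have : F = Finset.univ.filter (G.Adj x) :=
    Finset.eq_of_subset_of_card_le (fun c hc => by simpa using hF c hc) hd
  rw [this]
  simpa using hxy

theorem eq_or_eq_of_degIn_le_two {x y c d : V} (hd : degIn G Finset.univ x ≤ 2) (hcd : c ≠ d)
    (hc : G.Adj x c) (hd' : G.Adj x d) (hxy : G.Adj x y) : y = c ∨ y = d := by
  have := mem_of_card_degIn_le {c, d} (by simp [hc, hd']) (by rwa [Finset.card_pair hcd]) hxy
  simpa using this

theorem two_le_degIn {x c d : V} (hcd : c ≠ d) (hc : G.Adj x c) (hd : G.Adj x d) :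
    2 ≤ degIn G Finset.univ x :=
  Finset.one_lt_card.2 ⟨c, by simpa using hc, d, by simpa using hd, hcd⟩

theorem exists_edge_start {a b : V} (p : G.Walk a b) (hab : a ≠ b) :
    ∃ c, s(a, c) ∈ p.edges := by
  cases p with
  | nil => exact absurd rfl hab
  | @cons _ u _ h p => exact ⟨u, by simp⟩

theorem exists_edge_end {a b : V} (p : G.Walk a b) (hab : a ≠ b) :
    ∃ c, s(b, c) ∈ p.edges := by
  obtain ⟨c, hc⟩ := exists_edge_start p.reverse hab.symm
  exact ⟨c, by simpa using hc⟩

theorem exists_two_edges_of_isPath {a b : V} {p : G.Walk a b} (hp : p.IsPath) {v : V}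
    (hv : v ∈ p.support) (ha : v ≠ a) (hb : v ≠ b) :
    ∃ c d, c ≠ d ∧ s(v, c) ∈ p.edges ∧ s(v, d) ∈ p.edges := by
  induction p with
  | nil => exact absurd (by simpa using hv) ha
  | @cons x u y h q ih =>
    rw [SimpleGraph.Walk.cons_isPath_iff] at hp
    have hvq : v ∈ q.support := by
      rw [SimpleGraph.Walk.support_cons, List.mem_cons] at hv
      exact hv.resolve_left ha
    by_cases hvu : v = u
    · subst hvu
      obtain ⟨d, hd⟩ := exists_edge_start q hb
      refine ⟨x, d, ?_, by simp [Sym2.eq_swap], by simp [hd]⟩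
      rintro rfl
      exact hp.2 (q.snd_mem_support_of_mem_edges hd)
    · obtain ⟨c, d, hcd, hc, hd⟩ := ih hp.1 hvq hvu hb
      exact ⟨c, d, hcd, by simp [hc], by simp [hd]⟩

theorem exists_two_edges_of_isCycle {a : V} {p : G.Walk a a} (hp : p.IsCycle) {v : V}
    (hv : v ∈ p.support) : ∃ c d, c ≠ d ∧ s(v, c) ∈ p.edges ∧ s(v, d) ∈ p.edges := by
  obtain ⟨c, d, hcd, h⟩ := Set.ncard_eq_two.1 (hp.ncard_neighborSet_toSubgraph_eq_two hv)
  refine ⟨c, d, hcd, ?_, ?_⟩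
  · have : c ∈ p.toSubgraph.neighborSet v := by rw [h]; simp
    rwa [SimpleGraph.Subgraph.mem_neighborSet, SimpleGraph.Walk.adj_toSubgraph_iff_mem_edges] at this
  · have : d ∈ p.toSubgraph.neighborSet v := by rw [h]; simp
    rwa [SimpleGraph.Subgraph.mem_neighborSet, SimpleGraph.Walk.adj_toSubgraph_iff_mem_edges] at this

/-- A vertex set closed under adjacency is everything. -/
theorem mem_of_adj_closed (hG : G.Connected) {U : Set V} (hne : U.Nonempty)
    (h : ∀ x ∈ U, ∀ y, G.Adj x y → y ∈ U) (v : V) : v ∈ U := by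
  obtain ⟨u, hu⟩ := hne
  obtain ⟨w⟩ := hG.preconnected u v
  induction w with
  | nil => exact hu
  | cons hadj p ih => exact ih (h _ hu _ hadj)

end WalkDegrees

/-! ### Recognising paths and cycles from degrees -/

section PathsAndCycles

variable {V : Type*} [Fintype V] {G : SimpleGraph V}

/-- With at least two vertices, the degree sum forces exactly two pendant vertices. A path joining
them already uses all edges at its vertices, so by connectivity it covers V, and counting edges
shows that it is all of G. -/
theorem isPathGraph_of_degIn (hG : G.Connected)
    (hsum : ∑ v, degIn G Finset.univ v + 2 = 2 * Fintype.card V)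
    (hle : ∀ v, degIn G Finset.univ v ≤ 2) : IsPathGraph G := by
  have hS := ConnSet.univ_of_connected hG
  have hedge := sum_degIn_eq_edges (G := G) (SimpleGraph.Embedding.refl (G := G))
    (C := Finset.univ) (by simp)
  obtain ⟨u, v, p, hp, hcl⟩ : ∃ (u v : V) (p : G.Walk u v), p.IsPath ∧
      ∀ x ∈ p.support, ∀ y, G.Adj x y → y ∈ p.support := by
    rcases Nat.lt_or_ge (Fintype.card V) 2 with hc | hc
    · have := hG.nonempty
      have hsub : Subsingleton V := Fintype.card_le_one_iff_subsingleton.1 (by omega)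
      refine ⟨Classical.arbitrary V, _, SimpleGraph.Walk.nil, by simp, fun x _ y hxy => ?_⟩
      exact absurd (Subsingleton.elim x y) hxy.ne
    have hp := sum_degIn_add_pendant hS (by simpa using hc)
    have hq : majorExcess G Finset.univ = 0 := Finset.sum_eq_zero fun v _ => by
      have := hle v; omega
    rw [Finset.card_univ] at hp
    obtain ⟨u, v, huv, hpend⟩ := Finset.card_eq_two.1
      (show (Finset.univ.filter fun v => degIn G Finset.univ v = 1).card = 2 by omega)
    have hmem : ∀ x ∈ ({u, v} : Finset V), degIn G Finset.univ x = 1 := fun x hx => by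
      rw [← hpend] at hx
      exact (Finset.mem_filter.1 hx).2
    have hu := hmem u (by simp)
    have hv := hmem v (by simp)
    obtain ⟨p, hp, -⟩ := hS.exists_path (Finset.mem_univ u) (Finset.mem_univ v)
    refine ⟨u, v, p, hp, fun x hx y hxy => ?_⟩
    have hend : ∀ z c, degIn G Finset.univ z = 1 → s(z, c) ∈ p.edges → G.Adj z y →
        y ∈ p.support := fun z c hz hc hzy => by
      have := mem_of_card_degIn_le (G := G) {c} (by simpa using p.adj_of_mem_edges hc)
        (by simp [hz]) hzy
      rw [Finset.mem_singleton] at this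
      subst this
      exact p.snd_mem_support_of_mem_edges hc
    by_cases hxu : x = u
    · subst hxu
      obtain ⟨c, hc⟩ := exists_edge_start p huv
      exact hend x c hu hc hxy
    by_cases hxv : x = v
    · subst hxv
      obtain ⟨c, hc⟩ := exists_edge_end p huv
      exact hend x c hv hc hxy
    obtain ⟨c, d, hcd, hc, hd⟩ := exists_two_edges_of_isPath hp hx hxu hxv
    rcases eq_or_eq_of_degIn_le_two (hle x) hcd (p.adj_of_mem_edges hc) (p.adj_of_mem_edges hd)
      hxy with rfl | rfl
    · exact p.snd_mem_support_of_mem_edges hc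
    · exact p.snd_mem_support_of_mem_edges hd
  have hall : ∀ x, x ∈ p.support := mem_of_adj_closed (U := {x | x ∈ p.support}) hG
    ⟨u, p.start_mem_support⟩ hcl
  have hlen : Fintype.card V = p.length + 1 := by
    rw [← p.length_support, ← List.toFinset_card_of_nodup hp.support_nodup, ← Finset.card_univ]
    congr 1
    ext x
    simp [hall x]
  have hedges : ∀ e ∈ G.edgeSet, e ∈ p.edges := by
    have h1 : (p.edges.toFinset : Set (Sym2 V)) ⊆ G.edgeSet := fun e he =>
      p.edges_subset_edgeSet (by simpa using he)
    have h2 := Set.eq_of_subset_of_ncard_le h1 (by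
      rw [Set.ncard_coe_finset, List.toFinset_card_of_nodup hp.isTrail.edges_nodup,
        SimpleGraph.Walk.length_edges]
      omega)
    intro e he
    rw [← h2] at he
    simpa using he
  have htop : p.toSubgraph = ⊤ := by
    ext x y
    · simp [hall x]
    · rw [SimpleGraph.Walk.adj_toSubgraph_iff_mem_edges, SimpleGraph.Subgraph.top_adj]
      exact ⟨fun h => p.adj_of_mem_edges h, fun h => hedges _ h⟩
  have h1 : Nonempty (SimpleGraph.pathGraph (p.length + 1) ≃g p.toSubgraph.coe) :=
    ⟨hp.pathGraphIsoToSubgraph⟩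
  rw [htop] at h1
  obtain ⟨e⟩ := h1
  exact ⟨p.length + 1, by omega, ⟨(e.trans SimpleGraph.Subgraph.topIso).symm⟩⟩

/-- G has too many edges to be acyclic, so it contains a copy of some cycle. Each vertex of the copy
has both its neighbours in it, so the copy is closed under adjacency and equals G. -/
theorem isCycleGraph_of_degIn (hG : G.Connected) (hreg : ∀ v, degIn G Finset.univ v = 2) :
    IsCycleGraph G := by
  have hedge := sum_degIn_eq_edges (G := G) (SimpleGraph.Embedding.refl (G := G))
    (C := Finset.univ) (by simp)
  rw [Finset.sum_congr rfl fun v _ => hreg v, Finset.sum_const, smul_eq_mul] at hedge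
  have hnot : ¬ G.IsAcyclic := fun h => by
    have h1 := (SimpleGraph.isTree_iff_connected_and_card.1 ⟨hG, h⟩).2
    rw [Nat.card_coe_set_eq, Nat.card_eq_fintype_card] at h1
    rw [Finset.card_univ] at hedge
    omega
  rw [SimpleGraph.isAcyclic_iff_free_cycleGraph] at hnot
  push Not at hnot
  obtain ⟨n, hn, hfree⟩ := hnot
  obtain ⟨f⟩ := hfree
  obtain ⟨k, rfl⟩ : ∃ k, n = k + 3 := ⟨n - 3, by omega⟩
  have hinj : Function.Injective (fun i => f i) := f.injective
  have hnb : ∀ i y, G.Adj (f i) y → ∃ j, (SimpleGraph.cycleGraph (k + 3)).Adj i j ∧ f j = y := by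
    intro i y hy
    have := mem_of_card_degIn_le (G := G)
      (((SimpleGraph.cycleGraph (k + 3)).neighborFinset i).image f) (by
        intro c hc
        obtain ⟨j, hj, rfl⟩ := Finset.mem_image.1 hc
        exact f.toHom.map_adj (by simpa using hj)) (by
        rw [hreg, Finset.card_image_of_injective _ hinj,
          SimpleGraph.card_neighborFinset_eq_degree, SimpleGraph.cycleGraph_degree_three_le]) hy
    obtain ⟨j, hj, h⟩ := Finset.mem_image.1 this
    exact ⟨j, by simpa using hj, h⟩
  have hsurj : Function.Surjective f := fun v =>
    mem_of_adj_closed (U := Set.range f) hG ⟨f 0, 0, rfl⟩ (by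
      rintro _ ⟨i, rfl⟩ y hy
      obtain ⟨j, -, h⟩ := hnb i y hy
      exact ⟨j, h⟩) v
  refine ⟨k + 3, hn, ⟨SimpleGraph.Iso.symm ⟨Equiv.ofBijective f ⟨hinj, hsurj⟩, ?_⟩⟩⟩
  intro i j
  refine ⟨fun h => ?_, fun h => f.toHom.map_adj h⟩
  obtain ⟨j', h1, h2⟩ := hnb i _ h
  rwa [hinj h2] at h1

theorem IsCycleGraph.degIn_eq (h : IsCycleGraph G) (v : V) : degIn G Finset.univ v = 2 := by
  obtain ⟨n, hn, ⟨e⟩⟩ := h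
  obtain ⟨k, rfl⟩ : ∃ k, n = k + 3 := ⟨n - 3, by omega⟩
  rw [← SimpleGraph.cycleGraph_degree_three_le (v := e v), e.degree_eq v,
    ← SimpleGraph.card_neighborFinset_eq_degree, degIn]
  congr 1
  ext u
  simp

theorem IsPathGraph.degIn_le [Nontrivial V] (h : IsPathGraph G) :
    (∀ v, degIn G Finset.univ v ≤ 2) ∧ ∃ v, degIn G Finset.univ v ≤ 1 := by
  obtain ⟨n, hn, ⟨e⟩⟩ := h
  have key : ∀ v (A : Finset (Fin n)), (∀ j, (SimpleGraph.pathGraph n).Adj (e v) j → j ∈ A) →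
      degIn G Finset.univ v ≤ A.card := by
    intro v A hA
    rw [degIn, ← Finset.card_image_of_injective _ e.injective]
    refine Finset.card_le_card fun j hj => ?_
    obtain ⟨u, hu, rfl⟩ := Finset.mem_image.1 hj
    exact hA _ (e.map_adj_iff.2 (Finset.mem_filter.1 hu).2)
  constructor
  · intro v
    have hsub : (Finset.univ.filter fun j => (SimpleGraph.pathGraph n).Adj (e v) j).card ≤ 2 := by
      rw [← Finset.card_image_of_injective _ Fin.val_injective]
      refine (Finset.card_le_card (t := {(e v).val + 1, (e v).val - 1}) fun i hi => ?_).trans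
        Finset.card_le_two
      obtain ⟨j, hj, rfl⟩ := Finset.mem_image.1 hi
      have := SimpleGraph.pathGraph_adj.1 (Finset.mem_filter.1 hj).2
      simp only [Finset.mem_insert, Finset.mem_singleton]
      omega
    exact (key v _ fun j hj => by simpa using hj).trans hsub
  · refine ⟨e.symm ⟨0, hn⟩, ?_⟩
    have hsub : (Finset.univ.filter fun j =>
        (SimpleGraph.pathGraph n).Adj (e (e.symm ⟨0, hn⟩)) j).card ≤ 1 := by
      rw [← Finset.card_image_of_injective _ Fin.val_injective, ← Finset.card_singleton 1]
      refine Finset.card_le_card fun i hi => ?_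
      obtain ⟨j, hj, rfl⟩ := Finset.mem_image.1 hi
      have := SimpleGraph.pathGraph_adj.1 (Finset.mem_filter.1 hj).2
      rw [e.apply_symm_apply] at this
      dsimp only at this
      simp only [Finset.mem_singleton]
      omega
    exact (key _ _ fun j hj => by simpa using hj).trans hsub

end PathsAndCycles

/-! ### Bicyclic graphs without pendant vertices are ∞-graphs or θ-graphs -/

section BicyclicForward

variable {V : Type*} [Fintype V] {G : SimpleGraph V}

theorem edge_mem_of_degIn_le_two {x c d y : V} {L : List (Sym2 V)}
    (hL : ∀ e ∈ L, e ∈ G.edgeSet) (hx : degIn G Finset.univ x ≤ 2) (hcd : c ≠ d)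
    (hc : s(x, c) ∈ L) (hd : s(x, d) ∈ L) (hxy : G.Adj x y) : s(x, y) ∈ L := by
  rcases eq_or_eq_of_degIn_le_two hx hcd (hL _ hc) (hL _ hd) hxy with rfl | rfl
  · exact hc
  · exact hd

theorem exists_isCycle_of_comp {a : V} {C : Finset V}
    (hC : C ∈ comps G (Finset.univ.erase a)) (h2 : 2 ≤ degIn G C a)
    (hdeg : ∀ v ∈ C, degIn G Finset.univ v ≤ 2) :
    ∃ c : G.Walk a a, c.IsCycle ∧ ∀ v, v ∈ c.support ↔ v = a ∨ v ∈ C := by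
  obtain ⟨g1, g2, g3⟩ := mem_comps.1 hC
  obtain ⟨u, hu, v, hv, huv⟩ := Finset.one_lt_card.1 h2
  rw [Finset.mem_filter] at hu hv
  obtain ⟨p, hp, hpC⟩ := g2.exists_path hu.1 hv.1
  have hcyc := exists_isCycle_of_path huv hu.2 hv.2 hp fun h =>
    Finset.notMem_erase a _ (g1 (hpC a h))
  set c := SimpleGraph.Walk.cons hu.2 (p.concat hv.2.symm) with hcdef
  have hsupp : ∀ x, x ∈ c.support ↔ x = a ∨ x ∈ p.support := by
    intro x
    simp only [hcdef, SimpleGraph.Walk.support_cons, SimpleGraph.Walk.support_concat,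
      List.mem_cons, List.mem_append, List.not_mem_nil, or_false]
    tauto
  have hcl : ClosedIn G p.support.toFinset C := by
    intro x hx y hy hxy
    rw [List.mem_toFinset] at hx ⊢
    have hxc : x ∈ c.support := (hsupp x).2 (Or.inr hx)
    obtain ⟨s, t, hst, hs, ht⟩ := exists_two_edges_of_isCycle hcyc hxc
    have := edge_mem_of_degIn_le_two (fun e he => c.edges_subset_edgeSet he) (hdeg x (hpC x hx))
      hst hs ht hxy
    refine ((hsupp y).1 (c.snd_mem_support_of_mem_edges this)).resolve_left ?_
    rintro rfl
    exact Finset.notMem_erase y _ (g1 hy)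
  have heq := g2.2 _ (fun x hx => hpC x (List.mem_toFinset.1 hx)) ⟨u, by simp⟩ hcl
  refine ⟨c, hcyc, fun x => ?_⟩
  rw [hsupp, ← heq, List.mem_toFinset]

/-- Without pendant vertices, the degree sum inside C is 2|C| plus the excess minus the number of
attaching edges. Connectivity and parity give the two claims. -/
theorem comp_attachment (hmin : ∀ v, 2 ≤ degIn G Finset.univ v) {a : V} {C : Finset V}
    (hC : C ∈ comps G (Finset.univ.erase a)) :
    degIn G C a ≤ ∑ v ∈ C, (degIn G Finset.univ v - 2) + 2 ∧
      Even (degIn G C a + ∑ v ∈ C, (degIn G Finset.univ v - 2)) := by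
  have h1 := sum_degIn_of_mem_comps_erase (Finset.mem_univ a) hC
  have h2 := (mem_comps.1 hC).2.1.two_mul_card_le
  obtain ⟨k, hk⟩ := even_sum_degIn (G := G) C
  have h3 : ∑ v ∈ C, degIn G Finset.univ v =
      ∑ v ∈ C, (degIn G Finset.univ v - 2) + 2 * C.card := by
    rw [mul_comm, ← smul_eq_mul, ← Finset.sum_const, ← Finset.sum_add_distrib]
    exact Finset.sum_congr rfl fun v _ => by have := hmin v; omega
  refine ⟨by omega, ?_⟩
  rw [Nat.even_iff]
  omega

/-- A path entering a set that can only be left through the end of the path starts in it. -/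
theorem start_mem_of_path_mem {u b : V} {p : G.Walk u b} (hp : p.IsPath) {F : Set V} (hb : b ∉ F)
    (hF : ∀ x ∈ F, ∀ y ∈ p.support, y ≠ b → G.Adj x y → y ∈ F) {x : V} (hx : x ∈ p.support)
    (hxF : x ∈ F) : u ∈ F := by
  induction p with
  | nil =>
    rw [SimpleGraph.Walk.support_nil, List.mem_singleton] at hx
    exact hx ▸ hxF
  | @cons u w b h q ih =>
    rw [SimpleGraph.Walk.support_cons, List.mem_cons] at hx
    rw [SimpleGraph.Walk.cons_isPath_iff] at hp
    rcases hx with rfl | hx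
    · exact hxF
    · have hw := ih hp.1 hb (fun x hx y hy => hF x hx y (by simp [hy])) hx
      refine hF w hw u (by simp) ?_ h.symm
      rintro rfl
      exact hp.2 q.end_mem_support

/-- Join the three neighbours of a to b by paths inside `T`. Interior vertices have degree two, so
two paths meeting before b would coincide back towards a. The start of one would then be interior to
the other, which would have to contain a. -/
theorem isThetaGraph_of_connSet (hG : G.Connected) {a b : V} (hab : a ≠ b)
    (ha : degIn G Finset.univ a = 3) (hb : degIn G Finset.univ b = 3)
    (hdeg : ∀ v, v ≠ a → v ≠ b → degIn G Finset.univ v ≤ 2) {T : Finset V} (hT : ConnSet G T)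
    (haT : a ∉ T) (hbT : b ∈ T) (h3 : degIn G T a = 3) : IsThetaGraph G := by
  obtain ⟨u, huinj, hu⟩ : ∃ u : Fin 3 → V, Function.Injective u ∧
      ∀ i, u i ∈ T ∧ G.Adj a (u i) :=
    ⟨fun i => ((Finset.equivFinOfCardEq h3).symm i).1, fun i j h =>
      (Finset.equivFinOfCardEq h3).symm.injective (Subtype.ext h), fun i =>
      Finset.mem_filter.1 ((Finset.equivFinOfCardEq h3).symm i).2⟩
  choose p hp hpT using fun i => hT.exists_path (hu i).1 hbT
  have hap : ∀ i, a ∉ (p i).support := fun i h => haT (hpT i a h)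
  set w : Fin 3 → G.Walk a b := fun i => SimpleGraph.Walk.cons (hu i).2 (p i) with hw
  have hwpath : ∀ i, (w i).IsPath := fun i =>
    SimpleGraph.Walk.cons_isPath_iff _ _ |>.2 ⟨hp i, hap i⟩
  have hsupp : ∀ i v, v ∈ (w i).support ↔ v = a ∨ v ∈ (p i).support := fun i v => by
    simp [hw]
  have hedges : ∀ i, ∀ e ∈ (w i).edges, e ∈ G.edgeSet := fun i e he =>
    (w i).edges_subset_edgeSet he
  have hcl : ∀ i, ∀ x ∈ (p i).support, x ≠ b → ∀ y, y ≠ a → G.Adj x y →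
      y ∈ (p i).support := by
    intro i x hx hxb y hya hxy
    have hxa : x ≠ a := fun h => hap i (h ▸ hx)
    obtain ⟨c, d, hcd, hc, hd⟩ := exists_two_edges_of_isPath (hwpath i)
      ((hsupp i x).2 (Or.inr hx)) hxa hxb
    have := edge_mem_of_degIn_le_two (hedges i) (hdeg x hxa hxb) hcd hc hd hxy
    exact ((hsupp i y).1 ((w i).snd_mem_support_of_mem_edges this)).resolve_left hya
  have hdisj : ∀ i j, i ≠ j → ∀ v, v ∈ (w i).support → v ∈ (w j).support → v = a ∨ v = b := by
    intro i j hij v hvi hvj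
    by_contra hcon
    push Not at hcon
    have hvi' := ((hsupp i v).1 hvi).resolve_left hcon.1
    have hvj' := ((hsupp j v).1 hvj).resolve_left hcon.1
    have huj := start_mem_of_path_mem (hp j) (F := {x | x ∈ (p i).support ∧ x ≠ b})
      (fun h => h.2 rfl) (fun x hx y hy hyb hxy =>
        ⟨hcl i x hx.1 hx.2 y (fun h => hap j (h ▸ hy)) hxy, hyb⟩) hvj' ⟨hvi', hcon.2⟩
    have hne : u j ≠ u i := fun h => hij (huinj h).symm
    have hua : u j ≠ a := (hu j).2.ne'
    obtain ⟨c, d, hcd, hc, hd⟩ := exists_two_edges_of_isPath (hp i) huj.1 hne huj.2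
    rcases eq_or_eq_of_degIn_le_two (hdeg (u j) hua huj.2) hcd ((p i).adj_of_mem_edges hc)
      ((p i).adj_of_mem_edges hd) (hu j).2.symm with h | h
    · exact hap i (h ▸ (p i).snd_mem_support_of_mem_edges hc)
    · exact hap i (h ▸ (p i).snd_mem_support_of_mem_edges hd)
  have hcov : ∀ x, (∃ i, x ∈ (w i).support) → ∀ y, G.Adj x y → ∃ i, s(x, y) ∈ (w i).edges := by
    rintro x ⟨i, hxi⟩ y hxy
    by_cases hxa : x = a
    · subst hxa
      have := mem_of_card_degIn_le (G := G) (Finset.univ.image u) (by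
        intro c hc
        obtain ⟨j, -, rfl⟩ := Finset.mem_image.1 hc
        exact (hu j).2) (by
        rw [Finset.card_image_of_injective _ huinj, ha]; simp) hxy
      obtain ⟨j, -, rfl⟩ := Finset.mem_image.1 this
      exact ⟨j, by simp [hw]⟩
    by_cases hxb : x = b
    · subst hxb
      choose z hz using fun j => exists_edge_end (w j) hab
      have hzinj : Function.Injective z := by
        intro j k hjk
        by_contra hne
        have hadj : G.Adj x (z j) := (w j).adj_of_mem_edges (hz j)
        have h1 := hdisj j k hne (z j) ((w j).snd_mem_support_of_mem_edges (hz j))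
          (hjk ▸ (w k).snd_mem_support_of_mem_edges (hz k))
        have hza : z j = a := h1.resolve_right hadj.ne'
        have hub : ∀ l, z l = a → u l = x := by
          intro l hl
          have h2 := hz l
          rw [hl] at h2
          simp only [hw, SimpleGraph.Walk.edges_cons, List.mem_cons] at h2
          rcases h2 with h2 | h2
          · rw [Sym2.eq_swap, Sym2.congr_right] at h2
            exact h2.symm
          · exact absurd ((p l).snd_mem_support_of_mem_edges h2) (hap l)
        exact hne (huinj ((hub j hza).trans (hub k (hjk ▸ hza)).symm))
      have := mem_of_card_degIn_le (G := G) (Finset.univ.image z) (by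
        intro c hc
        obtain ⟨j, -, rfl⟩ := Finset.mem_image.1 hc
        exact (w j).adj_of_mem_edges (hz j)) (by
        rw [Finset.card_image_of_injective _ hzinj, hb]; simp) hxy
      obtain ⟨j, -, rfl⟩ := Finset.mem_image.1 this
      exact ⟨j, hz j⟩
    obtain ⟨c, d, hcd, hc, hd⟩ := exists_two_edges_of_isPath (hwpath i) hxi hxa hxb
    exact ⟨i, edge_mem_of_degIn_le_two (hedges i) (hdeg x hxa hxb) hcd hc hd hxy⟩
  have hall : ∀ x, ∃ i, x ∈ (w i).support :=
    mem_of_adj_closed (U := {x | ∃ i, x ∈ (w i).support}) hG ⟨a, 0, by simp⟩ fun x hx y hxy => by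
      obtain ⟨i, hi⟩ := hcov x hx y hxy
      exact ⟨i, (w i).snd_mem_support_of_mem_edges hi⟩
  refine ⟨a, b, w, hab, hwpath, hdisj, fun i j hij h => ?_, hall, fun e he => ?_⟩
  · have hlen : ∀ l, (w l).length = 1 → u l = b := fun l hl =>
      SimpleGraph.Walk.eq_of_length_eq_zero (p := p l) (by simpa [hw] using hl)
    exact hij (huinj ((hlen i h.1).trans (hlen j h.2).symm))
  · induction e using Sym2.ind with
    | _ x y => exact hcov x (hall x) y he

theorem isInfinityGraph_of_degIn_four (hG : G.Connected)
    (hmin : ∀ v, 2 ≤ degIn G Finset.univ v) {a : V} (ha : degIn G Finset.univ a = 4)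
    (hdeg : ∀ v, v ≠ a → degIn G Finset.univ v = 2) : IsInfinityGraph G := by
  have hS := ConnSet.univ_of_connected hG
  have hCa : ∀ C ∈ comps G (Finset.univ.erase a), ∀ v ∈ C, v ≠ a := fun C hC v hv =>
    Finset.ne_of_mem_erase ((mem_comps.1 hC).1 hv)
  have h2 : ∀ C ∈ comps G (Finset.univ.erase a), degIn G C a = 2 := by
    intro C hC
    obtain ⟨h1, k, hk⟩ := comp_attachment hmin hC
    have h3 := hS.degIn_comps_pos (Finset.mem_univ a) hC
    have h4 : ∑ v ∈ C, (degIn G Finset.univ v - 2) = 0 := Finset.sum_eq_zero fun v hv => by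
      have := hdeg v (hCa C hC v hv)
      omega
    omega
  have hsum := sum_comps_degIn (G := G) Finset.univ a
  rw [Finset.sum_congr rfl h2, Finset.sum_const, smul_eq_mul, ha] at hsum
  obtain ⟨C, D, hCD, hcomps⟩ := Finset.card_eq_two.1
    (show (comps G (Finset.univ.erase a)).card = 2 by omega)
  have hC : C ∈ comps G (Finset.univ.erase a) := by rw [hcomps]; simp
  have hD : D ∈ comps G (Finset.univ.erase a) := by rw [hcomps]; simp
  obtain ⟨c, hc, hcs⟩ := exists_isCycle_of_comp hC (h2 C hC).ge fun v hv =>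
    (hdeg v (hCa C hC v hv)).le
  obtain ⟨d, hd, hds⟩ := exists_isCycle_of_comp hD (h2 D hD).ge fun v hv =>
    (hdeg v (hCa D hD v hv)).le
  have hdis := comps_pairwiseDisjoint (G := G) _ hC hD hCD
  have hall : ∀ v, v = a ∨ v ∈ C ∨ v ∈ D := fun v => by
    by_cases hv : v = a
    · exact Or.inl hv
    · obtain ⟨E, hE, hvE⟩ := exists_mem_comps (G := G) (Finset.mem_erase.2 ⟨hv, Finset.mem_univ v⟩)
      rw [hcomps, Finset.mem_insert, Finset.mem_singleton] at hE
      rcases hE with rfl | rfl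
      · exact Or.inr (Or.inl hvE)
      · exact Or.inr (Or.inr hvE)
  have hedge : ∀ x y, G.Adj x y → x ≠ a → s(x, y) ∈ c.edges ∨ s(x, y) ∈ d.edges := by
    intro x y hxy hxa
    rcases (hall x).resolve_left hxa with hx | hx
    · obtain ⟨s, t, hst, hs, ht⟩ := exists_two_edges_of_isCycle hc ((hcs x).2 (Or.inr hx))
      exact Or.inl (edge_mem_of_degIn_le_two (fun e he => c.edges_subset_edgeSet he)
        (hdeg x hxa).le hst hs ht hxy)
    · obtain ⟨s, t, hst, hs, ht⟩ := exists_two_edges_of_isCycle hd ((hds x).2 (Or.inr hx))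
      exact Or.inr (edge_mem_of_degIn_le_two (fun e he => d.edges_subset_edgeSet he)
        (hdeg x hxa).le hst hs ht hxy)
  refine ⟨a, a, c, d, SimpleGraph.Walk.nil, hc, hd, by simp, by simp, by simp,
    fun v h1 h2 => ?_, fun v => ?_, fun e he => ?_⟩
  · rw [hcs] at h1
    rw [hds] at h2
    rcases h1 with rfl | h1
    · exact ⟨rfl, rfl⟩
    · rcases h2 with rfl | h2
      · exact ⟨rfl, rfl⟩
      · exact absurd h2 (Finset.disjoint_left.1 hdis h1)
  · rw [hcs, hds]
    have := hall v
    tauto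
  · induction e using Sym2.ind with
    | _ x y =>
      have hxy : G.Adj x y := he
      by_cases hxa : x = a
      · have := hedge y x hxy.symm fun h => hxy.ne (hxa.trans h.symm)
        rw [Sym2.eq_swap] at this
        tauto
      · have := hedge x y hxy hxa
        tauto

/-- The components C and D close up to cycles at a and b. A path from a to b cannot enter either,
since each is left only through its own attaching vertex. The degrees show that nothing else exists.
-/
theorem isInfinityGraph_of_degIn_three (hG : G.Connected) {a b : V} (hab : a ≠ b)
    (ha : degIn G Finset.univ a = 3) (hb : degIn G Finset.univ b = 3)
    (hdeg : ∀ v, v ≠ a → v ≠ b → degIn G Finset.univ v ≤ 2) {C D : Finset V}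
    (hC : C ∈ comps G (Finset.univ.erase a)) (hbC : b ∉ C) (hCa : degIn G C a = 2)
    (hD : D ∈ comps G (Finset.univ.erase b)) (haD : a ∉ D) (hDb : degIn G D b = 2) :
    IsInfinityGraph G := by
  obtain ⟨hC1, hC2, hC3⟩ := mem_comps.1 hC
  obtain ⟨hD1, hD2, hD3⟩ := mem_comps.1 hD
  have haC : a ∉ C := fun h => Finset.notMem_erase a _ (hC1 h)
  have hbD : b ∉ D := fun h => Finset.notMem_erase b _ (hD1 h)
  have hdegC : ∀ v ∈ C, degIn G Finset.univ v ≤ 2 := fun v hv =>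
    hdeg v (fun h => haC (h ▸ hv)) (fun h => hbC (h ▸ hv))
  have hdegD : ∀ v ∈ D, degIn G Finset.univ v ≤ 2 := fun v hv =>
    hdeg v (fun h => haD (h ▸ hv)) (fun h => hbD (h ▸ hv))
  obtain ⟨c, hc, hcs⟩ := exists_isCycle_of_comp hC hCa.ge hdegC
  obtain ⟨d, hd, hds⟩ := exists_isCycle_of_comp hD hDb.ge hdegD
  obtain ⟨w, hw, -⟩ := (ConnSet.univ_of_connected hG).exists_path (Finset.mem_univ a)
    (Finset.mem_univ b)
  have havoid : ∀ {x y : V} (p : G.Walk x y), p.IsPath → x ≠ y → ∀ E ∈ comps G (Finset.univ.erase x),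
      y ∉ E → ∀ v ∈ p.support, v ∉ E := by
    intro x y p hp hxy E hE hyE v hv hvE
    cases p with
    | nil => exact hxy rfl
    | @cons _ u _ h q =>
      rw [SimpleGraph.Walk.cons_isPath_iff] at hp
      have hvx : v ≠ x := Finset.ne_of_mem_erase ((mem_comps.1 hE).1 hvE)
      have hvq : v ∈ q.support := by
        rw [SimpleGraph.Walk.support_cons, List.mem_cons] at hv
        exact hv.resolve_left hvx
      have hsub : q.support.toFinset ⊆ E := by
        refine (connSet_support q).subset_of_closedIn (T := Finset.univ.erase x) (fun z hz => ?_)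
          (mem_comps.1 hE).2.2 ⟨v, Finset.mem_inter.2 ⟨List.mem_toFinset.2 hvq, hvE⟩⟩
        exact Finset.mem_erase.2 ⟨fun h => hp.2 (h ▸ List.mem_toFinset.1 hz), Finset.mem_univ z⟩
      exact hyE (hsub (by simp))
  have hwC := havoid w hw hab C hC hbC
  have hwD : ∀ v ∈ w.support, v ∉ D := fun v hv =>
    havoid w.reverse (by simpa using hw) hab.symm D hD haD v (by simpa using hv)
  have hdisj : Disjoint C D := by
    rw [Finset.disjoint_left]
    intro v hvC hvD
    have h1 : C ⊆ D := hC2.subset_of_closedIn (T := Finset.univ.erase b) (fun z hz =>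
      Finset.mem_erase.2 ⟨fun h => hbC (h ▸ hz), Finset.mem_univ z⟩) hD3
      ⟨v, Finset.mem_inter.2 ⟨hvC, hvD⟩⟩
    obtain ⟨u, hu⟩ := Finset.card_pos.1 (show 0 < degIn G C a by omega)
    rw [Finset.mem_filter] at hu
    exact haD (hD3 u (h1 hu.1) a (Finset.mem_erase.2 ⟨hab, Finset.mem_univ a⟩) hu.2.symm)
  have hend : ∀ {x y : V} (p : G.Walk x y) (e : G.Walk x x) (E : Finset V), x ≠ y → e.IsCycle →
      (∀ v, v ∈ e.support ↔ v = x ∨ v ∈ E) → (∀ v ∈ p.support, v ∉ E) →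
      degIn G Finset.univ x = 3 → ∀ z, G.Adj x z → s(x, z) ∈ e.edges ∨ s(x, z) ∈ p.edges := by
    intro x y p e E hxy he hes hpE hx3 z hxz
    obtain ⟨s, t, hst, hs, ht⟩ := exists_two_edges_of_isCycle he e.start_mem_support
    obtain ⟨r, hr⟩ := exists_edge_start p hxy
    have hmemE : ∀ s, s(x, s) ∈ e.edges → s ∈ E := fun s hs =>
      ((hes s).1 (e.snd_mem_support_of_mem_edges hs)).resolve_left (e.adj_of_mem_edges hs).ne'
    have hrE := hpE r (p.snd_mem_support_of_mem_edges hr)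
    have hrs : s ≠ r := fun h => hrE (h ▸ hmemE s hs)
    have hrt : t ≠ r := fun h => hrE (h ▸ hmemE t ht)
    have := mem_of_card_degIn_le (G := G) {s, t, r} (by
      simp [e.adj_of_mem_edges hs, e.adj_of_mem_edges ht, p.adj_of_mem_edges hr]) (by
      rw [hx3, Finset.card_eq_three.2 ⟨s, t, r, hst, hrs, hrt, rfl⟩]) hxz
    simp only [Finset.mem_insert, Finset.mem_singleton] at this
    rcases this with rfl | rfl | rfl
    · exact Or.inl hs
    · exact Or.inl ht
    · exact Or.inr hr
  have hcov : ∀ x, (x ∈ c.support ∨ x ∈ d.support ∨ x ∈ w.support) → ∀ y, G.Adj x y →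
      s(x, y) ∈ c.edges ∨ s(x, y) ∈ d.edges ∨ s(x, y) ∈ w.edges := by
    intro x hx y hxy
    by_cases hxa : x = a
    · subst hxa
      rcases hend w c C hab hc hcs hwC ha y hxy with h | h
      · exact Or.inl h
      · exact Or.inr (Or.inr h)
    by_cases hxb : x = b
    · subst hxb
      rcases hend w.reverse d D hab.symm hd hds (fun v hv => hwD v (by simpa using hv)) hb y hxy
        with h | h
      · exact Or.inr (Or.inl h)
      · exact Or.inr (Or.inr (by simpa using h))
    have hx2 := hdeg x hxa hxb
    rcases hx with hx | hx | hx
    · obtain ⟨s, t, hst, hs, ht⟩ := exists_two_edges_of_isCycle hc hx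
      exact Or.inl (edge_mem_of_degIn_le_two (fun e he => c.edges_subset_edgeSet he)
        hx2 hst hs ht hxy)
    · obtain ⟨s, t, hst, hs, ht⟩ := exists_two_edges_of_isCycle hd hx
      exact Or.inr (Or.inl (edge_mem_of_degIn_le_two (fun e he => d.edges_subset_edgeSet he)
        hx2 hst hs ht hxy))
    · obtain ⟨s, t, hst, hs, ht⟩ := exists_two_edges_of_isPath hw hx hxa hxb
      exact Or.inr (Or.inr (edge_mem_of_degIn_le_two (fun e he => w.edges_subset_edgeSet he)
        hx2 hst hs ht hxy))
  have hall : ∀ x, x ∈ c.support ∨ x ∈ d.support ∨ x ∈ w.support :=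
    mem_of_adj_closed (U := {x | x ∈ c.support ∨ x ∈ d.support ∨ x ∈ w.support}) hG
      ⟨a, Or.inl c.start_mem_support⟩ fun x hx y hxy => by
        rcases hcov x hx y hxy with h | h | h
        · exact Or.inl (c.snd_mem_support_of_mem_edges h)
        · exact Or.inr (Or.inl (d.snd_mem_support_of_mem_edges h))
        · exact Or.inr (Or.inr (w.snd_mem_support_of_mem_edges h))
  refine ⟨a, b, c, d, w, hc, hd, hw, fun v h1 h2 => ?_, fun v h1 h2 => ?_, fun v h1 h2 => ?_,
    hall, fun e he => ?_⟩
  · exact ((hcs v).1 h1).resolve_right (hwC v h2)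
  · exact ((hds v).1 h1).resolve_right (hwD v h2)
  · exfalso
    rcases (hcs v).1 h1 with rfl | h1
    · exact ((hds v).1 h2).elim hab haD
    · rcases (hds v).1 h2 with rfl | h2
      · exact hbC h1
      · exact Finset.disjoint_left.1 hdisj h1 h2
  · induction e using Sym2.ind with
    | _ x y => exact hcov x (hall x) y he

/-- Connected bicyclic graphs without pendant vertices. -/
theorem isInfinityGraph_or_isThetaGraph (hG : G.Connected)
    (hmin : ∀ v, 2 ≤ degIn G Finset.univ v) (hq : majorExcess G Finset.univ = 2) :
    IsInfinityGraph G ∨ IsThetaGraph G := by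
  have hS := ConnSet.univ_of_connected hG
  obtain ⟨a, -, ha⟩ := Finset.exists_ne_zero_of_sum_ne_zero
    (show ∑ v, (degIn G Finset.univ v - 2) ≠ 0 by rw [← majorExcess, hq]; omega)
  have hsplit := Finset.add_sum_erase Finset.univ (fun v => degIn G Finset.univ v - 2)
    (Finset.mem_univ a)
  rw [← majorExcess, hq] at hsplit
  by_cases h4 : degIn G Finset.univ a = 4
  · left
    refine isInfinityGraph_of_degIn_four hG hmin h4 fun v hv => ?_
    have h0 : ∑ v ∈ Finset.univ.erase a, (degIn G Finset.univ v - 2) = 0 := by omega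
    have := Finset.sum_eq_zero_iff.1 h0 v (Finset.mem_erase.2 ⟨hv, Finset.mem_univ v⟩)
    have := hmin v
    omega
  have h1 : ∑ v ∈ Finset.univ.erase a, (degIn G Finset.univ v - 2) = 1 := by omega
  obtain ⟨b, hb, hb0⟩ := Finset.exists_ne_zero_of_sum_ne_zero
    (show ∑ v ∈ Finset.univ.erase a, (degIn G Finset.univ v - 2) ≠ 0 by omega)
  have hba : b ≠ a := Finset.ne_of_mem_erase hb
  rw [← Finset.add_sum_erase _ _ hb] at h1
  have ha3 : degIn G Finset.univ a = 3 := by omega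
  have hb3 : degIn G Finset.univ b = 3 := by omega
  have hdeg : ∀ v, v ≠ a → v ≠ b → degIn G Finset.univ v ≤ 2 := fun v hva hvb => by
    have := Finset.sum_eq_zero_iff.1
      (show ∑ v ∈ (Finset.univ.erase a).erase b, (degIn G Finset.univ v - 2) = 0 by omega) v
      (by simp [hva, hvb])
    omega
  -- The component containing y has excess one, so it receives an odd number of edges from x. Three
  -- gives a θ-graph; otherwise some other component, of excess zero, receives exactly two and
  -- closes a cycle at x.
  have key : ∀ x y, x ≠ y → degIn G Finset.univ x = 3 → degIn G Finset.univ y = 3 →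
      (∀ v, v ≠ x → v ≠ y → degIn G Finset.univ v ≤ 2) → IsThetaGraph G ∨
      ∃ C ∈ comps G (Finset.univ.erase x), y ∉ C ∧ degIn G C x = 2 := by
    intro x y hxy hx hy hd
    obtain ⟨C, hC, hyC⟩ := exists_mem_comps (G := G)
      (Finset.mem_erase.2 ⟨hxy.symm, Finset.mem_univ y⟩)
    have hne : ∀ E ∈ comps G (Finset.univ.erase x), ∀ v ∈ E, v ≠ x := fun E hE v hv =>
      Finset.ne_of_mem_erase ((mem_comps.1 hE).1 hv)
    have hqC : ∑ v ∈ C, (degIn G Finset.univ v - 2) = 1 := by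
      have h0 : ∑ v ∈ C.erase y, (degIn G Finset.univ v - 2) = 0 := Finset.sum_eq_zero fun v hv => by
        have := hd v (hne C hC v (Finset.mem_of_mem_erase hv)) (Finset.ne_of_mem_erase hv)
        omega
      rw [← Finset.add_sum_erase _ _ hyC, hy, h0]
    obtain ⟨hCle, k, hk⟩ := comp_attachment hmin hC
    have hsum := sum_comps_degIn (G := G) Finset.univ x
    rw [← Finset.add_sum_erase _ _ hC, hx] at hsum
    by_cases h3 : degIn G C x = 3
    · exact Or.inl (isThetaGraph_of_connSet hG hxy hx hy hd (mem_comps.1 hC).2.1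
        (fun h => hne C hC x h rfl) hyC h3)
    right
    obtain ⟨D, hD, hD0⟩ := Finset.exists_ne_zero_of_sum_ne_zero
      (show ∑ E ∈ (comps G (Finset.univ.erase x)).erase C, degIn G E x ≠ 0 by omega)
    obtain ⟨hDC, hD⟩ := Finset.mem_erase.1 hD
    have hyD : y ∉ D := fun h => hDC (comps_eq_of_inter hD hC ⟨y, Finset.mem_inter.2 ⟨h, hyC⟩⟩)
    have hqD : ∑ v ∈ D, (degIn G Finset.univ v - 2) = 0 := Finset.sum_eq_zero fun v hv => by
      have := hd v (hne D hD v hv) fun h => hyD (h ▸ hv)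
      omega
    obtain ⟨hDle, l, hl⟩ := comp_attachment hmin hD
    exact ⟨D, hD, hyD, by omega⟩
  rcases key a b hba.symm ha3 hb3 hdeg with h | ⟨C, hC, hbC, hCa⟩
  · exact Or.inr h
  rcases key b a hba hb3 ha3 (fun v h1 h2 => hdeg v h2 h1) with h | ⟨D, hD, haD, hDb⟩
  · exact Or.inr h
  exact Or.inl (isInfinityGraph_of_degIn_three hG hba.symm ha3 hb3 hdeg hC hbC hCa hD haD hDb)

end BicyclicForward

/-! ### Edge counts and connectivity of ∞-graphs and θ-graphs -/

section BicyclicBackward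

variable {V : Type*} [Fintype V] {G : SimpleGraph V}

theorem card_support_of_isCycle {a : V} {c : G.Walk a a} (hc : c.IsCycle) :
    c.support.toFinset.card = c.length := by
  cases c with
  | nil => exact absurd hc SimpleGraph.Walk.not_isCycle_nil
  | @cons _ u _ h p =>
    rw [SimpleGraph.Walk.cons_isCycle_iff] at hc
    rw [SimpleGraph.Walk.support_cons, List.toFinset_cons, Finset.insert_eq_of_mem (by simp),
      List.toFinset_card_of_nodup hc.1.support_nodup, SimpleGraph.Walk.length_support,
      SimpleGraph.Walk.length_cons]

theorem card_support_of_isPath {a b : V} {p : G.Walk a b} (hp : p.IsPath) :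
    p.support.toFinset.card = p.length + 1 := by
  rw [List.toFinset_card_of_nodup hp.support_nodup, SimpleGraph.Walk.length_support]

theorem card_edges_of_isTrail {a b : V} {p : G.Walk a b} (hp : p.IsTrail) :
    p.edges.toFinset.card = p.length := by
  rw [List.toFinset_card_of_nodup hp.edges_nodup, SimpleGraph.Walk.length_edges]

/-- Walks meeting in at most one vertex share no edge. -/
theorem disjoint_edges_of_support {a b c d x : V} {p : G.Walk a b} {q : G.Walk c d}
    (h : ∀ v, v ∈ p.support → v ∈ q.support → v = x) :
    Disjoint p.edges.toFinset q.edges.toFinset := by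
  rw [Finset.disjoint_left]
  intro e hp hq
  rw [List.mem_toFinset] at hp hq
  induction e using Sym2.ind with
  | _ u v =>
    have h1 := h u (p.fst_mem_support_of_mem_edges hp) (q.fst_mem_support_of_mem_edges hq)
    have h2 := h v (p.snd_mem_support_of_mem_edges hp) (q.snd_mem_support_of_mem_edges hq)
    exact (p.adj_of_mem_edges hp).ne (h1.trans h2.symm)

theorem ncard_edgeSet_of_cover {E : Finset (Sym2 V)} (h1 : ∀ e ∈ E, e ∈ G.edgeSet)
    (h2 : ∀ e ∈ G.edgeSet, e ∈ E) : G.edgeSet.ncard = E.card := by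
  rw [← Set.ncard_coe_finset]
  congr 1
  ext e
  exact ⟨h2 e, h1 e⟩

theorem IsInfinityGraph.ncard_edgeSet (h : IsInfinityGraph G) :
    G.edgeSet.ncard = Fintype.card V + 1 ∧ ∀ v, 2 ≤ degIn G Finset.univ v := by
  obtain ⟨a, b, c, d, w, hc, hd, hw, h1, h2, h3, h4, h5⟩ := h
  constructor
  · have e1 : Disjoint c.edges.toFinset w.edges.toFinset := disjoint_edges_of_support h1
    have e2 : Disjoint (c.edges.toFinset ∪ w.edges.toFinset) d.edges.toFinset :=
      Finset.disjoint_union_left.2 ⟨disjoint_edges_of_support fun v x y => (h3 v x y).1,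
        (disjoint_edges_of_support h2).symm⟩
    rw [ncard_edgeSet_of_cover (E := (c.edges.toFinset ∪ w.edges.toFinset) ∪ d.edges.toFinset),
      Finset.card_union_of_disjoint e2, Finset.card_union_of_disjoint e1,
      card_edges_of_isTrail hc.isTrail, card_edges_of_isTrail hd.isTrail,
      card_edges_of_isTrail hw.isTrail]
    · have hV : (Finset.univ : Finset V) =
          (c.support.toFinset ∪ w.support.toFinset) ∪ d.support.toFinset := by
        ext v
        have := h4 v
        simp only [Finset.mem_univ, Finset.mem_union, List.mem_toFinset, true_iff]
        tauto
      have i1 : c.support.toFinset ∩ w.support.toFinset = {a} := by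
        ext v
        simp only [Finset.mem_inter, List.mem_toFinset, Finset.mem_singleton]
        refine ⟨fun h => h1 v h.1 h.2, ?_⟩
        rintro rfl
        simp
      have i2 : (c.support.toFinset ∪ w.support.toFinset) ∩ d.support.toFinset = {b} := by
        ext v
        simp only [Finset.mem_inter, Finset.mem_union, List.mem_toFinset, Finset.mem_singleton]
        constructor
        · rintro ⟨h | h, h'⟩
          · exact (h3 v h h').2
          · exact h2 v h' h
        · rintro rfl
          simp
      have j1 := Finset.card_union_add_card_inter c.support.toFinset w.support.toFinset
      have j2 := Finset.card_union_add_card_inter (c.support.toFinset ∪ w.support.toFinset)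
        d.support.toFinset
      rw [i1, Finset.card_singleton, card_support_of_isCycle hc, card_support_of_isPath hw] at j1
      rw [i2, Finset.card_singleton, card_support_of_isCycle hd, ← hV, Finset.card_univ] at j2
      omega
    · intro e he
      simp only [Finset.mem_union, List.mem_toFinset] at he
      rcases he with (he | he) | he
      · exact c.edges_subset_edgeSet he
      · exact w.edges_subset_edgeSet he
      · exact d.edges_subset_edgeSet he
    · intro e he
      have := h5 e he
      simp only [Finset.mem_union, List.mem_toFinset]
      tauto
  · intro v
    by_cases hvc : v ∈ c.support
    · obtain ⟨s, t, hst, hs, ht⟩ := exists_two_edges_of_isCycle hc hvc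
      exact two_le_degIn hst (c.adj_of_mem_edges hs) (c.adj_of_mem_edges ht)
    by_cases hvd : v ∈ d.support
    · obtain ⟨s, t, hst, hs, ht⟩ := exists_two_edges_of_isCycle hd hvd
      exact two_le_degIn hst (d.adj_of_mem_edges hs) (d.adj_of_mem_edges ht)
    have hvw : v ∈ w.support := by have := h4 v; tauto
    obtain ⟨s, t, hst, hs, ht⟩ := exists_two_edges_of_isPath hw hvw
      (by rintro rfl; simp at hvc) (by rintro rfl; simp at hvd)
    exact two_le_degIn hst (w.adj_of_mem_edges hs) (w.adj_of_mem_edges ht)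

theorem length_eq_one_of_edge {a b : V} {p : G.Walk a b} (hp : p.IsPath) (h : s(a, b) ∈ p.edges) :
    p.length = 1 := by
  cases p with
  | nil => simp at h
  | @cons _ u _ hadj q =>
    rw [SimpleGraph.Walk.cons_isPath_iff] at hp
    rw [SimpleGraph.Walk.edges_cons, List.mem_cons] at h
    rcases h with h | h
    · rw [Sym2.congr_right] at h
      subst h
      rw [(SimpleGraph.Walk.isPath_iff_nil.1 hp.1).eq_nil]
      rfl
    · exact absurd (q.fst_mem_support_of_mem_edges h) hp.2

theorem IsThetaGraph.ncard_edgeSet (h : IsThetaGraph G) :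
    G.edgeSet.ncard = Fintype.card V + 1 ∧ ∀ v, 2 ≤ degIn G Finset.univ v := by
  obtain ⟨a, b, w, hab, hw, h1, h2, h3, h4⟩ := h
  have hdisj : ∀ i j, i ≠ j → Disjoint (w i).edges.toFinset (w j).edges.toFinset := by
    intro i j hij
    rw [Finset.disjoint_left]
    intro e hi hj
    rw [List.mem_toFinset] at hi hj
    induction e using Sym2.ind with
    | _ u v =>
      have k1 := h1 i j hij u ((w i).fst_mem_support_of_mem_edges hi)
        ((w j).fst_mem_support_of_mem_edges hj)
      have k2 := h1 i j hij v ((w i).snd_mem_support_of_mem_edges hi)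
        ((w j).snd_mem_support_of_mem_edges hj)
      have hne := ((w i).adj_of_mem_edges hi).ne
      have he : s(u, v) = s(a, b) := by
        rcases k1 with rfl | rfl <;> rcases k2 with rfl | rfl
        · exact absurd rfl hne
        · rfl
        · exact Sym2.eq_swap
        · exact absurd rfl hne
      rw [he] at hi hj
      exact h2 i j hij ⟨length_eq_one_of_edge (hw i) hi, length_eq_one_of_edge (hw j) hj⟩
  have hinter : ∀ i j, i ≠ j → (w i).support.toFinset ∩ (w j).support.toFinset = {a, b} := by
    intro i j hij
    ext v
    simp only [Finset.mem_inter, List.mem_toFinset, Finset.mem_insert, Finset.mem_singleton]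
    refine ⟨fun h => h1 i j hij v h.1 h.2, ?_⟩
    rintro (rfl | rfl) <;> simp
  constructor
  · have e1 := hdisj 0 1 (by decide)
    have e2 : Disjoint ((w 0).edges.toFinset ∪ (w 1).edges.toFinset) (w 2).edges.toFinset :=
      Finset.disjoint_union_left.2 ⟨hdisj 0 2 (by decide), hdisj 1 2 (by decide)⟩
    rw [ncard_edgeSet_of_cover
      (E := ((w 0).edges.toFinset ∪ (w 1).edges.toFinset) ∪ (w 2).edges.toFinset),
      Finset.card_union_of_disjoint e2, Finset.card_union_of_disjoint e1,
      card_edges_of_isTrail (hw 0).isTrail, card_edges_of_isTrail (hw 1).isTrail,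
      card_edges_of_isTrail (hw 2).isTrail]
    · have hV : (Finset.univ : Finset V) =
          ((w 0).support.toFinset ∪ (w 1).support.toFinset) ∪ (w 2).support.toFinset := by
        ext v
        simp only [Finset.mem_univ, Finset.mem_union, List.mem_toFinset, true_iff]
        obtain ⟨i, hi⟩ := h3 v
        fin_cases i
        · exact Or.inl (Or.inl hi)
        · exact Or.inl (Or.inr hi)
        · exact Or.inr hi
      have i2 : ((w 0).support.toFinset ∪ (w 1).support.toFinset) ∩ (w 2).support.toFinset =
          {a, b} := by
        rw [Finset.union_inter_distrib_right, hinter 0 2 (by decide), hinter 1 2 (by decide),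
          Finset.union_self]
      have j1 := Finset.card_union_add_card_inter (w 0).support.toFinset (w 1).support.toFinset
      have j2 := Finset.card_union_add_card_inter
        ((w 0).support.toFinset ∪ (w 1).support.toFinset) (w 2).support.toFinset
      rw [hinter 0 1 (by decide), Finset.card_pair hab, card_support_of_isPath (hw 0),
        card_support_of_isPath (hw 1)] at j1
      rw [i2, Finset.card_pair hab, card_support_of_isPath (hw 2), ← hV, Finset.card_univ] at j2
      omega
    · intro e he
      simp only [Finset.mem_union, List.mem_toFinset] at he
      rcases he with (he | he) | he
      · exact (w 0).edges_subset_edgeSet he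
      · exact (w 1).edges_subset_edgeSet he
      · exact (w 2).edges_subset_edgeSet he
    · intro e he
      obtain ⟨i, hi⟩ := h4 e he
      simp only [Finset.mem_union, List.mem_toFinset]
      fin_cases i
      · exact Or.inl (Or.inl hi)
      · exact Or.inl (Or.inr hi)
      · exact Or.inr hi
  · intro v
    have hends : ∀ x, (∀ i, ∃ c, s(x, c) ∈ (w i).edges) → 2 ≤ degIn G Finset.univ x := by
      intro x hx
      obtain ⟨c, hc⟩ := hx 0
      obtain ⟨d, hd⟩ := hx 1
      refine two_le_degIn ?_ ((w 0).adj_of_mem_edges hc) ((w 1).adj_of_mem_edges hd)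
      rintro rfl
      exact Finset.disjoint_left.1 (hdisj 0 1 (by decide)) (List.mem_toFinset.2 hc)
        (List.mem_toFinset.2 hd)
    by_cases hva : v = a
    · subst hva
      exact hends v fun i => exists_edge_start (w i) hab
    by_cases hvb : v = b
    · subst hvb
      exact hends v fun i => exists_edge_end (w i) hab
    obtain ⟨i, hi⟩ := h3 v
    obtain ⟨s, t, hst, hs, ht⟩ := exists_two_edges_of_isPath (hw i) hi hva hvb
    exact two_le_degIn hst ((w i).adj_of_mem_edges hs) ((w i).adj_of_mem_edges ht)

/-- Deleting a vertex of a `θ`-graph leaves a connected graph. -/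
theorem IsThetaGraph.connSet_erase (h : IsThetaGraph G) (x : V) :
    ConnSet G (Finset.univ.erase x) := by
  obtain ⟨a, b, w, hab, hw, h1, -, h3, -⟩ := h
  have hcl : ∀ {C : Finset V}, ClosedIn G C (Finset.univ.erase x) → ∀ {u v : V} (p : G.Walk u v),
      x ∉ p.support → (u ∈ C ↔ v ∈ C) := by
    intro C hC u v p hx
    have hsub : p.support.toFinset ⊆ Finset.univ.erase x := fun z hz =>
      Finset.mem_erase.2 ⟨by rintro rfl; exact hx (List.mem_toFinset.1 hz), Finset.mem_univ z⟩
    constructor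
    · intro hu
      exact (connSet_support p).subset_of_closedIn hsub hC
        ⟨u, Finset.mem_inter.2 ⟨by simp, hu⟩⟩ (by simp)
    · intro hv
      exact (connSet_support p).subset_of_closedIn hsub hC
        ⟨v, Finset.mem_inter.2 ⟨by simp, hv⟩⟩ (by simp)
  have habC : ∀ {C : Finset V}, ClosedIn G C (Finset.univ.erase x) → x ≠ a → x ≠ b →
      (a ∈ C ↔ b ∈ C) := by
    intro C hC hxa hxb
    by_cases h0 : x ∈ (w 0).support
    · refine hcl hC (w 1) fun h => ?_
      rcases h1 0 1 (by decide) x h0 h with h | h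
      · exact hxa h
      · exact hxb h
    · exact hcl hC (w 0) h0
  -- The deleted x lies on at most one of the two halves into which v cuts its path, so v stays
  -- joined to a or to b; if neither is x, another path joins a and b.
  have hv : ∀ {C : Finset V}, ClosedIn G C (Finset.univ.erase x) → ∀ v, v ≠ x →
      ((v ∈ C ↔ a ∈ C) ∧ x ≠ a) ∨ ((v ∈ C ↔ b ∈ C) ∧ x ≠ b) := by
    intro C hC v hvx
    obtain ⟨i, hi⟩ := h3 v
    by_cases ht : x ∈ ((w i).takeUntil v hi).support
    · right
      have hd : x ∉ ((w i).dropUntil v hi).support := by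
        intro hd
        have hnd := (hw i).support_nodup
        rw [← (w i).take_spec hi, SimpleGraph.Walk.support_append, List.nodup_append] at hnd
        have hd' : x ∈ ((w i).dropUntil v hi).support.tail := by
          rw [← SimpleGraph.Walk.cons_tail_support, List.mem_cons] at hd
          exact hd.resolve_left hvx.symm
        exact hnd.2.2 x ht x hd' rfl
      exact ⟨hcl hC _ hd, by rintro rfl; simp at hd⟩
    · exact Or.inl ⟨(hcl hC _ ht).symm, by rintro rfl; simp at ht⟩
  have hne : (Finset.univ.erase x).Nonempty := by
    by_cases hxa : x = a
    · exact ⟨b, by simp [hxa, hab.symm]⟩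
    · exact ⟨a, by simp [Ne.symm hxa]⟩
  refine ⟨hne, fun C hC ⟨c, hc⟩ hCcl => Finset.Subset.antisymm hC fun v hvm => ?_⟩
  have g1 := hv hCcl c (Finset.ne_of_mem_erase (hC hc))
  have g2 := hv hCcl v (Finset.ne_of_mem_erase hvm)
  have g3 := habC hCcl
  tauto

/-- A connected graph with one more edge than vertices and no pendant vertices has a cycle vertex of
degree two adjacent to a major vertex. -/
theorem exists_isCycleVertex_adj_major (hG : G.Connected)
    (hE : G.edgeSet.ncard = Fintype.card V + 1) (hmin : ∀ v, 2 ≤ degIn G Finset.univ v)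
    (hq : majorExcess G Finset.univ = 2) :
    ∃ y, IsCycleVertex G y ∧ degIn G Finset.univ y = 2 ∧
      ∃ x, 3 ≤ degIn G Finset.univ x ∧ G.Adj y x := by
  have hnot : ¬ G.IsAcyclic := fun h => by
    have h1 := (SimpleGraph.isTree_iff_connected_and_card.1 ⟨hG, h⟩).2
    rw [Nat.card_coe_set_eq, Nat.card_eq_fintype_card] at h1
    omega
  simp only [SimpleGraph.IsAcyclic, not_forall, not_not] at hnot
  obtain ⟨a, c, hc⟩ := hnot
  set A := c.support.toFinset with hA
  set N := A.filter fun v => degIn G Finset.univ v = 2 with hN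
  -- A cycle has at least three vertices, but the total excess is two, so some vertex has degree
  -- two. If all had, the cycle would be the whole graph. Somewhere along it a vertex of degree two
  -- meets a major one.
  have hNne : N.Nonempty := by
    by_contra hcon
    rw [Finset.not_nonempty_iff_eq_empty, Finset.filter_eq_empty_iff] at hcon
    have h1 : A.card ≤ majorExcess G Finset.univ := by
      rw [Finset.card_eq_sum_ones]
      refine (Finset.sum_le_sum fun v hv => ?_).trans
        (Finset.sum_le_sum_of_subset (f := fun v => degIn G Finset.univ v - 2)
          (Finset.subset_univ A))
      have := hcon hv
      have := hmin v
      omega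
    rw [card_support_of_isCycle hc] at h1
    have := hc.three_le_length
    omega
  have hNA : N ≠ A := by
    intro h
    have hcl : ∀ x ∈ {x | x ∈ c.support}, ∀ y, G.Adj x y → y ∈ {x | x ∈ c.support} := by
      intro x hx y hxy
      obtain ⟨s, t, hst, hs, ht⟩ := exists_two_edges_of_isCycle hc hx
      have hxN : x ∈ N := by rw [h, hA]; exact List.mem_toFinset.2 hx
      exact c.snd_mem_support_of_mem_edges (edge_mem_of_degIn_le_two
        (fun e he => c.edges_subset_edgeSet he) (Finset.mem_filter.1 hxN).2.le hst hs ht hxy)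
    have hall := mem_of_adj_closed hG ⟨a, c.start_mem_support⟩ hcl
    have : majorExcess G Finset.univ = 0 := Finset.sum_eq_zero fun v _ => by
      have hv : v ∈ N := by rw [h, hA]; exact List.mem_toFinset.2 (hall v)
      have := (Finset.mem_filter.1 hv).2
      omega
    omega
  obtain ⟨y, hy, x, hx, hxN, hyx⟩ := (connSet_support c).exists_adj (Finset.filter_subset _ _)
    hNne hNA
  obtain ⟨hyA, hy2⟩ := Finset.mem_filter.1 hy
  refine ⟨y, ⟨c.rotate y (List.mem_toFinset.1 hyA), hc.rotate _⟩, hy2, x, ?_, hyx⟩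
  have h1 : degIn G Finset.univ x ≠ 2 := fun h => hxN (Finset.mem_filter.2 ⟨hx, h⟩)
  have := hmin x
  omega

end BicyclicBackward

/-! ### The equality and the four forms in terms of vertex sets -/

section Translation

variable {V : Type*} [Fintype V] {G : SimpleGraph V} {B : Matrix V V ℂ} {μ : ℂ}

theorem two_mul_cyclomatic_univ (hG : G.Connected) : 2 * cyclomatic G =
    ((∑ v, degIn G Finset.univ v : ℕ) : ℤ) - 2 * (Finset.univ : Finset V).card + 2 :=
  two_mul_cyclomatic hG SimpleGraph.Embedding.refl (by simp)

theorem pendantCount_eq_univ :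
    pendantCount G = (Finset.univ.filter fun v => degIn G Finset.univ v = 1).card :=
  pendantCount_eq SimpleGraph.Embedding.refl (by simp)

theorem two_mul_cyclomatic_add_pendantCount [Nontrivial V] (hG : G.Connected) :
    2 * cyclomatic G + (pendantCount G : ℤ) = majorExcess G Finset.univ + 2 := by
  have h1 := two_mul_cyclomatic_univ hG
  have h2 := sum_degIn_add_pendant (ConnSet.univ_of_connected hG)
    (by rw [Finset.card_univ]; exact Fintype.one_lt_card)
  rw [← pendantCount_eq_univ] at h2
  omega

theorem mult_eq_iff_extremal [Nontrivial V] (hG : G.Connected) :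
    (mult B μ : ℤ) = 2 * cyclomatic G + (pendantCount G : ℤ) - 1 ↔
      solDim B μ Finset.univ ∅ = 1 + majorExcess G Finset.univ := by
  have := two_mul_cyclomatic_add_pendantCount hG
  rw [mult_eq_solDim_univ]
  omega

theorem mem_majorSet {v : V} : v ∈ majorSet G ↔ 3 ≤ degIn G Finset.univ v := by
  rw [majorSet, Set.mem_ofPred_eq, deg_eq_degIn_univ]

theorem mem_offCycleMajorSet {v : V} : v ∈ offCycleMajorSet G ↔ v ∈ offMajor G Finset.univ := by
  simp [offCycleMajorSet, mem_majorSet, offMajor, cycAt_univ_iff]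

theorem mem_compl_offCycleMajorSet (v : V) :
    v ∈ Finset.univ \ offMajor G Finset.univ ↔ v ∈ (offCycleMajorSet G)ᶜ := by
  simp [mem_offCycleMajorSet]

theorem mem_compl_majorSet (v : V) :
    v ∈ Finset.univ \ (Finset.univ.filter fun v => 3 ≤ degIn G Finset.univ v) ↔
      v ∈ (majorSet G)ᶜ := by
  simp [mem_majorSet]

theorem exists_compFin_eq_of_mem_comps {s : Set V} {T : Finset V} (hT : ∀ v, v ∈ T ↔ v ∈ s)
    {C : Finset V} (hC : C ∈ comps G T) :
    ∃ K : (G.induce s).ConnectedComponent, compFin K = C := by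
  have h : T = s.toFinset := by
    ext v
    rw [hT, Set.mem_toFinset]
  exact exists_compFin_eq (h ▸ hC)

theorem sum_comps_eq_sum_compFin {M : Type*} [AddCommMonoid M] {s : Set V} {T : Finset V}
    (hT : ∀ v, v ∈ T ↔ v ∈ s) (F : Finset V → M) :
    ∑ C ∈ comps G T, F C = ∑ K : (G.induce s).ConnectedComponent, F (compFin K) := by
  have h : T = s.toFinset := by
    ext v
    rw [hT, Set.mem_toFinset]
  rw [h, sum_compFin]

theorem isEig_restrict_iff {s : Set V} (K : (G.induce s).ConnectedComponent) :
    IsEig (restrict (restrict B s) K.supp) μ ↔ 1 ≤ solDim B μ (compFin K) ∅ := by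
  rw [isEig_iff, mult_restrict_restrict]

theorem inU_iff {W : Type*} [Finite W] {H : SimpleGraph W} (hH : H.Connected) (φ : H ↪g G)
    {C : Finset V} (hC : ∀ v, v ∈ C ↔ ∃ a, φ a = v) :
    InU H ↔ ∑ v ∈ C, degIn G C v = 2 * C.card ∧
      (C.filter fun v => degIn G C v = 1).card ≤ 1 := by
  have := two_mul_cyclomatic hH φ hC
  rw [InU, pendantCount_eq φ hC]
  constructor
  · rintro ⟨-, h1, h2⟩
    exact ⟨by omega, h2⟩
  · rintro ⟨h1, h2⟩
    exact ⟨hH, by omega, h2⟩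

theorem inU_toSimpleGraph_iff {s : Set V} (K : (G.induce s).ConnectedComponent) :
    InU K.toSimpleGraph ↔ ∑ v ∈ compFin K, degIn G (compFin K) v = 2 * (compFin K).card ∧
      ((compFin K).filter fun v => degIn G (compFin K) v = 1).card ≤ 1 :=
  inU_iff K.connected_toSimpleGraph (compEmbedding K) (mem_compFin K)

theorem connSet_compFin {s : Set V} (K : (G.induce s).ConnectedComponent) :
    ConnSet G (compFin K) :=
  connSet_of_connected K.connected_toSimpleGraph (compEmbedding K) (mem_compFin K)

theorem isPathGraph_of_embedding {W : Type*} [Finite W] {H : SimpleGraph W} (hH : H.Connected)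
    (φ : H ↪g G) {C : Finset V} (hC : ∀ v, v ∈ C ↔ ∃ a, φ a = v)
    (hsum : ∑ v ∈ C, degIn G C v + 2 = 2 * C.card) (hle : ∀ v ∈ C, degIn G C v ≤ 2) :
    IsPathGraph H := by
  have := Fintype.ofFinite W
  have h1 := sum_degIn_eq_edges φ hC
  have h2 := sum_degIn_eq_edges (SimpleGraph.Embedding.refl (G := H)) (C := Finset.univ) (by simp)
  have h3 := natCard_eq φ hC
  rw [Nat.card_eq_fintype_card] at h3
  refine isPathGraph_of_degIn hH (by omega) fun a => ?_
  rw [← deg_eq_degIn_univ, deg_eq_degIn φ hC]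
  exact hle _ ((hC _).2 ⟨a, rfl⟩)

theorem isPathGraph_toSimpleGraph {s : Set V} (K : (G.induce s).ConnectedComponent)
    (hsum : ∑ v ∈ compFin K, degIn G (compFin K) v + 2 = 2 * (compFin K).card)
    (hle : ∀ v ∈ compFin K, degIn G (compFin K) v ≤ 2) : IsPathGraph K.toSimpleGraph :=
  isPathGraph_of_embedding K.connected_toSimpleGraph (compEmbedding K) (mem_compFin K) hsum hle

theorem IsPathGraph.not_inU {W : Type*} [Finite W] {H : SimpleGraph W} (h : IsPathGraph H) :
    ¬ InU H := by
  intro hU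
  have := Fintype.ofFinite W
  have h1 := hU.2.1
  have h2 := two_mul_cyclomatic_univ hU.1
  have : ∑ v, degIn H Finset.univ v < ∑ v : W, 2 := by
    obtain ⟨w⟩ := hU.1.nonempty
    rcases subsingleton_or_nontrivial W with hW | hW
    · refine Finset.sum_lt_sum_of_nonempty ⟨w, Finset.mem_univ w⟩ fun v _ => ?_
      have : degIn H Finset.univ v = 0 := by
        rw [degIn, Finset.card_eq_zero, Finset.filter_eq_empty_iff]
        intro a _ ha
        exact ha.ne (Subsingleton.elim _ _)
      omega
    · obtain ⟨k1, v, k2⟩ := h.degIn_le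
      exact Finset.sum_lt_sum (fun v _ => k1 v) ⟨v, Finset.mem_univ v, by omega⟩
  rw [Finset.sum_const, smul_eq_mul] at this
  omega

end Translation

/-! ### Lower bound from deleting an independent set -/

section LowerBound

variable {V : Type*} [Fintype V] {G : SimpleGraph V} {B : Matrix V V ℂ} {μ : ℂ}

theorem solDim_sdiff_le (S M : Finset V) :
    solDim B μ (S \ M) ∅ ≤ solDim B μ S ∅ + M.card := by
  induction M using Finset.induction_on with
  | empty => simp
  | insert x M hx ih =>
    rw [Finset.sdiff_insert, Finset.card_insert_of_notMem hx]
    have := solDim_erase_le_add_one (B := B) (μ := μ) (S \ M) x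
    omega

/-- Degree count for the deletion of an independent set `M`. -/
theorem sum_degIn_eq_sum_comps_sdiff {S M : Finset V} (hM : M ⊆ S)
    (hind : ∀ u ∈ M, ∀ v ∈ M, ¬ G.Adj u v) :
    ∑ v ∈ S, degIn G S v =
      ∑ K ∈ comps G (S \ M), ∑ v ∈ K, degIn G K v + 2 * ∑ x ∈ M, degIn G S x := by
  have h1 : ∑ K ∈ comps G (S \ M), ∑ v ∈ K, degIn G K v = ∑ v ∈ S \ M, degIn G (S \ M) v := by
    rw [← sum_comps (G := G)]
    refine Finset.sum_congr rfl fun K hK => Finset.sum_congr rfl fun v hv => ?_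
    obtain ⟨k1, -, k2⟩ := mem_comps.1 hK
    exact degIn_of_closedIn k1 k2 hv
  have h2 : ∀ v, degIn G S v = degIn G (S \ M) v + degIn G M v := fun v => by
    rw [degIn, degIn, degIn, ← Finset.card_union_of_disjoint, ← Finset.filter_union,
      Finset.sdiff_union_of_subset hM]
    exact Finset.disjoint_filter_filter Finset.sdiff_disjoint
  have h3 : ∀ x ∈ M, degIn G M x = 0 := fun x hx => by
    rw [degIn, Finset.card_eq_zero, Finset.filter_eq_empty_iff]
    exact fun y hy => hind x hx y hy
  have h4 : ∑ v ∈ S \ M, degIn G M v = ∑ x ∈ M, degIn G S x := by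
    have : ∀ x ∈ M, degIn G S x = ∑ v ∈ S \ M, if G.Adj x v then 1 else 0 := fun x hx => by
      rw [h2, h3 x hx, sum_ite_adj, add_zero]
    rw [Finset.sum_congr rfl this, Finset.sum_comm]
    refine Finset.sum_congr rfl fun v _ => ?_
    rw [← sum_ite_adj]
    exact Finset.sum_congr rfl fun x _ => by rw [G.adj_comm]
  rw [← Finset.sum_sdiff hM, h1, Finset.sum_congr rfl fun v _ => h2 v, Finset.sum_add_distrib, h4]
  ring

theorem le_solDim_of_independent (hB : IsMatrixOf G B) {S M : Finset V} (hM : M ⊆ S)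
    (hind : ∀ u ∈ M, ∀ v ∈ M, ¬ G.Adj u v) {t : ℤ}
    (ht : 2 * t = (∑ v ∈ S, degIn G S v : ℕ) - 2 * (S.card : ℤ) + 2)
    (hc : 2 * t ≤ ∑ K ∈ comps G (S \ M), ((∑ v ∈ K, degIn G K v : ℕ) - 2 * (K.card : ℤ) + 2))
    (hm : (comps G (S \ M)).card + t ≤ ((∑ K ∈ comps G (S \ M), solDim B μ K ∅ : ℕ) : ℤ)) :
    1 + ∑ x ∈ M, ((degIn G S x : ℤ) - 2) + t ≤ solDim B μ S ∅ := by
  have h1 := sum_degIn_eq_sum_comps_sdiff hM hind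
  have h2 := solDim_sdiff_le (B := B) (μ := μ) S M
  have h3 := sum_card_comps (G := G) (S \ M)
  have h4 := Finset.card_sdiff_add_card_eq_card hM
  rw [← solDim_eq_sum_comps hB] at hm
  rw [Finset.sum_add_distrib, Finset.sum_sub_distrib, ← Finset.mul_sum, ← Nat.cast_sum,
    ← Nat.cast_sum, h3, Finset.sum_const, nsmul_eq_mul] at hc
  rw [Finset.sum_sub_distrib, Finset.sum_const, nsmul_eq_mul, ← Nat.cast_sum]
  generalize ∑ v ∈ S, degIn G S v = s at *
  generalize ∑ x ∈ M, degIn G S x = a at *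
  generalize ∑ K ∈ comps G (S \ M), ∑ v ∈ K, degIn G K v = b at *
  generalize (comps G (S \ M)).card = k at *
  omega

theorem ConnSet.component_term_nonneg {K : Finset V} (hK : ConnSet G K) :
    0 ≤ ((∑ v ∈ K, degIn G K v : ℕ) : ℤ) - 2 * (K.card : ℤ) + 2 := by
  have := hK.two_mul_card_le
  omega

theorem sum_inU (s : Set V) : ∑ K : (G.induce s).ConnectedComponent,
    (if InU K.toSimpleGraph then (1 : ℤ) else 0) =
      {K : (G.induce s).ConnectedComponent | InU K.toSimpleGraph}.ncard := by
  rw [Finset.sum_boole, ← Set.ncard_coe_finset, Finset.coe_filter]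
  simp

theorem component_bounds {s : Set V} {T : Finset V} (hT : ∀ v, v ∈ T ↔ v ∈ s) {t : ℤ}
    (hU : ({K : (G.induce s).ConnectedComponent | InU K.toSimpleGraph}.ncard : ℤ) = t)
    (hK : ∀ K : (G.induce s).ConnectedComponent,
      (InU K.toSimpleGraph ∧ mult (restrict (restrict B s) K.supp) μ = 2) ∨
      (IsPathGraph K.toSimpleGraph ∧ IsEig (restrict (restrict B s) K.supp) μ)) :
    2 * t ≤ ∑ K ∈ comps G T, ((∑ v ∈ K, degIn G K v : ℕ) - 2 * (K.card : ℤ) + 2) ∧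
    (comps G T).card + t ≤ ((∑ K ∈ comps G T, solDim B μ K ∅ : ℕ) : ℤ) := by
  rw [← sum_inU] at hU
  constructor
  · rw [sum_comps_eq_sum_compFin hT, ← hU, Finset.mul_sum]
    refine Finset.sum_le_sum fun K _ => ?_
    by_cases h : InU K.toSimpleGraph
    · rw [if_pos h, ((inU_toSimpleGraph_iff K).1 h).1]
      push_cast
      linarith
    · rw [if_neg h, mul_zero]
      exact (connSet_compFin K).component_term_nonneg
  · rw [Finset.card_eq_sum_ones, sum_comps_eq_sum_compFin hT, sum_comps_eq_sum_compFin hT, ← hU]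
    push_cast
    rw [← Finset.sum_add_distrib]
    refine Finset.sum_le_sum fun K _ => ?_
    rcases hK K with ⟨h1, h2⟩ | ⟨h1, h2⟩
    · rw [if_pos h1, ← mult_restrict_restrict, h2]
      norm_num
    · rw [if_neg h1.not_inU, add_zero]
      exact_mod_cast (isEig_restrict_iff K).1 h2

end LowerBound

/-! ### Each of the four forms attains the bound -/

section Backward

variable {V : Type*} [Fintype V] [Nontrivial V] {G : SimpleGraph V} {B : Matrix V V ℂ} {μ : ℂ}

theorem majorExcess_univ_eq_zero (h : ∀ v, degIn G Finset.univ v ≤ 2) :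
    majorExcess G Finset.univ = 0 :=
  Finset.sum_eq_zero fun v _ => Nat.sub_eq_zero_of_le (h v)

theorem FormA.extremal (hG : G.Connected) (hB : IsMatrixOf G B) (hμ : IsEig B μ)
    (h : FormA G B μ) : solDim B μ Finset.univ ∅ = 1 + majorExcess G Finset.univ := by
  have hS := ConnSet.univ_of_connected hG
  have hs := hμ.star_eq hB.1
  rcases h with h | ⟨hT, hp, hK, hind⟩
  · obtain ⟨h2, v, hv⟩ := h.degIn_le
    have h0 := majorExcess_univ_eq_zero h2
    have h1 := hS.solDim_le_of_pendant (μ := μ) hB (Finset.mem_univ v) hv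
    rw [isEig_iff, mult_eq_solDim_univ] at hμ
    omega
  · have ht : cyclomatic G = 0 := by
      have := (SimpleGraph.isTree_iff_connected_and_card.1 hT).2
      rw [Nat.card_coe_set_eq] at this
      rw [cyclomatic_of_connected hG]
      omega
    set M := Finset.univ.filter fun v => 3 ≤ degIn G Finset.univ v with hM
    have hK' : ∀ C ∈ comps G (Finset.univ \ M), 1 ≤ solDim B μ C ∅ := fun C hC => by
      obtain ⟨K, rfl⟩ := exists_compFin_eq_of_mem_comps mem_compl_majorSet hC
      exact (isEig_restrict_iff K).1 (hK K)
    have hlow := le_solDim_of_independent (μ := μ) (t := 0) hB (Finset.subset_univ M)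
      (fun u hu v hv => hind u (mem_majorSet.2 (Finset.mem_filter.1 hu).2) v
        (mem_majorSet.2 (Finset.mem_filter.1 hv).2))
      (by rw [← ht, two_mul_cyclomatic_univ hG])
      (by
        rw [mul_zero]
        exact Finset.sum_nonneg fun K hK => (mem_comps.1 hK).2.1.component_term_nonneg)
      (by
        rw [add_zero, Finset.card_eq_sum_ones]
        exact_mod_cast Finset.sum_le_sum hK')
    have hq : (majorExcess G Finset.univ : ℤ) = ∑ x ∈ M, ((degIn G Finset.univ x : ℤ) - 2) := by
      rw [majorExcess, Nat.cast_sum, hM, Finset.sum_filter]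
      refine Finset.sum_congr rfl fun v _ => ?_
      split_ifs <;> omega
    have hmaj : ∃ x, 3 ≤ degIn G Finset.univ x := by
      by_contra! hcon
      have h0 := majorExcess_univ_eq_zero fun v => Nat.le_of_lt_succ (hcon v)
      have := two_mul_cyclomatic_add_pendantCount hG
      omega
    obtain ⟨x, hx⟩ := hmaj
    have := hS.solDim_le_of_major hB hs (Finset.mem_univ x) hx
    omega

theorem FormB.extremal (hG : G.Connected) (h : FormB G B μ) :
    solDim B μ Finset.univ ∅ = 1 + majorExcess G Finset.univ := by
  have h3 := two_mul_cyclomatic_add_pendantCount hG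
  rcases h with ⟨hc, h1⟩ | ⟨⟨-, h1, h2⟩, hc, hm⟩
  · rw [mult_eq_solDim_univ] at h1
    rw [h1, majorExcess_univ_eq_zero fun v => (hc.degIn_eq v).le]
  · rw [mult_eq_solDim_univ] at hm
    -- For θ = 1 the identity reads `majorExcess` = p ≤ 1. If it is 0, the graph is a cycle, which
    -- is excluded; otherwise it is 1, matching multiplicity two.
    rcases Nat.eq_zero_or_pos (majorExcess G Finset.univ) with h0 | h0
    · refine absurd (isCycleGraph_of_degIn hG ?_) hc
      rcases ConnSet.exists_degIn_le_one_or h0 with ⟨v, -, hv⟩ | hreg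
      · have hpos := (ConnSet.univ_of_connected hG).degIn_pos
          (by rw [Finset.card_univ]; exact Fintype.one_lt_card) (Finset.mem_univ v)
        have : 0 < pendantCount G := by
          rw [pendantCount_eq_univ, Finset.card_pos]
          exact ⟨v, Finset.mem_filter.2 ⟨Finset.mem_univ v, by omega⟩⟩
        omega
      · exact fun v => hreg v (Finset.mem_univ v)
    · omega

theorem FormC.extremal (hG : G.Connected) (h : FormC G B μ) :
    solDim B μ Finset.univ ∅ = 1 + majorExcess G Finset.univ := by
  obtain ⟨h1, h2, -⟩ := h
  obtain ⟨hE, hmin⟩ : G.edgeSet.ncard = Fintype.card V + 1 ∧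
      ∀ v, 2 ≤ degIn G Finset.univ v := by
    rcases h1 with h | h
    · exact h.ncard_edgeSet
    · exact h.ncard_edgeSet
  have h3 := two_mul_cyclomatic_add_pendantCount hG
  rw [cyclomatic_of_connected hG, hE, Nat.card_eq_fintype_card, pendantCount_eq_univ,
    Finset.filter_eq_empty_iff.2 fun v _ h => by have := hmin v; omega, Finset.card_empty] at h3
  have hq : majorExcess G Finset.univ = 2 := by omega
  obtain ⟨y, hy, hy2, x, hx, hyx⟩ := exists_isCycleVertex_adj_major hG hE hmin hq
  obtain ⟨k1, k2⟩ := h2 y hy (by rw [deg_eq_degIn_univ, hy2]) ⟨x, mem_majorSet.2 hx, hyx⟩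
  rw [← mult_eq_solDim_univ]
  omega

/-- The vertices of a cycle with a single major vertex, this one excepted, form a component of the
graph with that vertex deleted. -/
theorem support_erase_mem_comps {x : V} {c : G.Walk x x} (hc : c.IsCycle)
    (h : ∀ v ∈ c.support, v ≠ x → degIn G Finset.univ v ≤ 2) :
    c.support.toFinset.erase x ∈ comps G (Finset.univ.erase x) := by
  refine mem_comps.2 ⟨Finset.erase_subset_erase x (Finset.subset_univ _),
    (isCycle_support_erase hc).1, fun a ha b hb hab => ?_⟩
  obtain ⟨hax, ha⟩ := Finset.mem_erase.1 ha
  rw [List.mem_toFinset] at ha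
  obtain ⟨s, t, hst, hs, ht⟩ := exists_two_edges_of_isCycle hc ha
  exact Finset.mem_erase.2 ⟨Finset.ne_of_mem_erase hb, List.mem_toFinset.2
    (c.snd_mem_support_of_mem_edges (edge_mem_of_degIn_le_two
      (fun e he => c.edges_subset_edgeSet he) (h a ha hax) hst hs ht hab))⟩

theorem FormD.extremal (hG : G.Connected) (hB : IsMatrixOf G B) (hμ : IsEig B μ)
    (h : FormD G B μ) : solDim B μ Finset.univ ∅ = 1 + majorExcess G Finset.univ := by
  have hS := ConnSet.univ_of_connected hG
  have hs := hμ.star_eq hB.1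
  obtain ⟨⟨m, hm⟩, -, hcyc, hind, hU, hK⟩ := h
  set M := offMajor G Finset.univ with hM
  obtain ⟨hexc, hmul⟩ := component_bounds mem_compl_offCycleMajorSet hU hK
  have hlow := le_solDim_of_independent hB (Finset.subset_univ M)
    (fun u hu v hv => hind u (mem_offCycleMajorSet.2 hu) v (mem_offCycleMajorSet.2 hv))
    (two_mul_cyclomatic_univ hG) hexc hmul
  set X := Finset.univ.filter fun v => 3 ≤ degIn G Finset.univ v ∧ CycAt G Finset.univ v with hX
  have hXc : ∀ x ∈ X, ∃ c : G.Walk x x, c.IsCycle := fun x hx =>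
    cycAt_univ_iff.1 (Finset.mem_filter.1 hx).2.2
  choose! c hc using hXc
  have hdeg : ∀ x ∈ X, degIn G Finset.univ x = 3 ∧
      ∀ v ∈ (c x).support, v ≠ x → degIn G Finset.univ v ≤ 2 := fun x hx => by
    obtain ⟨⟨y, -, hy⟩, h3⟩ := hcyc x (c x) (hc x hx)
    have hxm := mem_majorSet.2 (Finset.mem_filter.1 hx).2.1
    refine ⟨by rw [← deg_eq_degIn_univ]; exact h3 x (c x).start_mem_support hxm,
      fun v hv hvx => ?_⟩
    by_contra hcon
    exact hvx ((hy v ⟨hv, mem_majorSet.2 (by omega)⟩).trans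
      (hy x ⟨(c x).start_mem_support, hxm⟩).symm)
  -- Major vertices on cycles have degree three, and each carries a private cycle, so they
  -- contribute |X| ≤ θ to `majorExcess`. Hence the lower bound with t = θ reaches 1 +
  -- `majorExcess`.
  have hXt : (X.card : ℤ) ≤ cyclomatic G := by
    have := hS.card_private_cycles (Finset.subset_univ X)
      (fun x => (c x).support.toFinset.erase x)
      (fun x hx => support_erase_mem_comps (hc x hx) (hdeg x hx).2)
      (fun x hx => Finset.disjoint_left.2 fun v hv hvX => by
        obtain ⟨hvx, hv⟩ := Finset.mem_erase.1 hv
        have := (hdeg x hx).2 v (List.mem_toFinset.1 hv) hvx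
        have := (Finset.mem_filter.1 hvX).2.1
        omega)
      (fun x hx => (isCycle_support_erase (hc x hx)).2)
    have := two_mul_cyclomatic_univ hG
    omega
  have hq : (majorExcess G Finset.univ : ℤ) =
      ∑ x ∈ M, ((degIn G Finset.univ x : ℤ) - 2) + X.card := by
    have h1 : (X.card : ℤ) = ∑ x ∈ X, ((degIn G Finset.univ x : ℤ) - 2) := by
      rw [Finset.card_eq_sum_ones, Nat.cast_sum]
      exact Finset.sum_congr rfl fun x hx => by rw [(hdeg x hx).1]; norm_num
    have hdisj : Disjoint M X := Finset.disjoint_left.2 fun v hv hvX => by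
      rw [hM, offMajor, Finset.mem_filter] at hv
      exact hv.2.2 (Finset.mem_filter.1 hvX).2.2
    rw [h1, ← Finset.sum_union hdisj, majorExcess, Nat.cast_sum]
    symm
    rw [← Finset.sum_subset (Finset.subset_univ (M ∪ X))]
    · refine Finset.sum_congr rfl fun x hx => ?_
      rw [Finset.mem_union, hM, offMajor, Finset.mem_filter, hX, Finset.mem_filter] at hx
      omega
    · intro x _ hx
      rw [Finset.mem_union, hM, offMajor, Finset.mem_filter, hX, Finset.mem_filter] at hx
      have : ¬ 3 ≤ degIn G Finset.univ x := by tauto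
      omega
  have h3 : 3 ≤ degIn G Finset.univ m := mem_majorSet.1 hm.1
  have := hS.solDim_le_of_major hB hs (Finset.mem_univ m) h3
  omega

end Backward

/-! ### Attaining the bound forces one of the four forms -/

section Forward

variable {V : Type*} [Fintype V] {G : SimpleGraph V} {B : Matrix V V ℂ} {μ : ℂ}

theorem degIn_le_two_of_majorExcess_eq_zero (h0 : majorExcess G Finset.univ = 0) (v : V) :
    degIn G Finset.univ v ≤ 2 :=
  Nat.le_of_sub_eq_zero (Finset.sum_eq_zero_iff.1 h0 v (Finset.mem_univ v))

theorem isPathGraph_or_isCycleGraph (hG : G.Connected) (h0 : majorExcess G Finset.univ = 0) :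
    IsPathGraph G ∨ IsCycleGraph G := by
  have h2 := degIn_le_two_of_majorExcess_eq_zero h0
  rcases ConnSet.exists_degIn_le_one_or h0 with ⟨v, -, hv⟩ | hreg
  · left
    refine isPathGraph_of_degIn hG ?_ h2
    have h3 := (ConnSet.univ_of_connected hG).two_mul_card_le
    have h4 : ∑ v, degIn G Finset.univ v < ∑ v : V, 2 :=
      Finset.sum_lt_sum (fun v _ => h2 v) ⟨v, Finset.mem_univ v, by omega⟩
    obtain ⟨k, hk⟩ := even_sum_degIn (G := G) Finset.univ
    rw [Finset.sum_const, smul_eq_mul, Finset.card_univ] at h4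
    rw [Finset.card_univ] at h3
    omega
  · exact Or.inr (isCycleGraph_of_degIn hG fun v => hreg v (Finset.mem_univ v))

/-- Deleting a cycle vertex of degree two leaves a connected graph. -/
theorem connSet_erase_of_isCycleVertex (hG : G.Connected) {y : V} (hy : IsCycleVertex G y)
    (h2 : degIn G Finset.univ y = 2) : ConnSet G (Finset.univ.erase y) := by
  obtain ⟨C, hC, hCy⟩ := (cycAt_univ_iff.2 hy).exists_comp
  have hS := ConnSet.univ_of_connected hG
  have hall : C = Finset.univ.erase y := by
    refine Finset.Subset.antisymm (mem_comps.1 hC).1 fun v hv => ?_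
    obtain ⟨D, hD, hvD⟩ := exists_mem_comps (G := G) hv
    by_contra hvC
    have hDC : D ≠ C := by
      rintro rfl
      exact hvC hvD
    have h3 := hS.degIn_comps_pos (Finset.mem_univ y) hD
    have h4 := sum_comps_degIn (G := G) Finset.univ y
    rw [← Finset.add_sum_erase _ _ hC,
      ← Finset.add_sum_erase _ _ (Finset.mem_erase.2 ⟨hDC, hD⟩)] at h4
    omega
  rw [← hall]
  exact (mem_comps.1 hC).2.1

theorem excess_term_erase_le {x u : V} (hux : G.Adj u x) (v : V) :
    degIn G (Finset.univ.erase x) v - (if v ∈ ({u} : Finset V) then 1 else 2) ≤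
      degIn G Finset.univ v - 2 := by
  split_ifs with h
  · rw [Finset.mem_singleton] at h
    subst h
    have := degIn_erase_of_adj (Finset.mem_univ x) hux
    omega
  · have := degIn_mono (G := G) (Finset.erase_subset x Finset.univ) v
    omega

theorem excess_erase_le {x u : V} (hux : G.Adj u x) :
    excess G (Finset.univ.erase x) {u} + (degIn G Finset.univ x - 2) ≤
      majorExcess G Finset.univ := by
  rw [majorExcess, ← Finset.sum_erase_add _ _ (Finset.mem_univ x), excess]
  exact Nat.add_le_add_right (Finset.sum_le_sum fun v _ => excess_term_erase_le hux v) _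

/-- The other neighbour u of y absorbs the lost degree as the root, but the major neighbour x loses
one degree with threshold still 2. This gives the strict inequality. -/
theorem excess_erase_lt {y x u : V} (huy : G.Adj u y) (hxy : G.Adj x y) (hux : u ≠ x)
    (hx : 3 ≤ degIn G Finset.univ x) :
    excess G (Finset.univ.erase y) {u} < majorExcess G Finset.univ := by
  refine lt_of_lt_of_le (Finset.sum_lt_sum (fun v _ => excess_term_erase_le huy v)
    ⟨x, Finset.mem_erase.2 ⟨hxy.ne, Finset.mem_univ x⟩, ?_⟩)
    (Finset.sum_le_sum_of_subset (Finset.erase_subset y Finset.univ))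
  rw [if_neg (by rw [Finset.mem_singleton]; exact hux.symm)]
  have := degIn_erase_of_adj (Finset.mem_univ y) hxy
  omega

theorem exists_adj_ne {y x : V} (h2 : 2 ≤ degIn G Finset.univ y) : ∃ u, u ≠ x ∧ G.Adj y u := by
  obtain ⟨u, hu, hux⟩ := Finset.exists_mem_ne (s := Finset.univ.filter (G.Adj y)) h2 x
  exact ⟨u, hux, (Finset.mem_filter.1 hu).2⟩

/-- The multiplicity is 3, so interlacing leaves at least 2 after a deletion. The remainder is
connected, and its rooted bound is at most 2. -/
theorem formC_of_extremal (hG : G.Connected) (hB : IsMatrixOf G B)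
    (hmin : ∀ v, 2 ≤ degIn G Finset.univ v) (hq : majorExcess G Finset.univ = 2)
    (hext : solDim B μ Finset.univ ∅ = 1 + majorExcess G Finset.univ) : FormC G B μ := by
  refine ⟨isInfinityGraph_or_isThetaGraph hG hmin hq, ?_, ?_⟩
  · rintro y hy hy2 ⟨x, hx, hyx⟩
    rw [deg_eq_degIn_univ] at hy2
    rw [mem_majorSet] at hx
    obtain ⟨u, hux, hyu⟩ := exists_adj_ne (x := x) hy2.ge
    have h1 := (connSet_erase_of_isCycleVertex hG hy hy2).solDim_le_root (μ := μ) hB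
      (Finset.mem_erase.2 ⟨hyu.ne', Finset.mem_univ u⟩)
    have h2 := excess_erase_lt hyu.symm hyx.symm hux hx
    have h3 := solDim_le_erase_add_one (B := B) (μ := μ) Finset.univ y
    rw [mult_restrict_compl_singleton, mult_eq_solDim_univ]
    omega
  · intro h x hx
    rw [mem_majorSet] at hx
    obtain ⟨u, -, hxu⟩ := exists_adj_ne (x := x) (hmin x)
    have h1 := (h.connSet_erase x).solDim_le_root (μ := μ) hB
      (Finset.mem_erase.2 ⟨hxu.ne', Finset.mem_univ u⟩)
    have h2 := excess_erase_le hxu.symm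
    have h3 := solDim_le_erase_add_one (B := B) (μ := μ) Finset.univ x
    rw [mult_restrict_compl_singleton]
    omega

theorem GoodComp.one_le_solDim {S K : Finset V} (h : GoodComp G B μ S K) :
    1 ≤ solDim B μ K ∅ := by
  rcases h with ⟨-, h, -⟩ | ⟨-, h, -⟩ <;> omega

theorem GoodComp.sum_le_one {S K : Finset V} (h : GoodComp G B μ S K) :
    ∑ v ∈ K, (degIn G S v - 2) ≤ 1 := by
  rcases h with ⟨-, -, h⟩ | ⟨-, -, h⟩ <;> omega

theorem compFin_mem_comps_of {s : Set V} {T : Finset V} (hT : ∀ v, v ∈ T ↔ v ∈ s)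
    (K : (G.induce s).ConnectedComponent) : compFin K ∈ comps G T := by
  have h : T = s.toFinset := by
    ext v
    rw [hT, Set.mem_toFinset]
  exact h ▸ compFin_mem_comps K

theorem inU_of_sum_degIn {s : Set V} {K : (G.induce s).ConnectedComponent}
    (h1 : ∑ v ∈ compFin K, degIn G (compFin K) v = 2 * (compFin K).card)
    (h2 : ∑ v ∈ compFin K, (degIn G Finset.univ v - 2) = 1) : InU K.toSimpleGraph := by
  refine (inU_toSimpleGraph_iff K).2 ⟨h1, ?_⟩
  have hK := connSet_compFin K
  have hcard : 2 ≤ (compFin K).card := by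
    by_contra hlt
    have hpos := hK.1.card_pos
    obtain ⟨v, hv⟩ := Finset.card_eq_one.1 (show (compFin K).card = 1 by omega)
    rw [hv] at h1
    simp [degIn, Finset.filter_singleton] at h1
  have h3 := sum_degIn_add_pendant hK hcard
  have h4 : majorExcess G (compFin K) ≤ 1 := by
    rw [← h2]
    exact Finset.sum_le_sum fun v _ => Nat.sub_le_sub_right (degIn_mono (Finset.subset_univ _) v) 2
  omega

theorem GoodComp.inU_or_isPathGraph {s : Set V} {K : (G.induce s).ConnectedComponent}
    (h : GoodComp G B μ Finset.univ (compFin K)) :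
    (InU K.toSimpleGraph ∧ mult (restrict (restrict B s) K.supp) μ = 2) ∨
      (IsPathGraph K.toSimpleGraph ∧ IsEig (restrict (restrict B s) K.supp) μ) := by
  rcases id h with ⟨h1, -, h3⟩ | ⟨h1, h2, h3⟩
  · refine Or.inr ⟨isPathGraph_toSimpleGraph K h1 fun v hv => ?_,
      (isEig_restrict_iff K).2 h.one_le_solDim⟩
    have h4 := Finset.sum_eq_zero_iff.1 h3 v hv
    have h5 := degIn_mono (G := G) (Finset.subset_univ (compFin K)) v
    omega
  · exact Or.inl ⟨inU_of_sum_degIn h1 h3, by rw [mult_restrict_restrict, h2]⟩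

/-- Each summand is 0 for a path piece and 2 for a unicyclic one, so the preserved sum counts the
unicyclic pieces. -/
theorem ncard_inU_eq {s : Set V} {T : Finset V} (hT : ∀ v, v ∈ T ↔ v ∈ s) {t : ℤ}
    (h : ∀ K ∈ comps G T, GoodComp G B μ Finset.univ K)
    (hsum : ∑ K ∈ comps G T, ((∑ v ∈ K, degIn G K v : ℕ) - 2 * (K.card : ℤ) + 2) = 2 * t) :
    ({K : (G.induce s).ConnectedComponent | InU K.toSimpleGraph}.ncard : ℤ) = t := by
  have h2 : ∀ K : (G.induce s).ConnectedComponent,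
      ((∑ v ∈ compFin K, degIn G (compFin K) v : ℕ) - 2 * ((compFin K).card : ℤ) + 2) =
        2 * if InU K.toSimpleGraph then (1 : ℤ) else 0 := fun K => by
    rcases h _ (compFin_mem_comps_of hT K) with hg | hg
    · rw [if_neg fun hU => by have := ((inU_toSimpleGraph_iff K).1 hU).1; omega]
      omega
    · rw [if_pos (inU_of_sum_degIn hg.1 hg.2.2), hg.1]
      push_cast
      linarith
  rw [sum_comps_eq_sum_compFin hT, Finset.sum_congr rfl fun K _ => h2 K, ← Finset.mul_sum,
    sum_inU] at hsum
  linarith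

/-- A cycle whose vertices have total excess degree at most one has exactly one major vertex, of
degree three, unless it contains all vertices. -/
theorem existsUnique_major_of_isCycle (hG : G.Connected) {v : V} {c : G.Walk v v} (hc : c.IsCycle)
    (hle : ∑ u ∈ c.support.toFinset, (degIn G Finset.univ u - 2) ≤ 1) {m : V}
    (hm : m ∉ c.support) :
    (∃! x, x ∈ c.support ∧ x ∈ majorSet G) ∧
      ∀ x, x ∈ c.support → x ∈ majorSet G → deg G x = 3 := by
  have hex : ∃ x ∈ c.support, 3 ≤ degIn G Finset.univ x := by
    by_contra! hcon
    refine hm (mem_of_adj_closed hG (U := {x | x ∈ c.support}) ⟨v, c.start_mem_support⟩ ?_ m)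
    intro x hx y hxy
    obtain ⟨s, t, hst, hs, ht⟩ := exists_two_edges_of_isCycle hc hx
    exact c.snd_mem_support_of_mem_edges (edge_mem_of_degIn_le_two
      (fun e he => c.edges_subset_edgeSet he) (Nat.le_of_lt_succ (hcon x hx)) hst hs ht hxy)
  obtain ⟨x, hx, hx3⟩ := hex
  refine ⟨⟨x, ⟨hx, mem_majorSet.2 hx3⟩, ?_⟩, ?_⟩
  · rintro y ⟨hy, hy3⟩
    rw [mem_majorSet] at hy3
    by_contra hyx
    rw [← Finset.add_sum_erase _ _ (List.mem_toFinset.2 hx),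
      ← Finset.add_sum_erase _ _ (Finset.mem_erase.2 ⟨hyx, List.mem_toFinset.2 hy⟩)] at hle
    omega
  · intro y hy hy3
    rw [mem_majorSet] at hy3
    rw [← Finset.add_sum_erase _ _ (List.mem_toFinset.2 hy)] at hle
    rw [deg_eq_degIn_univ]
    omega

theorem exists_comp_of_isCycle {v : V} {c : G.Walk v v} (hc : c.IsCycle) :
    ∃ K ∈ comps G (Finset.univ \ offMajor G Finset.univ), c.support.toFinset ⊆ K := by
  have hsub : c.support.toFinset ⊆ Finset.univ \ offMajor G Finset.univ := fun u hu => by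
    rw [List.mem_toFinset] at hu
    rw [mem_compl_offCycleMajorSet]
    exact fun h => h.2 ⟨c.rotate u hu, hc.rotate hu⟩
  have hv : v ∈ c.support.toFinset := List.mem_toFinset.2 c.start_mem_support
  obtain ⟨K, hK, hvK⟩ := exists_mem_comps (G := G) (hsub hv)
  exact ⟨K, hK, (connSet_support c).subset_of_closedIn hsub (mem_comps.1 hK).2.2
    ⟨v, Finset.mem_inter.2 ⟨hv, hvK⟩⟩⟩

theorem formD_of_goodComp (hG : G.Connected) (hne : (offMajor G Finset.univ).Nonempty)
    (hθ : 1 ≤ cyclomatic G)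
    (hind : ∀ u ∈ offMajor G Finset.univ, ∀ v ∈ offMajor G Finset.univ, ¬ G.Adj u v)
    (hgood : ∀ K ∈ comps G (Finset.univ \ offMajor G Finset.univ), GoodComp G B μ Finset.univ K)
    (hsum : ∑ K ∈ comps G (Finset.univ \ offMajor G Finset.univ),
      ((∑ v ∈ K, degIn G K v : ℕ) - 2 * (K.card : ℤ) + 2) = 2 * cyclomatic G) :
    FormD G B μ := by
  obtain ⟨m, hm⟩ := hne
  refine ⟨⟨m, mem_offCycleMajorSet.2 hm⟩, hθ, fun v c hc => ?_,
    fun u hu v hv => hind u (mem_offCycleMajorSet.1 hu) v (mem_offCycleMajorSet.1 hv),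
    ncard_inU_eq mem_compl_offCycleMajorSet hgood hsum,
    fun K => (hgood _ (compFin_mem_comps_of mem_compl_offCycleMajorSet K)).inU_or_isPathGraph⟩
  obtain ⟨K, hK, hcK⟩ := exists_comp_of_isCycle hc
  refine existsUnique_major_of_isCycle hG hc
    ((Finset.sum_le_sum_of_subset hcK).trans (hgood K hK).sum_le_one) (m := m) fun hmc => ?_
  exact (Finset.mem_sdiff.1 ((mem_comps.1 hK).1 (hcK (List.mem_toFinset.2 hmc)))).2 hm

theorem formA_of_goodComp [Nontrivial V] (hG : G.Connected)
    (hne : (offMajor G Finset.univ).Nonempty) (hθ : cyclomatic G = 0)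
    (hind : ∀ u ∈ offMajor G Finset.univ, ∀ v ∈ offMajor G Finset.univ, ¬ G.Adj u v)
    (hgood : ∀ K ∈ comps G (Finset.univ \ offMajor G Finset.univ), GoodComp G B μ Finset.univ K) :
    FormA G B μ := by
  have htree : G.IsTree := by
    rw [cyclomatic_of_connected hG] at hθ
    refine SimpleGraph.isTree_iff_connected_and_card.2 ⟨hG, ?_⟩
    rw [Nat.card_coe_set_eq]
    omega
  have hM : majorSet G = offCycleMajorSet G := by
    ext v
    exact ⟨fun h => ⟨h, fun ⟨c, hc⟩ => htree.isAcyclic c hc⟩, fun h => h.1⟩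
  obtain ⟨m, hm⟩ := hne
  have hp : 3 ≤ pendantCount G := by
    have h1 := two_mul_cyclomatic_add_pendantCount hG
    have h2 : 3 ≤ degIn G Finset.univ m := (Finset.mem_filter.1 hm).2.1
    have h3 : degIn G Finset.univ m - 2 ≤ majorExcess G Finset.univ :=
      Finset.single_le_sum (f := fun v => degIn G Finset.univ v - 2) (fun _ _ => Nat.zero_le _)
        (Finset.mem_univ m)
    omega
  refine Or.inr ⟨htree, hp, fun K => (isEig_restrict_iff K).2
    (hgood _ (compFin_mem_comps_of ?_ K)).one_le_solDim, ?_⟩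
  · rw [hM]
    exact mem_compl_offCycleMajorSet
  · rw [hM]
    exact fun u hu v hv => hind u (mem_offCycleMajorSet.1 hu) v (mem_offCycleMajorSet.1 hv)

theorem forms_of_extremal [Nontrivial V] (hG : G.Connected) (hB : IsMatrixOf G B)
    (hμ : star μ = μ) (hext : solDim B μ Finset.univ ∅ = 1 + majorExcess G Finset.univ) :
    FormA G B μ ∨ FormB G B μ ∨ FormC G B μ ∨ FormD G B μ := by
  have hS := ConnSet.univ_of_connected hG
  have hid := two_mul_cyclomatic_add_pendantCount hG
  rcases Nat.eq_zero_or_pos (majorExcess G Finset.univ) with h0 | h0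
  · rcases isPathGraph_or_isCycleGraph hG h0 with h | h
    · exact Or.inl (Or.inl h)
    · exact Or.inr (Or.inl (Or.inl ⟨h, by rw [mult_eq_solDim_univ]; omega⟩))
  rcases (offMajor G Finset.univ).eq_empty_or_nonempty with hM | hM
  · have hmaj : ∃ x ∈ Finset.univ, 3 ≤ degIn G Finset.univ x := by
      by_contra! hcon
      exact h0.ne' (majorExcess_univ_eq_zero fun v =>
        Nat.le_of_lt_succ (hcon v (Finset.mem_univ v)))
    have hcyc : ∀ x ∈ Finset.univ, 3 ≤ degIn G Finset.univ x → CycAt G Finset.univ x := by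
      intro x hx h3
      by_contra hcon
      exact Finset.notMem_empty x (hM ▸ Finset.mem_filter.2 ⟨hx, h3, hcon⟩)
    rcases hS.extremal_of_cycAt hB hμ hext hmaj hcyc with ⟨hq, hp⟩ | ⟨hq, hp⟩
    · rw [← pendantCount_eq_univ] at hp
      refine Or.inr (Or.inl (Or.inr ⟨⟨hG, by omega, hp.le⟩, fun hc => ?_, ?_⟩))
      · rw [majorExcess_univ_eq_zero fun v => (hc.degIn_eq v).le] at hq
        omega
      · rw [mult_eq_solDim_univ]
        omega
    · refine Or.inr (Or.inr (Or.inl (formC_of_extremal hG hB (fun v => ?_) hq hext)))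
      have h1 := hS.degIn_pos (by rw [Finset.card_univ]; exact Fintype.one_lt_card)
        (Finset.mem_univ v)
      have h2 := Finset.filter_eq_empty_iff.1 (Finset.card_eq_zero.1 hp) (Finset.mem_univ v)
      omega
  · obtain ⟨hgood, hsum⟩ := hS.goodComp_of_extremal hB hμ _ hext (Or.inl hM)
    have hind : ∀ u ∈ offMajor G Finset.univ, ∀ v ∈ offMajor G Finset.univ, ¬ G.Adj u v :=
      fun u hu v hv => hS.offMajor_not_adj hB hμ hext hu hv
    rw [← two_mul_cyclomatic_univ hG] at hsum
    have hθ : 0 ≤ 2 * cyclomatic G := hsum ▸ Finset.sum_nonneg fun K hK =>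
      (mem_comps.1 hK).2.1.component_term_nonneg
    rcases eq_or_lt_of_le (show 0 ≤ cyclomatic G by omega) with h | h
    · exact Or.inl (formA_of_goodComp hG hM h.symm hind hgood)
    · exact Or.inr (Or.inr (Or.inr (formD_of_goodComp hG hM h hind hgood hsum)))

end Forward

end HermitianGraph

theorem theorem4p5 {V : Type*} [Finite V] [Nontrivial V] (G : SimpleGraph V) (hG : G.Connected)
    (B : Matrix V V ℂ) (hB : HermitianGraph.IsMatrixOf G B)
    (μ : ℂ) (hμ : HermitianGraph.IsEig B μ) :
    (HermitianGraph.mult B μ : ℤ)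
        = 2 * HermitianGraph.cyclomatic G + (HermitianGraph.pendantCount G : ℤ) - 1 ↔
      HermitianGraph.FormA G B μ ∨ HermitianGraph.FormB G B μ ∨
      HermitianGraph.FormC G B μ ∨ HermitianGraph.FormD G B μ := by
  have := Fintype.ofFinite V
  rw [HermitianGraph.mult_eq_iff_extremal hG]
  refine ⟨HermitianGraph.forms_of_extremal hG hB (hμ.star_eq hB.1), ?_⟩
  rintro (h | h | h | h)
  · exact h.extremal hG hB hμ
  · exact h.extremal hG
  · exact h.extremal hG
  · exact h.extremal hG hB hμ
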